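/- Let $T>0$ and let $y,z:[0,T]\to\mathbb R$ be continuous with $y<z$ on $[0,T]$, continuously differentiable on $(0,T]$ (one-sidedly at $T$) with $y',z'$ integrable on $(0,T)$. Let $f^\pm:[0,T]\to\mathbb R$ be continuous, let $U_0$ be integrable on $(y(0),z(0))$, and let $\Phi,\Psi$ be integrable on $(0,T)$. Put $l(\tau)=z(\tau)-y(\tau)$ and, for $n\in\mathbb Z$, $s<\tau$, $$\Upsilon_n(x,\tau\,|\,\xi,s)=\frac{1}{2\sqrt{\pi(\tau-s)}}\left[e^{-\frac{(2nl(\tau)+x-\xi)^2}{4(\tau-s)}}-e^{-\frac{(2nl(\tau)+x+\xi-2y(\tau))^2}{4(\tau-s)}}\right],$$ $$\Lambda_n(x,\tau\,|\,\xi,s)=\frac{x-\xi+2nl(\tau)}{4\sqrt{\pi(\tau-s)^3}}e^{-\frac{(2nl(\tau)+x-\xi)^2}{4(\tau-s)}}+\frac{x+\xi-2y(\tau)+2nl(\tau)}{4\sqrt{\pi(\tau-s)^3}}e^{-\frac{(2nl(\tau)+x+\xi-2y(\tau))^2}{4(\tau-s)}},$$ $$I_n(\tau,x)=\int_{y(0)}^{z(0)}U_0(\xi)\Upsilon_n(x,\tau|\xi,0)\,d\xi+\int_0^\tau[\Phi(s)+f^+(s)z'(s)]\Upsilon_n(x,\tau|z(s),s)\,ds+\int_0^\tau[\Psi(s)-f^-(s)y'(s)]\Upsilon_n(x,\tau|y(s),s)\,ds+\int_0^\tau\bigl[f^-(s)\Lambda_n(x,\tau|y(s),s)-f^+(s)\Lambda_n(x,\tau|z(s),s)\bigr]ds.$$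 For $n\ge1$ put $\omega_n=\pi n/l(\tau)$, $$\beta(\tau,s,n)=f^-(s)\bigl(\omega_n\cos(\omega_n[y(s)-y(\tau)])-y'(s)\sin(\omega_n[y(s)-y(\tau)])\bigr)-f^+(s)\bigl(\omega_n\cos(\omega_n[z(s)-y(\tau)])-z'(s)\sin(\omega_n[z(s)-y(\tau)])\bigr),$$ $$F_n(\tau,x)=\frac{2}{l(\tau)}\sin(\omega_n[x-y(\tau)])\Bigl\{e^{-\omega_n^2\tau}\int_{y(0)}^{z(0)}U_0(\xi)\sin(\omega_n[\xi-y(\tau)])\,d\xi+\int_0^\tau e^{-\omega_n^2(\tau-s)}\bigl[\Phi(s)\sin(\omega_n[z(s)-y(\tau)])+\Psi(s)\sin(\omega_n[y(s)-y(\tau)])+\beta(\tau,s,n)\bigr]ds\Bigr\}.$$ Then: 1. For every $\tau\in(0,T]$ and $x\in(y(\tau),z(\tau))$, all the integrals above converge absolutely, $\sum_{n\in\mathbb Z}I_n(\tau,x)$ converges absolutely, the Fourier series $\sum_{n\ge1}F_n(\tau,x)=\lim_{N\to\infty}\sum_{n=1}^NF_n(\tau,x)$ converges, and $$\sum_{n=1}^\infty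 F_n(\tau,x)=\sum_{n=-\infty}^\infty I_n(\tau,x)=:\tilde U(\tau,x).$$ 2. For every $\tau\in(0,T]$, $\lim_{x\to y(\tau)+0}\tilde U(\tau,x)=f^-(\tau)$ and $\lim_{x\to z(\tau)-0}\tilde U(\tau,x)=f^+(\tau)$. 3. Let $U$ be a bounded classical solution of $U_\tau=U_{xx}$ in $\{0<\tau<T,\ y(\tau)<x<z(\tau)\}$ with $U(\tau,y(\tau))=f^-(\tau)$, $U(\tau,z(\tau))=f^+(\tau)$ for $0<\tau\le T$, initial value $U_0$, and $\Psi(\tau)=-U_x(\tau,y(\tau))$, $\Phi(\tau)=U_x(\tau,z(\tau))$ for $0<\tau<T$; that is: $U$ is bounded and continuous on $\{0<\tau\le T,\ y(\tau)\le x\le z(\tau)\}$; $U_\tau=U_{xx}$ holds in the open region with $U_{xx}$ continuous there; $U_x$ exists (one-sidedly on the boundaries) and is continuous on $\{0<\tau<T,\ y(\tau)\le x\le z(\tau)\}$; and $U(\tau,x)\to U_0(x)$ as $\tau\downarrow0$ for almost every $x\in(y(0),z(0))$. Then for every $\tau\in(0,T]$ and $x\in(y(\tau),z(\tau))$ $$U(\tau,x)=\sum_{n=-\infty}^{\infty}I_n(\tau,x)=\sum_{n=1}^\infty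 F_n(\tau,x).$$ -/

import Mathlib

open Real Set Filter Topology MeasureTheory

noncomputable section

/-- The functions entering the moving-boundary problem: the boundaries `y < z` and their time
derivatives `dy`, `dz`, the boundary values `fm` (at `x = y`) and `fp` (at `x = z`), the initial
value `U0`, and the two boundary gradients `Φ`, `Ψ`. What is required of them is stated in
`BarrierData.Admissible` and `BarrierData.IsSolution`. -/
structure BarrierData where
  y : ℝ → ℝ
  z : ℝ → ℝ
  dy : ℝ → ℝ
  dz : ℝ → ℝ
  fm : ℝ → ℝ
  fp : ℝ → ℝ
  U0 : ℝ → ℝ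
  Φ : ℝ → ℝ
  Ψ : ℝ → ℝ

namespace BarrierData

/-- Regularity of the data on the time interval `[0, T]`. -/
structure Admissible (D : BarrierData) (T : ℝ) : Prop where
  y_lt_z : ∀ t ∈ Icc 0 T, D.y t < D.z t
  y_cont : ContinuousOn D.y (Icc 0 T)
  z_cont : ContinuousOn D.z (Icc 0 T)
  y_deriv : ∀ t ∈ Ioc 0 T, HasDerivWithinAt D.y (D.dy t) (Icc 0 T) t
  z_deriv : ∀ t ∈ Ioc 0 T, HasDerivWithinAt D.z (D.dz t) (Icc 0 T) t
  dy_cont : ContinuousOn D.dy (Ioc 0 T)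
  dz_cont : ContinuousOn D.dz (Ioc 0 T)
  dy_int : IntervalIntegrable D.dy volume 0 T
  dz_int : IntervalIntegrable D.dz volume 0 T
  fm_cont : ContinuousOn D.fm (Icc 0 T)
  fp_cont : ContinuousOn D.fp (Icc 0 T)
  U0_int : IntervalIntegrable D.U0 volume (D.y 0) (D.z 0)
  Φ_int : IntervalIntegrable D.Φ volume 0 T
  Ψ_int : IntervalIntegrable D.Ψ volume 0 T

/-- `U t x` is a bounded classical solution of `U_t = U_xx` for `0 < t < T`, `y t < x < z t`, with
boundary values `fm`, `fp`, initial value `U0`, and boundary gradients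
`U_x (t, y t) = -Ψ t`, `U_x (t, z t) = Φ t`. Nothing is asked at the two corners
`(0, y 0)`, `(0, z 0)`, so the initial and boundary values need not match there. -/
structure IsSolution (D : BarrierData) (T : ℝ) (U : ℝ → ℝ → ℝ) : Prop where
  cont : ContinuousOn (fun p : ℝ × ℝ => U p.1 p.2)
    {p | p.1 ∈ Ioc 0 T ∧ p.2 ∈ Icc (D.y p.1) (D.z p.1)}
  bounded : ∃ C, ∀ t ∈ Ioc 0 T, ∀ x ∈ Icc (D.y t) (D.z t), |U t x| ≤ C
  initial : ∀ᵐ x ∂(volume.restrict (Ioo (D.y 0) (D.z 0))),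
    Tendsto (fun t => U t x) (𝓝[>] 0) (𝓝 (D.U0 x))
  lower : ∀ t ∈ Ioc 0 T, U t (D.y t) = D.fm t
  upper : ∀ t ∈ Ioc 0 T, U t (D.z t) = D.fp t
  heat : ∃ Ux Uxx : ℝ → ℝ → ℝ,
    (∀ t ∈ Ioo 0 T, ∀ x ∈ Icc (D.y t) (D.z t),
      HasDerivWithinAt (fun x' => U t x') (Ux t x) (Icc (D.y t) (D.z t)) x) ∧
    (∀ t ∈ Ioo 0 T, ∀ x ∈ Ioo (D.y t) (D.z t),
      HasDerivAt (fun x' => Ux t x') (Uxx t x) x ∧ HasDerivAt (fun t' => U t' x) (Uxx t x) t) ∧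
    ContinuousOn (fun p : ℝ × ℝ => Ux p.1 p.2)
      {p | p.1 ∈ Ioo 0 T ∧ p.2 ∈ Icc (D.y p.1) (D.z p.1)} ∧
    ContinuousOn (fun p : ℝ × ℝ => Uxx p.1 p.2)
      {p | p.1 ∈ Ioo 0 T ∧ p.2 ∈ Ioo (D.y p.1) (D.z p.1)} ∧
    (∀ t ∈ Ioo 0 T, Ux t (D.y t) = -D.Ψ t ∧ Ux t (D.z t) = D.Φ t)

/-- The width `l τ = z τ - y τ`. -/
def l (D : BarrierData) (τ : ℝ) : ℝ := D.z τ - D.y τ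

/-- The kernel `Υ_n (x, τ | ξ, s)`. -/
def Upsilon (D : BarrierData) (n : ℤ) (x τ ξ s : ℝ) : ℝ :=
  1 / (2 * √(π * (τ - s))) *
    (exp (-(2 * n * D.l τ + x - ξ) ^ 2 / (4 * (τ - s)))
      - exp (-(2 * n * D.l τ + x + ξ - 2 * D.y τ) ^ 2 / (4 * (τ - s))))

/-- The kernel `Λ_n (x, τ | ξ, s)`. -/
def Lam (D : BarrierData) (n : ℤ) (x τ ξ s : ℝ) : ℝ :=
  (x - ξ + 2 * n * D.l τ) / (4 * √(π * (τ - s) ^ 3)) *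
      exp (-(2 * n * D.l τ + x - ξ) ^ 2 / (4 * (τ - s)))
    + (x + ξ - 2 * D.y τ + 2 * n * D.l τ) / (4 * √(π * (τ - s) ^ 3)) *
      exp (-(2 * n * D.l τ + x + ξ - 2 * D.y τ) ^ 2 / (4 * (τ - s)))

/-- The `n`-th summand of the method-of-images series. -/
def imageTerm (D : BarrierData) (τ x : ℝ) (n : ℤ) : ℝ :=
  (∫ ξ in (D.y 0)..(D.z 0), D.U0 ξ * D.Upsilon n x τ ξ 0)
    + (∫ s in (0)..τ, (D.Φ s + D.fp s * D.dz s) * D.Upsilon n x τ (D.z s) s)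
    + (∫ s in (0)..τ, (D.Ψ s - D.fm s * D.dy s) * D.Upsilon n x τ (D.y s) s)
    + ∫ s in (0)..τ, (D.fm s * D.Lam n x τ (D.y s) s - D.fp s * D.Lam n x τ (D.z s) s)

/-- All integrals in the `n`-th summand of the method-of-images series converge absolutely. -/
def ImageIntegrable (D : BarrierData) (τ x : ℝ) (n : ℤ) : Prop :=
  IntervalIntegrable (fun ξ => D.U0 ξ * D.Upsilon n x τ ξ 0) volume (D.y 0) (D.z 0) ∧
  IntervalIntegrable (fun s => (D.Φ s + D.fp s * D.dz s) * D.Upsilon n x τ (D.z s) s)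
    volume 0 τ ∧
  IntervalIntegrable (fun s => (D.Ψ s - D.fm s * D.dy s) * D.Upsilon n x τ (D.y s) s)
    volume 0 τ ∧
  IntervalIntegrable
    (fun s => D.fm s * D.Lam n x τ (D.y s) s - D.fp s * D.Lam n x τ (D.z s) s) volume 0 τ

/-- The frequency `π n / l τ`. -/
def freq (D : BarrierData) (τ : ℝ) (n : ℕ) : ℝ := π * n / D.l τ

/-- The boundary-value term `β (τ, s, n)` of the Fourier form. -/
def beta (D : BarrierData) (τ s : ℝ) (n : ℕ) : ℝ :=
  D.fm s * (D.freq τ n * cos (D.freq τ n * (D.y s - D.y τ))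
      - D.dy s * sin (D.freq τ n * (D.y s - D.y τ)))
    - D.fp s * (D.freq τ n * cos (D.freq τ n * (D.z s - D.y τ))
      - D.dz s * sin (D.freq τ n * (D.z s - D.y τ)))

/-- The time integrand in the `n`-th coefficient of the Fourier form. -/
def fourierIntegrand (D : BarrierData) (τ : ℝ) (n : ℕ) (s : ℝ) : ℝ :=
  exp (-(D.freq τ n) ^ 2 * (τ - s)) *
    (D.Φ s * sin (D.freq τ n * (D.z s - D.y τ)) + D.Ψ s * sin (D.freq τ n * (D.y s - D.y τ))
      + D.beta τ s n)

/-- The `n`-th summand (`n ≥ 1`) of the Fourier form. -/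
def fourierTerm (D : BarrierData) (τ x : ℝ) (n : ℕ) : ℝ :=
  2 / D.l τ * sin (D.freq τ n * (x - D.y τ)) *
    (exp (-(D.freq τ n) ^ 2 * τ) *
        (∫ ξ in (D.y 0)..(D.z 0), D.U0 ξ * sin (D.freq τ n * (ξ - D.y τ)))
      + ∫ s in (0)..τ, D.fourierIntegrand τ n s)

/-- The integrals in the `n`-th summand of the Fourier form converge absolutely. -/
def FourierIntegrable (D : BarrierData) (τ : ℝ) (n : ℕ) : Prop :=
  IntervalIntegrable (fun ξ => D.U0 ξ * sin (D.freq τ n * (ξ - D.y τ))) volume (D.y 0) (D.z 0) ∧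
  IntervalIntegrable (D.fourierIntegrand τ n) volume 0 τ

end BarrierData

end

/-! Both series arise from one linear functional `Rep`, a sum of five integrals: over the initial
interval, two single-layer and two double-layer integrals along the moving boundaries. The `n`-th
image term is `Rep` of a difference of two Gaussian sources, centred at `x + 2nl` and at its mirror
image in `y(τ)` (`imageKer_eq`). The `n`-th Fourier term is `Rep` of a sine mode
(`fourierTerm_eq_Rep`). At each fixed source point with `s < τ` the two families of kernels have the
same sum by Poisson summation (`hasSum_fourierKer`), so the equality of the series is a matter of
dominated convergence.

The domination rests on one geometric fact (`exists_curve_point`): since `y` and `z` are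
differentiable at `τ > 0`, the boundary points at time `s` lie within `A (τ - s)` of those at time
`τ`. A source centre away from `y(τ)` and `z(τ)` is therefore separated from the curves either in
space or in time, which tames the Gaussian singularity (`exists_gauss_bound`) and gives summable
bounds over the images. The Fourier terms have no such absolute bounds; their partial sums are
bounded through Abel summation (`exists_fourier_bound`).

As `x` tends to `y(τ)`, only the double layer of the image `n = 0` along `y` is singular. Freezing
its boundary point at `y(τ)` leaves the explicit kernel `2 * gaussQ (τ - s) (x - y τ)`, whose
integral against `f⁻` tends to `f⁻(τ)` (`tendsto_layer`). The remainder is dominated and tends to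
zero pointwise, because every sine mode vanishes at `y(τ)`. The upper boundary follows by reflecting
`x` to `-x`.

For a solution `U`, Green's identity with a Gaussian source centred at `c` shows that `Rep` of that
source is the limit, as `s` increases to `τ`, of the integral of `U` against it (`Rep_ctr`). This is
`U(τ, c)` for `c` inside the strip and `0` for `c` outside. Among all image centres only `x` lies
inside, so `I_0 = U` and every other image term vanishes (`imageTerm_eq`). No uniqueness theorem for
the heat equation enters. -/

noncomputable section

/-! ### The Gaussian kernel and its derivatives -/

/-- The heat kernel at time `σ`. -/
def gaussK (σ u : ℝ) : ℝ := 1 / (2 * √(π * σ)) * exp (-u ^ 2 / (4 * σ))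

/-- Minus the space derivative of the heat kernel. -/
def gaussQ (σ u : ℝ) : ℝ := u / (4 * √(π * σ ^ 3)) * exp (-u ^ 2 / (4 * σ))

/-- Minus the second space derivative of the heat kernel. -/
def gaussR (σ u : ℝ) : ℝ := (1 / (2 * σ) - u ^ 2 / (4 * σ ^ 2)) * gaussK σ u

lemma gaussK_neg (σ u : ℝ) : gaussK σ (-u) = gaussK σ u := by simp [gaussK]

lemma gaussQ_neg (σ u : ℝ) : gaussQ σ (-u) = -gaussQ σ u := by simp [gaussQ, neg_div]

lemma gaussK_nonneg (σ u : ℝ) : 0 ≤ gaussK σ u := by unfold gaussK; positivity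

lemma sqrt_pi_mul_cube {σ : ℝ} (hσ : 0 ≤ σ) : √(π * σ ^ 3) = σ * √(π * σ) := by
  rw [show π * σ ^ 3 = σ ^ 2 * (π * σ) by ring, Real.sqrt_mul (by positivity), Real.sqrt_sq hσ]

lemma gaussQ_eq {σ : ℝ} (hσ : 0 < σ) (u : ℝ) : gaussQ σ u = u / (2 * σ) * gaussK σ u := by
  have : 0 < √(π * σ) := Real.sqrt_pos.2 (by positivity)
  rw [gaussQ, gaussK, sqrt_pi_mul_cube hσ.le]
  field_simp
  norm_num

lemma hasDerivAt_gaussK {σ : ℝ} (hσ : 0 < σ) (u : ℝ) :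
    HasDerivAt (gaussK σ) (-gaussQ σ u) u := by
  have h : HasDerivAt (fun u : ℝ => -u ^ 2 / (4 * σ)) (-(2 * u) / (4 * σ)) u := by
    simpa using ((hasDerivAt_pow 2 u).neg).div_const (4 * σ)
  refine (h.exp.const_mul (1 / (2 * √(π * σ)))).congr_deriv ?_
  rw [gaussQ_eq hσ, gaussK]
  field_simp
  ring

lemma hasDerivAt_gaussQ {σ : ℝ} (hσ : 0 < σ) (u : ℝ) :
    HasDerivAt (gaussQ σ) (gaussR σ u) u := by
  have h : HasDerivAt (fun u : ℝ => u / (2 * σ)) (1 / (2 * σ)) u := (hasDerivAt_id u).div_const _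
  have h2 := h.mul (hasDerivAt_gaussK hσ u)
  refine (h2.congr_of_eventuallyEq (Eventually.of_forall fun v => gaussQ_eq hσ v)).congr_deriv ?_
  rw [gaussQ_eq hσ, gaussR]
  field_simp
  ring

lemma hasDerivAt_gaussK_time {σ : ℝ} (hσ : 0 < σ) (u : ℝ) :
    HasDerivAt (fun σ => gaussK σ u) (-gaussR σ u) σ := by
  have hp : 0 < √(π * σ) := Real.sqrt_pos.2 (by positivity)
  have h1 : HasDerivAt (fun σ : ℝ => π * σ) π σ := by simpa using (hasDerivAt_id σ).const_mul π
  have h2 := ((h1.sqrt (by positivity)).const_mul 2).inv (by positivity)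
  have h3 : HasDerivAt (fun σ : ℝ => 4 * σ) 4 σ := by simpa using (hasDerivAt_id σ).const_mul 4
  have h4 := (((hasDerivAt_const σ (-u ^ 2)).div h3 (by positivity)).exp)
  refine ((h2.mul h4).congr_of_eventuallyEq (Eventually.of_forall fun v => ?_)).congr_deriv ?_
  · simp [gaussK]
  · have hs : √(π * σ) ^ 2 = π * σ := Real.sq_sqrt (by positivity)
    rw [gaussR, gaussK]
    simp only [Pi.inv_apply, Pi.div_apply]
    rw [mul_pow, hs]
    field_simp
    ring

lemma measurable_gaussK : Measurable (Function.uncurry gaussK) := by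
  unfold Function.uncurry gaussK; fun_prop

lemma measurable_gaussQ : Measurable (Function.uncurry gaussQ) := by
  unfold Function.uncurry gaussQ; fun_prop

lemma continuousOn_gaussK :
    ContinuousOn (Function.uncurry gaussK) {p | 0 < p.1} := by
  unfold Function.uncurry gaussK
  refine ContinuousOn.mul (ContinuousOn.div (by fun_prop) (by fun_prop) ?_)
    (ContinuousOn.rexp (ContinuousOn.div (by fun_prop) (by fun_prop) ?_))
  · rintro ⟨a, b⟩ (h : 0 < a)
    have : 0 < √(π * a) := Real.sqrt_pos.2 (by positivity)
    positivity
  · rintro ⟨a, b⟩ (h : 0 < a)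
    positivity

lemma continuousOn_gaussQ :
    ContinuousOn (Function.uncurry gaussQ) {p | 0 < p.1} := by
  have : ContinuousOn (fun p : ℝ × ℝ => p.2 / (2 * p.1) * Function.uncurry gaussK p)
      {p | 0 < p.1} := by
    refine ContinuousOn.mul (ContinuousOn.div (by fun_prop) (by fun_prop) ?_) continuousOn_gaussK
    rintro ⟨a, b⟩ (h : 0 < a)
    positivity
  exact this.congr fun p hp => gaussQ_eq hp p.2

lemma continuousOn_gaussR :
    ContinuousOn (Function.uncurry gaussR) {p | 0 < p.1} := by
  refine ContinuousOn.mul (f := fun p : ℝ × ℝ => 1 / (2 * p.1) - p.2 ^ 2 / (4 * p.1 ^ 2))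
    (ContinuousOn.sub (ContinuousOn.div (by fun_prop) (by fun_prop) ?_)
    (ContinuousOn.div (by fun_prop) (by fun_prop) ?_)) continuousOn_gaussK
  all_goals
    rintro ⟨a, b⟩ (h : 0 < a)
    positivity

/-! ### Pointwise bounds -/

/-- In the parabolic variable `v` the powers of `√σ` split off, and each pointwise bound below
becomes a bound on a polynomial times `exp (-v ^ 2)`. -/
lemma gaussK_eq_scaled {σ : ℝ} (hσ : 0 < σ) (v : ℝ) :
    gaussK σ (2 * √σ * v) = exp (-v ^ 2) / (2 * √π * √σ) := by
  have hs : √σ ^ 2 = σ := Real.sq_sqrt hσ.le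
  rw [gaussK, Real.sqrt_mul pi_pos.le, mul_pow, mul_pow, hs,
    show -(2 ^ 2 * σ * v ^ 2) / (4 * σ) = -v ^ 2 by field_simp; ring]
  field_simp

lemma one_le_sqrt_pi : 1 ≤ √π := by
  rw [Real.one_le_sqrt]; linarith [pi_gt_three]

lemma gaussK_scaled_le {σ : ℝ} (hσ : 0 < σ) (v : ℝ) :
    gaussK σ (2 * √σ * v) ≤ exp (-v ^ 2) / √σ := by
  have hs : 0 < √σ := Real.sqrt_pos.2 hσ
  rw [gaussK_eq_scaled hσ]
  gcongr
  nlinarith [one_le_sqrt_pi]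

lemma exists_scaled {σ : ℝ} (hσ : 0 < σ) (w : ℝ) : ∃ v, w = 2 * √σ * v := by
  have hs : 0 < √σ := Real.sqrt_pos.2 hσ
  exact ⟨w / (2 * √σ), by field_simp⟩

lemma exp_neg_sq_mul_le_one (v : ℝ) : (1 + v ^ 2) * exp (-v ^ 2) ≤ 1 := by
  have h := Real.add_one_le_exp (v ^ 2)
  have : exp (v ^ 2) * exp (-v ^ 2) = 1 := by rw [← Real.exp_add]; simp
  nlinarith [Real.exp_pos (-v ^ 2)]

lemma exp_neg_sq_mul_pow_four_le (v : ℝ) : v ^ 4 * exp (-v ^ 2) ≤ 2 := by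
  have h := Real.quadratic_le_exp_of_nonneg (sq_nonneg v)
  have : exp (v ^ 2) * exp (-v ^ 2) = 1 := by rw [← Real.exp_add]; simp
  nlinarith [Real.exp_pos (-v ^ 2), sq_nonneg v, mul_nonneg (sq_nonneg v) (Real.exp_pos (-v ^ 2)).le]

lemma gaussK_le_inv_sqrt {σ : ℝ} (hσ : 0 < σ) (w : ℝ) : gaussK σ w ≤ 1 / √σ := by
  obtain ⟨v, rfl⟩ := exists_scaled hσ w
  refine (gaussK_scaled_le hσ v).trans ?_
  gcongr
  exact Real.exp_le_one_iff.2 (by nlinarith [sq_nonneg v])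

lemma gaussK_mul_sq_le {σ : ℝ} (hσ : 0 < σ) (w : ℝ) : gaussK σ w * w ^ 2 ≤ 4 * √σ := by
  have hs : 0 < √σ := Real.sqrt_pos.2 hσ
  obtain ⟨v, rfl⟩ := exists_scaled hσ w
  calc gaussK σ (2 * √σ * v) * (2 * √σ * v) ^ 2
      ≤ exp (-v ^ 2) / √σ * (2 * √σ * v) ^ 2 := by gcongr; exact gaussK_scaled_le hσ v
    _ = 4 * √σ * (v ^ 2 * exp (-v ^ 2)) := by field_simp; ring
    _ ≤ 4 * √σ * 1 := by
        gcongr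
        nlinarith [exp_neg_sq_mul_le_one v, Real.exp_pos (-v ^ 2)]
    _ = _ := mul_one _

lemma abs_gaussQ_scaled_le {σ : ℝ} (hσ : 0 < σ) (v : ℝ) :
    |gaussQ σ (2 * √σ * v)| ≤ |v| * exp (-v ^ 2) / σ := by
  have hs : 0 < √σ := Real.sqrt_pos.2 hσ
  have hs2 : √σ * √σ = σ := Real.mul_self_sqrt hσ.le
  rw [gaussQ_eq hσ, abs_mul, abs_of_nonneg (gaussK_nonneg _ _)]
  calc |2 * √σ * v / (2 * σ)| * gaussK σ (2 * √σ * v)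
      ≤ |2 * √σ * v / (2 * σ)| * (exp (-v ^ 2) / √σ) := by
        gcongr; exact gaussK_scaled_le hσ v
    _ = _ := by
        rw [abs_div, abs_mul, abs_mul, abs_of_pos hs, abs_of_pos (by positivity : (0:ℝ) < 2 * σ),
          abs_of_pos (by norm_num : (0:ℝ) < 2)]
        field_simp

lemma abs_gaussQ_le_inv {σ : ℝ} (hσ : 0 < σ) (w : ℝ) : |gaussQ σ w| ≤ 1 / σ := by
  obtain ⟨v, rfl⟩ := exists_scaled hσ w
  refine (abs_gaussQ_scaled_le hσ v).trans ?_
  gcongr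
  nlinarith [exp_neg_sq_mul_le_one v, Real.exp_pos (-v ^ 2), sq_abs v, sq_nonneg (|v| - 1),
    mul_nonneg (sq_nonneg (|v| - 1)) (Real.exp_pos (-v ^ 2)).le]

lemma abs_gaussQ_mul_sq_le {σ : ℝ} (hσ : 0 < σ) (w : ℝ) : |gaussQ σ w| * w ^ 2 ≤ 12 := by
  have hs2 : √σ ^ 2 = σ := Real.sq_sqrt hσ.le
  obtain ⟨v, rfl⟩ := exists_scaled hσ w
  calc |gaussQ σ (2 * √σ * v)| * (2 * √σ * v) ^ 2
      ≤ |v| * exp (-v ^ 2) / σ * (2 * √σ * v) ^ 2 := by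
        gcongr; exact abs_gaussQ_scaled_le hσ v
    _ = 4 * (|v| ^ 3 * exp (-v ^ 2)) := by
        rw [mul_pow, mul_pow, hs2, ← sq_abs v]; field_simp; norm_num
    -- `|v|³ ≤ v⁴ + v²` avoids odd powers; the two bounds `2` and `1` then give `4 * 3 = 12`.
    _ ≤ 4 * ((v ^ 4 + v ^ 2) * exp (-v ^ 2)) := by
        gcongr
        rw [← Even.pow_abs (by decide : Even 4) v, ← sq_abs v]
        nlinarith [mul_nonneg (sq_nonneg (|v|)) (sq_nonneg (|v| - 1)), abs_nonneg v,
          sq_nonneg (|v| ^ 2)]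
    _ ≤ 12 := by
        nlinarith [exp_neg_sq_mul_le_one v, exp_neg_sq_mul_pow_four_le v, Real.exp_pos (-v ^ 2)]

lemma abs_gaussQ_mul_cube_le {σ : ℝ} (hσ : 0 < σ) (w : ℝ) :
    |gaussQ σ w| * |w| ^ 3 ≤ 16 * √σ := by
  have hs : 0 < √σ := Real.sqrt_pos.2 hσ
  have hs2 : √σ ^ 2 = σ := Real.sq_sqrt hσ.le
  obtain ⟨v, rfl⟩ := exists_scaled hσ w
  calc |gaussQ σ (2 * √σ * v)| * |2 * √σ * v| ^ 3
      ≤ |v| * exp (-v ^ 2) / σ * |2 * √σ * v| ^ 3 := by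
        gcongr; exact abs_gaussQ_scaled_le hσ v
    _ = 8 * √σ * (v ^ 4 * exp (-v ^ 2)) := by
        rw [abs_mul, abs_mul, abs_of_pos hs, abs_of_pos (by norm_num : (0:ℝ) < 2),
          ← Even.pow_abs (by decide : Even 4) v]
        nth_rewrite 1 [← hs2]
        field_simp
        norm_num
    _ ≤ 8 * √σ * 2 := by gcongr; exact exp_neg_sq_mul_pow_four_le v
    _ = _ := by ring

lemma abs_gaussR_le {σ : ℝ} (hσ : 0 < σ) (w : ℝ) : |gaussR σ w| ≤ 1 / σ * (1 / √σ) := by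
  have hs : 0 < √σ := Real.sqrt_pos.2 hσ
  have hs2 : √σ ^ 2 = σ := Real.sq_sqrt hσ.le
  obtain ⟨v, rfl⟩ := exists_scaled hσ w
  rw [gaussR, abs_mul, abs_of_nonneg (gaussK_nonneg _ _)]
  have h1 : 1 / (2 * σ) - (2 * √σ * v) ^ 2 / (4 * σ ^ 2) = (1 / 2 - v ^ 2) / σ := by
    rw [mul_pow, mul_pow, hs2]; field_simp; ring
  rw [h1]
  have h2 : |1 / 2 - v ^ 2| ≤ 1 + v ^ 2 := by
    rw [abs_le]; constructor <;> nlinarith [sq_nonneg v]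
  calc |(1 / 2 - v ^ 2) / σ| * gaussK σ (2 * √σ * v)
      ≤ (1 + v ^ 2) / σ * (exp (-v ^ 2) / √σ) := by
        rw [abs_div, abs_of_pos hσ]
        gcongr
        · exact gaussK_nonneg _ _
        · exact gaussK_scaled_le hσ v
    _ = ((1 + v ^ 2) * exp (-v ^ 2)) / σ * (1 / √σ) := by field_simp
    _ ≤ 1 / σ * (1 / √σ) := by gcongr; exact exp_neg_sq_mul_le_one v

/-- The hypothesis forces either `σ ≥ d / (2A)`, where there is no singularity in time, or `|w| ≥ d
/ 2`, where powers of `w` absorb the negative powers of `σ`. The decay in `w` is what later makes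
the sum over images converge. -/
lemma exists_gauss_bound {τ d A : ℝ} (hd : 0 < d) (hA : 0 < A) :
    ∃ B, 0 ≤ B ∧ ∀ σ w, 0 < σ → σ ≤ τ → d ≤ A * σ + |w| →
      gaussK σ w ≤ B / (1 + w ^ 2) ∧ |gaussQ σ w| ≤ B / (1 + w ^ 2) := by
  set e := d / (2 * A) with he
  have hepos : 0 < e := by positivity
  -- A sum of all the constants needed: `1 / √e` and `1 / e` for large `σ`, the terms divided by `d
  -- ^ 2` and `d ^ 3` for large `|w|`, and `4 * √τ`, `12` for the kernels multiplied by `w ^ 2`.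
  refine ⟨1 / √e + 1 / e + 4 * √τ + 16 * √τ / (d ^ 2) + 12 + 128 * √τ / d ^ 3, by positivity, ?_⟩
  intro σ w hσ hστ h
  have hsq : √σ ≤ √τ := Real.sqrt_le_sqrt hστ
  have hsd : 0 < √e := Real.sqrt_pos.2 hepos
  have k1 := gaussK_mul_sq_le hσ w
  have q1 := abs_gaussQ_mul_sq_le hσ w
  have hp1 : 0 ≤ 1 / √e := by positivity
  have hp2 : 0 ≤ 1 / e := by positivity
  have hp3 : 0 ≤ 16 * √τ / (d ^ 2) := by positivity
  have hp4 : 0 ≤ 128 * √τ / (d ^ 3) := by positivity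
  have hp5 : 0 ≤ √τ := by positivity
  rw [le_div_iff₀ (by positivity), le_div_iff₀ (by positivity), mul_add, mul_add, mul_one, mul_one]
  rcases le_total e σ with h1 | h1
  · have k2 := gaussK_le_inv_sqrt hσ w
    have q2 := abs_gaussQ_le_inv hσ w
    have k3 : 1 / √σ ≤ 1 / √e := by gcongr
    have q3 : 1 / σ ≤ 1 / e := by gcongr
    constructor <;> linarith
  · have hw : d / 2 ≤ |w| := by
      have : A * σ ≤ A * e := by gcongr
      have h2 : A * e = d / 2 := by rw [he]; field_simp
      linarith
    have q4 := abs_gaussQ_mul_cube_le hσ w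
    have k5 : gaussK σ w ≤ 16 * √τ / d ^ 2 := by
      rw [le_div_iff₀ (by positivity)]
      have : d ^ 2 / 4 ≤ w ^ 2 := by rw [← sq_abs w]; nlinarith
      nlinarith [gaussK_nonneg σ w]
    have q5 : |gaussQ σ w| ≤ 128 * √τ / d ^ 3 := by
      rw [le_div_iff₀ (by positivity)]
      have : (d / 2) ^ 3 ≤ |w| ^ 3 := by gcongr
      have := mul_le_mul_of_nonneg_left this (abs_nonneg (gaussQ σ w))
      nlinarith
    constructor <;> linarith

/-- This and the next bound are for arguments that differ by `O(σ)`: the difference of `gaussK` is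
then bounded and that of `gaussQ` is `O(1 / √σ)`, exactly the growth permitted in `dom`. -/
lemma abs_gaussK_sub_le {σ : ℝ} (hσ : 0 < σ) (u v : ℝ) :
    |gaussK σ u - gaussK σ v| ≤ 1 / σ * |u - v| := by
  have := Convex.norm_image_sub_le_of_norm_hasDerivWithin_le (f := gaussK σ) (s := univ)
    (f' := fun u => -gaussQ σ u) (C := 1 / σ) (x := v) (y := u)
    (fun x _ => (hasDerivAt_gaussK hσ x).hasDerivWithinAt)
    (fun x _ => by rw [norm_neg]; exact abs_gaussQ_le_inv hσ x) convex_univ trivial trivial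
  simpa using this

lemma abs_gaussQ_sub_le {σ : ℝ} (hσ : 0 < σ) (u v : ℝ) :
    |gaussQ σ u - gaussQ σ v| ≤ 1 / σ * (1 / √σ) * |u - v| := by
  have := Convex.norm_image_sub_le_of_norm_hasDerivWithin_le (f := gaussQ σ) (s := univ)
    (f' := fun u => gaussR σ u) (C := 1 / σ * (1 / √σ)) (x := v) (y := u)
    (fun x _ => (hasDerivAt_gaussQ hσ x).hasDerivWithinAt)
    (fun x _ => abs_gaussR_le hσ x) convex_univ trivial trivial
  simpa using this

end

noncomputable section

/-! ### Bounds for trigonometric sums with Gaussian weights -/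

/-- The `n`-th frequency of the sine series on an interval of length `l`. -/
def waveNum (l : ℝ) (n : ℕ) : ℝ := π * n / l

/-- Abel's inequality. The quantity estimated in `key` equals the sum of `(a k - a (k + 1))` times
partial sums of `b`, and the weights telescope. -/
lemma abs_sum_mul_le_of_antitone {a b : ℕ → ℝ} {B : ℝ} (ha : Antitone a) (ha0 : ∀ n, 0 ≤ a n)
    (hb : ∀ N, |∑ n ∈ Finset.range N, b n| ≤ B) (N : ℕ) :
    |∑ n ∈ Finset.range N, a n * b n| ≤ B * a 0 := by
  have key : ∀ N, |∑ n ∈ Finset.range N, a n * b n - a N * ∑ n ∈ Finset.range N, b n|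
      ≤ B * (a 0 - a N) := by
    intro N
    induction N with
    | zero => simp
    | succ N ih =>
      have h1 : ∑ n ∈ Finset.range (N + 1), a n * b n
          - a (N + 1) * ∑ n ∈ Finset.range (N + 1), b n
          = (∑ n ∈ Finset.range N, a n * b n - a N * ∑ n ∈ Finset.range N, b n)
            + (a N - a (N + 1)) * ∑ n ∈ Finset.range (N + 1), b n := by
        rw [Finset.sum_range_succ, Finset.sum_range_succ]; ring
      have h2 : 0 ≤ a N - a (N + 1) := sub_nonneg.2 (ha (Nat.le_succ N))
      rw [h1]
      refine (abs_add_le _ _).trans ?_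
      rw [abs_mul, abs_of_nonneg h2]
      nlinarith [hb (N + 1), abs_nonneg (∑ n ∈ Finset.range (N + 1), b n)]
  have h3 : |a N * ∑ n ∈ Finset.range N, b n| ≤ a N * B := by
    rw [abs_mul, abs_of_nonneg (ha0 N)]
    exact mul_le_mul_of_nonneg_left (hb N) (ha0 N)
  calc |∑ n ∈ Finset.range N, a n * b n|
      = |(∑ n ∈ Finset.range N, a n * b n - a N * ∑ n ∈ Finset.range N, b n)
          + a N * ∑ n ∈ Finset.range N, b n| := by rw [sub_add_cancel]
    _ ≤ B * (a 0 - a N) + a N * B := (abs_add_le _ _).trans (add_le_add (key N) h3)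
    _ = B * a 0 := by ring

/-- The factor `sin (φ / 2)` makes the Dirichlet sum telescope. -/
lemma abs_sin_half_mul_sum_cos_le (φ : ℝ) (N : ℕ) :
    |∑ n ∈ Finset.range N, sin (φ / 2) * cos ((n + 1) * φ)| ≤ 1 := by
  have h : ∑ n ∈ Finset.range N, sin (φ / 2) * cos ((n + 1) * φ)
      = ∑ n ∈ Finset.range N, (sin (((n + 1 : ℕ) + 1 / 2) * φ) / 2 - sin ((n + 1 / 2) * φ) / 2) := by
    refine Finset.sum_congr rfl fun n _ => ?_
    push_cast
    rw [show ((n:ℝ) + 1 + 1 / 2) * φ = (n + 1) * φ + φ / 2 by ring,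
      show ((n:ℝ) + 1 / 2) * φ = (n + 1) * φ - φ / 2 by ring, sin_add, sin_sub]
    ring
  rw [h, Finset.sum_range_sub (fun n : ℕ => sin ((n + 1 / 2) * φ) / 2), abs_le]
  constructor <;> linarith [neg_one_le_sin ((N + 1 / 2) * φ), sin_le_one ((N + 1 / 2) * φ),
    neg_one_le_sin (((0 : ℕ) + 1 / 2) * φ), sin_le_one (((0 : ℕ) + 1 / 2) * φ)]

lemma abs_sin_half_mul_sum_sin_le (φ : ℝ) (N : ℕ) :
    |∑ n ∈ Finset.range N, sin (φ / 2) * sin ((n + 1) * φ)| ≤ 1 := by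
  have h : ∑ n ∈ Finset.range N, sin (φ / 2) * sin ((n + 1) * φ)
      = ∑ n ∈ Finset.range N,
        (-cos (((n + 1 : ℕ) + 1 / 2) * φ) / 2 - -cos ((n + 1 / 2) * φ) / 2) := by
    refine Finset.sum_congr rfl fun n _ => ?_
    push_cast
    rw [show ((n:ℝ) + 1 + 1 / 2) * φ = (n + 1) * φ + φ / 2 by ring,
      show ((n:ℝ) + 1 / 2) * φ = (n + 1) * φ - φ / 2 by ring, cos_add, cos_sub]
    ring
  rw [h, Finset.sum_range_sub (fun n : ℕ => -cos ((n + 1 / 2) * φ) / 2), abs_le]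
  constructor <;> linarith [neg_one_le_cos ((N + 1 / 2) * φ), cos_le_one ((N + 1 / 2) * φ),
    neg_one_le_cos (((0 : ℕ) + 1 / 2) * φ), cos_le_one (((0 : ℕ) + 1 / 2) * φ)]

lemma waveNum_nonneg {l : ℝ} (hl : 0 < l) (n : ℕ) : 0 ≤ waveNum l n := by
  unfold waveNum; positivity

lemma waveNum_mono {l : ℝ} (hl : 0 < l) : Monotone (waveNum l) := by
  intro m n h
  unfold waveNum
  gcongr

lemma waveNum_succ_mul (l u : ℝ) (n : ℕ) :
    waveNum l (n + 1) * u = (n + 1) * (π * u / l) := by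
  unfold waveNum; push_cast; ring

lemma abs_sin_mul_sum_exp_mul_cos_le {l σ : ℝ} (hl : 0 < l) (hσ : 0 ≤ σ) (u : ℝ) (N : ℕ) :
    |sin (π * u / (2 * l))| * |∑ n ∈ Finset.range N,
      exp (-waveNum l (n + 1) ^ 2 * σ) * cos (waveNum l (n + 1) * u)| ≤ 1 := by
  have := abs_sum_mul_le_of_antitone (a := fun n => exp (-waveNum l (n + 1) ^ 2 * σ))
    (b := fun n => sin (π * u / l / 2) * cos ((n + 1) * (π * u / l))) (B := 1) ?_
    (fun n => (Real.exp_pos _).le) (abs_sin_half_mul_sum_cos_le _) N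
  · rw [← abs_mul, Finset.mul_sum]
    refine le_trans (le_of_eq ?_) (this.trans ?_)
    · congr 1
      refine Finset.sum_congr rfl fun n _ => ?_
      rw [waveNum_succ_mul, show π * u / (2 * l) = π * u / l / 2 by field_simp]
      ring
    · rw [one_mul, Real.exp_le_one_iff]
      nlinarith [mul_nonneg (sq_nonneg (waveNum l (0 + 1))) hσ]
  · intro m n h
    have h1 := waveNum_nonneg hl (m + 1)
    have h2 : waveNum l (m + 1) ≤ waveNum l (n + 1) := waveNum_mono hl (by lia)
    refine Real.exp_le_exp.2 ?_
    have : waveNum l (m + 1) ^ 2 ≤ waveNum l (n + 1) ^ 2 := by gcongr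
    nlinarith

/-- The weight `t * exp (-t ^ 2)` is not monotone, so Abel's inequality does not apply to it. It is
the difference of `2 * exp (-t ^ 2 / 2)` and the function here, both nonnegative and decreasing for
`t ≥ 0`. With `p = exp (-t ^ 2 / 2)` the sign of the derivative comes from `t * p ≤ 1`. -/
lemma antitoneOn_two_exp_sub :
    AntitoneOn (fun t : ℝ => 2 * exp (-t ^ 2 / 2) - t * exp (-t ^ 2)) (Ici 0) := by
  have hd : ∀ t : ℝ, HasDerivAt (fun t : ℝ => 2 * exp (-t ^ 2 / 2) - t * exp (-t ^ 2))
      (2 * (exp (-t ^ 2 / 2) * (-t)) - (exp (-t ^ 2) + t * (exp (-t ^ 2) * (-(2 * t))))) t := by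
    intro t
    have h1 : HasDerivAt (fun t : ℝ => -t ^ 2) (-(2 * t)) t :=
      (hasDerivAt_pow 2 t).neg.congr_deriv (by simp)
    have h2 : HasDerivAt (fun t : ℝ => -t ^ 2 / 2) (-t) t :=
      (h1.div_const 2).congr_deriv (by ring)
    exact ((h2.exp.const_mul 2).sub ((hasDerivAt_id t).mul h1.exp)).congr_deriv (by simp)
  refine antitoneOn_of_deriv_nonpos (convex_Ici 0)
    (fun t _ => (hd t).continuousAt.continuousWithinAt)
    (fun t _ => (hd t).differentiableAt.differentiableWithinAt) fun t ht => ?_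
  rw [interior_Ici] at ht
  have ht0 : 0 < t := ht
  rw [(hd t).deriv]
  have he : exp (-t ^ 2) = exp (-t ^ 2 / 2) * exp (-t ^ 2 / 2) := by
    rw [← Real.exp_add]; congr 1; ring
  set p := exp (-t ^ 2 / 2) with hp
  have hp0 : 0 < p := Real.exp_pos _
  have h1 : t * p ≤ 1 := by
    have h3 := Real.add_one_le_exp (t ^ 2 / 2)
    have h4 : exp (t ^ 2 / 2) * p = 1 := by rw [hp, ← Real.exp_add]; ring_nf; simp
    nlinarith [sq_nonneg (t - 1)]
  rw [he]
  nlinarith [mul_pos ht0 hp0, mul_nonneg (mul_pos ht0 hp0).le (sub_nonneg.2 h1)]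

lemma abs_sin_mul_sum_mul_exp_mul_sin_le {l σ : ℝ} (hl : 0 < l) (hσ : 0 < σ) (u : ℝ) (N : ℕ) :
    |sin (π * u / (2 * l))| * |∑ n ∈ Finset.range N,
      waveNum l (n + 1) * exp (-waveNum l (n + 1) ^ 2 * σ) * sin (waveNum l (n + 1) * u)|
      ≤ 4 / √σ := by
  have hs : 0 < √σ := Real.sqrt_pos.2 hσ
  have hs2 : √σ ^ 2 = σ := Real.sq_sqrt hσ.le
  set t : ℕ → ℝ := fun n => waveNum l (n + 1) * √σ with ht
  have htm : Monotone t := fun m n h =>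
    mul_le_mul_of_nonneg_right (waveNum_mono hl (by lia)) hs.le
  have ht0 : ∀ n, 0 ≤ t n := fun n => mul_nonneg (waveNum_nonneg hl _) hs.le
  set b : ℕ → ℝ := fun n => sin (π * u / l / 2) * sin ((n + 1) * (π * u / l)) with hb
  have e1 := abs_sum_mul_le_of_antitone (a := fun n => 2 * exp (-t n ^ 2 / 2)) (b := b)
    (B := 1) (fun m n h => by
      have := htm h
      have := ht0 m
      dsimp only
      gcongr) (fun n => by positivity) (abs_sin_half_mul_sum_sin_le _) N
  have hle1 : ∀ t : ℝ, exp (-t ^ 2 / 2) ≤ 1 := fun t =>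
    Real.exp_le_one_iff.2 (by nlinarith [sq_nonneg t])
  have hpos : ∀ t : ℝ, 0 ≤ 2 * exp (-t ^ 2 / 2) - t * exp (-t ^ 2) := by
    intro t
    have he : exp (-t ^ 2) = exp (-t ^ 2 / 2) * exp (-t ^ 2 / 2) := by
      rw [← Real.exp_add]; congr 1; ring
    have h3 := Real.add_one_le_exp (t ^ 2 / 2)
    have h4 : exp (t ^ 2 / 2) * exp (-t ^ 2 / 2) = 1 := by rw [← Real.exp_add]; ring_nf; simp
    have hp0 : 0 < exp (-t ^ 2 / 2) := Real.exp_pos _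
    have : t * exp (-t ^ 2 / 2) ≤ 1 := by nlinarith [sq_nonneg (t - 1)]
    rw [he]
    nlinarith
  have e2 := abs_sum_mul_le_of_antitone
    (a := fun n => 2 * exp (-t n ^ 2 / 2) - t n * exp (-t n ^ 2)) (b := b)
    (B := 1) (fun m n h => antitoneOn_two_exp_sub (ht0 m) (ht0 n) (htm h))
    (fun n => hpos _) (abs_sin_half_mul_sum_sin_le _) N
  rw [le_div_iff₀ hs, ← abs_mul, Finset.mul_sum]
  rw [← abs_of_pos hs]
  rw [← abs_mul, Finset.sum_mul]
  -- Each of the two monotone weights is at most `2` at its first index, whence the constant `4`.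
  have e3 : ∑ n ∈ Finset.range N, sin (π * u / (2 * l)) *
        (waveNum l (n + 1) * exp (-waveNum l (n + 1) ^ 2 * σ) * sin (waveNum l (n + 1) * u)) * √σ
      = ∑ n ∈ Finset.range N, 2 * exp (-t n ^ 2 / 2) * b n
        - ∑ n ∈ Finset.range N, (2 * exp (-t n ^ 2 / 2) - t n * exp (-t n ^ 2)) * b n := by
    rw [← Finset.sum_sub_distrib]
    refine Finset.sum_congr rfl fun n _ => ?_
    rw [waveNum_succ_mul l u n, show π * u / (2 * l) = π * u / l / 2 by field_simp, hb, ht]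
    simp only
    rw [mul_pow, hs2, neg_mul]
    ring
  rw [e3]
  refine (abs_sub _ _).trans ?_
  have := hle1 (t 0)
  have : 0 ≤ t 0 * exp (-t 0 ^ 2) := mul_nonneg (ht0 0) (Real.exp_pos _).le
  linarith

lemma summable_inv_succ_sq : Summable fun n : ℕ => 1 / ((n : ℝ) + 1) ^ 2 := by
  have := (summable_nat_add_iff 1).2 (Real.summable_one_div_nat_pow.2 (by norm_num : 1 < 2))
  simpa using this

lemma exp_waveNum_le {l σ : ℝ} (hl : 0 < l) (hσ : 0 < σ) (n : ℕ) :
    exp (-waveNum l (n + 1) ^ 2 * σ) ≤ l ^ 2 / σ * (1 / ((n : ℝ) + 1) ^ 2) ∧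
    waveNum l (n + 1) * exp (-waveNum l (n + 1) ^ 2 * σ)
      ≤ 2 * l ^ 3 / σ ^ 2 * (1 / ((n : ℝ) + 1) ^ 2) ∧
    waveNum l (n + 1) ^ 2 * exp (-waveNum l (n + 1) ^ 2 * σ)
      ≤ 2 * l ^ 2 / σ ^ 2 * (1 / ((n : ℝ) + 1) ^ 2) := by
  set w := waveNum l (n + 1) with hw
  have hn : (0 : ℝ) < (n : ℝ) + 1 := by positivity
  have hwl : ((n : ℝ) + 1) / l ≤ w := by
    rw [hw, waveNum]; push_cast
    gcongr
    nlinarith [pi_gt_three]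
  have hw0 : 0 < w := lt_of_lt_of_le (by positivity) hwl
  set p := w ^ 2 * σ with hp
  have hp0 : 0 < p := by positivity
  rw [neg_mul, ← hp]
  have e0 : exp p * exp (-p) = 1 := by rw [← Real.exp_add]; simp
  have e1 : p * exp (-p) ≤ 1 := by
    nlinarith [Real.add_one_le_exp p, Real.exp_pos (-p)]
  have e2 : p ^ 2 * exp (-p) ≤ 2 := by
    nlinarith [Real.quadratic_le_exp_of_nonneg hp0.le, Real.exp_pos (-p)]
  have i1 : 1 / w ≤ l / ((n : ℝ) + 1) := by
    rw [div_le_div_iff₀ hw0 hn]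
    rw [div_le_iff₀ hl] at hwl
    linarith
  have i2 : (1 / w) ^ 2 ≤ (l / ((n : ℝ) + 1)) ^ 2 := by gcongr
  refine ⟨?_, ?_, ?_⟩
  · calc exp (-p) = (p * exp (-p)) * (1 / w) ^ 2 / σ := by rw [hp]; field_simp
      _ ≤ 1 * (l / ((n : ℝ) + 1)) ^ 2 / σ := by gcongr
      _ = _ := by field_simp
  · calc w * exp (-p) = (p ^ 2 * exp (-p)) * (1 / w) ^ 3 / σ ^ 2 := by rw [hp]; field_simp
      _ ≤ 2 * (l / ((n : ℝ) + 1)) ^ 3 / σ ^ 2 := by gcongr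
      _ = 2 * l ^ 3 / σ ^ 2 * (1 / ((n : ℝ) + 1) ^ 3) := by field_simp
      _ ≤ _ := by
        have h1 : (1 : ℝ) ≤ (n : ℝ) + 1 := by linarith [Nat.cast_nonneg (α := ℝ) n]
        gcongr 2 * l ^ 3 / σ ^ 2 * (1 / ?_)
        exact pow_le_pow_right₀ h1 (by norm_num)
  · calc w ^ 2 * exp (-p) = (p ^ 2 * exp (-p)) * (1 / w) ^ 2 / σ ^ 2 := by rw [hp]; field_simp
      _ ≤ 2 * (l / ((n : ℝ) + 1)) ^ 2 / σ ^ 2 := by gcongr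
      _ = _ := by field_simp

lemma abs_sum_range_le_of_le_inv_sq {f : ℕ → ℝ} {c : ℝ}
    (h : ∀ n, |f n| ≤ c * (1 / ((n : ℝ) + 1) ^ 2)) (N : ℕ) :
    |∑ n ∈ Finset.range N, f n| ≤ c * ∑' n : ℕ, 1 / ((n : ℝ) + 1) ^ 2 := by
  have hc : 0 ≤ c := by simpa using (abs_nonneg _).trans (h 0)
  calc |∑ n ∈ Finset.range N, f n| ≤ ∑ n ∈ Finset.range N, |f n| := Finset.abs_sum_le_sum_abs _ _
    _ ≤ ∑ n ∈ Finset.range N, c * (1 / ((n : ℝ) + 1) ^ 2) := Finset.sum_le_sum fun n _ => h n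
    _ = c * ∑ n ∈ Finset.range N, (1 / ((n : ℝ) + 1) ^ 2) := by rw [Finset.mul_sum]
    _ ≤ _ := by
      gcongr
      exact summable_inv_succ_sq.sum_le_tsum _ (fun n _ => by positivity)

/-- The same alternative as in `exists_gauss_bound`, with `|sin (π u / 2l)|` as the distance from
the singular points `u ∈ 2lℤ`. For `σ` bounded below the series converges absolutely; otherwise the
half-angle factor is at least `d / 2` and Abel's inequality applies. -/
lemma exists_fourier_bound {l d A : ℝ} (τ : ℝ) (hl : 0 < l) (hd : 0 < d) (hA : 0 < A) :
    ∃ B, 0 ≤ B ∧ ∀ σ u, 0 < σ → σ ≤ τ → d ≤ A * σ + |sin (π * u / (2 * l))| → ∀ N,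
      |∑ n ∈ Finset.range N,
        exp (-waveNum l (n + 1) ^ 2 * σ) * cos (waveNum l (n + 1) * u)| ≤ B ∧
      |∑ n ∈ Finset.range N, waveNum l (n + 1) * exp (-waveNum l (n + 1) ^ 2 * σ)
        * sin (waveNum l (n + 1) * u)| ≤ B * (1 / √σ) := by
  set S := ∑' n : ℕ, 1 / ((n : ℝ) + 1) ^ 2 with hS
  have hS0 : 0 ≤ S := tsum_nonneg fun n => by positivity
  set e := d / (2 * A) with he
  have hepos : 0 < e := by positivity
  refine ⟨2 / d + 8 / d + l ^ 2 / e * S + 2 * l ^ 3 / e ^ 2 * S * √τ, by positivity, ?_⟩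
  intro σ u hσ hστ h N
  have hs : 0 < √σ := Real.sqrt_pos.2 hσ
  have hsq : √σ ≤ √τ := Real.sqrt_le_sqrt hστ
  have n1 : 0 ≤ 2 / d := by positivity
  have n2 : 0 ≤ 8 / d := by positivity
  have n3 : 0 ≤ l ^ 2 / e * S := by positivity
  have n4 : 0 ≤ 2 * l ^ 3 / e ^ 2 * S * √τ := by positivity
  rcases le_total e σ with h1 | h1
  · have b1 := abs_sum_range_le_of_le_inv_sq
      (f := fun n => exp (-waveNum l (n + 1) ^ 2 * σ) * cos (waveNum l (n + 1) * u))
      (c := l ^ 2 / σ) (fun n => by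
        rw [abs_mul, abs_of_pos (Real.exp_pos _)]
        exact (mul_le_of_le_one_right (Real.exp_pos _).le (abs_cos_le_one _)).trans
          (exp_waveNum_le hl hσ n).1) N
    have b2 := abs_sum_range_le_of_le_inv_sq
      (f := fun n => waveNum l (n + 1) * exp (-waveNum l (n + 1) ^ 2 * σ)
        * sin (waveNum l (n + 1) * u))
      (c := 2 * l ^ 3 / σ ^ 2) (fun n => by
        have h0 : 0 ≤ waveNum l (n + 1) * exp (-waveNum l (n + 1) ^ 2 * σ) :=
          mul_nonneg (waveNum_nonneg hl _) (Real.exp_pos _).le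
        rw [abs_mul, abs_of_nonneg h0]
        exact (mul_le_of_le_one_right h0 (abs_sin_le_one _)).trans
          (exp_waveNum_le hl hσ n).2.1) N
    have c1 : l ^ 2 / σ * S ≤ l ^ 2 / e * S := by gcongr
    have c2 : 2 * l ^ 3 / σ ^ 2 * S ≤ 2 * l ^ 3 / e ^ 2 * S := by gcongr
    constructor
    · linarith
    · rw [mul_one_div, le_div_iff₀ hs]
      have c3 : 2 * l ^ 3 / σ ^ 2 * S * √σ ≤ 2 * l ^ 3 / e ^ 2 * S * √τ := by gcongr
      have := mul_le_mul_of_nonneg_right b2 hs.le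
      linarith
  · have hw : d / 2 ≤ |sin (π * u / (2 * l))| := by
      have : A * σ ≤ A * e := by gcongr
      have h2 : A * e = d / 2 := by rw [he]; field_simp
      linarith
    have b1 := abs_sin_mul_sum_exp_mul_cos_le hl hσ.le u N
    have b2 := abs_sin_mul_sum_mul_exp_mul_sin_le hl hσ u N
    constructor
    · have : |∑ n ∈ Finset.range N,
        exp (-waveNum l (n + 1) ^ 2 * σ) * cos (waveNum l (n + 1) * u)| ≤ 2 / d := by
        rw [le_div_iff₀ hd]
        nlinarith [mul_le_mul_of_nonneg_right hw (abs_nonneg (∑ n ∈ Finset.range N,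
          exp (-waveNum l (n + 1) ^ 2 * σ) * cos (waveNum l (n + 1) * u)))]
      linarith
    · have : |∑ n ∈ Finset.range N, waveNum l (n + 1) * exp (-waveNum l (n + 1) ^ 2 * σ)
        * sin (waveNum l (n + 1) * u)| ≤ 8 / d * (1 / √σ) := by
        rw [div_mul_eq_mul_div, le_div_iff₀ hd, mul_one_div]
        have e8 : 8 / √σ = 2 * (4 / √σ) := by ring
        rw [e8]
        nlinarith [mul_le_mul_of_nonneg_right hw (abs_nonneg (∑ n ∈ Finset.range N,
          waveNum l (n + 1) * exp (-waveNum l (n + 1) ^ 2 * σ) * sin (waveNum l (n + 1) * u)))]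
      refine this.trans ?_
      have : 0 ≤ 1 / √σ := by positivity
      gcongr
      linarith

/-! ### Poisson summation -/

lemma hasSum_of_eq {ι : Type*} {f g : ι → ℝ} {a : ℝ} (h : HasSum g a) (e : ∀ n, f n = g n) :
    HasSum f a := by
  rwa [funext e]

/-- This is the functional equation of the even theta kernel at parameter `l² / (πσ)`. The amount `1
/ (2 * l)` removed on the cosine side is the zero mode, which cancels between the two halves of
`Upsilon`. -/
lemma exists_hasSum_gaussK {l σ : ℝ} (hl : 0 < l) (hσ : 0 < σ) (u : ℝ) :
    ∃ θ, HasSum (fun n : ℤ => gaussK σ (2 * n * l + u)) θ ∧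
      HasSum (fun n : ℕ => 1 / l * (exp (-waveNum l (n + 1) ^ 2 * σ)
        * cos (waveNum l (n + 1) * u))) (θ - 1 / (2 * l)) := by
  set t := l ^ 2 / (π * σ) with ht
  have ht0 : 0 < t := by positivity
  have hps : 0 < √(π * σ) := Real.sqrt_pos.2 (by positivity)
  have hps2 : √(π * σ) ^ 2 = π * σ := Real.sq_sqrt (by positivity)
  have h1 := (HurwitzZeta.hasSum_int_evenKernel (u / (2 * l)) ht0).mul_left (1 / (2 * √(π * σ)))
  have h2 := (HurwitzZeta.hasSum_nat_cosKernel₀ (u / (2 * l)) (one_div_pos.2 ht0)).mul_left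
    (1 / (2 * l))
  have hk : 1 / (2 * √(π * σ)) * HurwitzZeta.evenKernel ↑(u / (2 * l)) t
      = 1 / (2 * l) * HurwitzZeta.cosKernel ↑(u / (2 * l)) (1 / t) := by
    rw [HurwitzZeta.evenKernel_functional_equation, ← Real.sqrt_eq_rpow, ht,
      Real.sqrt_div (by positivity), Real.sqrt_sq hl.le]
    field_simp
  refine ⟨1 / (2 * √(π * σ)) * HurwitzZeta.evenKernel ↑(u / (2 * l)) t, ?_, ?_⟩
  · refine hasSum_of_eq h1 fun n => ?_
    rw [gaussK]
    congr 2
    rw [ht]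
    field_simp
    ring
  · rw [hk, show ∀ c : ℝ, 1 / (2 * l) * c - 1 / (2 * l) = 1 / (2 * l) * (c - 1) by intro c; ring]
    refine hasSum_of_eq h2 fun n => ?_
    rw [waveNum]
    have e1 : -π * ((n : ℝ) + 1) ^ 2 * (1 / t) = -(π * ((n + 1 : ℕ) : ℝ) / l) ^ 2 * σ := by
      rw [ht]; push_cast; field_simp
    have e2 : 2 * π * (u / (2 * l)) * ((n : ℝ) + 1) = π * ((n + 1 : ℕ) : ℝ) / l * u := by
      push_cast; field_simp
    rw [e1, e2]
    ring

/-- The odd counterpart; a sine series has no zero mode, so both sums agree without correction. -/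
lemma exists_hasSum_gaussQ {l σ : ℝ} (hl : 0 < l) (hσ : 0 < σ) (u : ℝ) :
    ∃ θ, HasSum (fun n : ℤ => gaussQ σ (2 * n * l + u)) θ ∧
      HasSum (fun n : ℕ => 1 / l * (waveNum l (n + 1) * exp (-waveNum l (n + 1) ^ 2 * σ)
        * sin (waveNum l (n + 1) * u))) θ := by
  set t := l ^ 2 / (π * σ) with ht
  have ht0 : 0 < t := by positivity
  have hps : 0 < √(π * σ) := Real.sqrt_pos.2 (by positivity)
  have hps2 : √(π * σ) ^ 2 = π * σ := Real.sq_sqrt (by positivity)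
  have h1 := (HurwitzZeta.hasSum_int_oddKernel (u / (2 * l)) ht0).mul_left
    (l / (2 * (σ * √(π * σ))))
  have h2 := (HurwitzZeta.hasSum_nat_sinKernel (u / (2 * l)) (one_div_pos.2 ht0)).mul_left
    (π / (2 * l ^ 2))
  have hk : l / (2 * (σ * √(π * σ))) * HurwitzZeta.oddKernel ↑(u / (2 * l)) t
      = π / (2 * l ^ 2) * HurwitzZeta.sinKernel ↑(u / (2 * l)) (1 / t) := by
    have ht3 : t ^ (3 / 2 : ℝ) = (l / √(π * σ)) ^ 3 := by
      rw [show (3 / 2 : ℝ) = 1 / 2 * (3 : ℕ) by norm_num, Real.rpow_mul ht0.le,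
        ← Real.sqrt_eq_rpow, Real.rpow_natCast, ht, Real.sqrt_div (by positivity),
        Real.sqrt_sq hl.le]
    have h3 : √(π * σ) ^ 3 = π * σ * √(π * σ) := by rw [pow_succ, hps2]
    rw [HurwitzZeta.oddKernel_functional_equation, ht3, div_pow, h3]
    field_simp
  refine ⟨l / (2 * (σ * √(π * σ))) * HurwitzZeta.oddKernel ↑(u / (2 * l)) t, ?_, ?_⟩
  · refine hasSum_of_eq h1 fun n => ?_
    have e1 : -(2 * n * l + u) ^ 2 / (4 * σ) = -π * ((n : ℝ) + u / (2 * l)) ^ 2 * t := by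
      rw [ht]; field_simp; ring
    rw [gaussQ, sqrt_pi_mul_cube hσ.le, e1]
    generalize rexp _ = E
    field_simp
    ring
  · rw [hk]
    -- The sine series is indexed from `0`, where its term vanishes; it is shifted to start at mode
    -- `1`.
    have h4 := (hasSum_nat_add_iff' 1).2 h2
    simp only [Finset.range_one, Finset.sum_singleton, Nat.cast_zero, mul_zero, zero_mul,
      sub_zero] at h4
    refine hasSum_of_eq h4 fun n => ?_
    rw [waveNum]
    have e1 : -π * ((n + 1 : ℕ) : ℝ) ^ 2 * (1 / t) = -(π * ((n + 1 : ℕ) : ℝ) / l) ^ 2 * σ := by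
      rw [ht]; field_simp
    have e2 : 2 * π * (u / (2 * l)) * ((n + 1 : ℕ) : ℝ) = π * ((n + 1 : ℕ) : ℝ) / l * u := by
      field_simp
    rw [e1, e2]
    field_simp

end

noncomputable section

namespace BarrierData

/-! ### The representation functional

A kernel pair `(K, L)` enters both series through five integrals; `wgt` collects the densities,
`lo`, `hi` the ranges of integration, and `dom` the admissible growth of the kernel. -/

variable {D : BarrierData} {T τ : ℝ}

/-- The five densities. -/
def wgt (D : BarrierData) : Fin 5 → ℝ → ℝ :=
  ![D.U0, fun s => D.Φ s + D.fp s * D.dz s, fun s => D.Ψ s - D.fm s * D.dy s, D.fm,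
    fun s => -D.fp s]

/-- The lower limits of integration. -/
def lo (D : BarrierData) : Fin 5 → ℝ := ![D.y 0, 0, 0, 0, 0]

/-- The upper limits of integration. -/
def hi (D : BarrierData) (τ : ℝ) : Fin 5 → ℝ := ![D.z 0, τ, τ, τ, τ]

/-- The growth allowed in each of the five integrals. -/
def dom (τ : ℝ) : Fin 5 → ℝ → ℝ :=
  ![fun _ => 1, fun _ => 1, fun _ => 1, fun s => 1 / √(τ - s), fun s => 1 / √(τ - s)]

/-- The sum of the five integrals. -/
def Rep (D : BarrierData) (τ : ℝ) (κ : Fin 5 → ℝ → ℝ) : ℝ :=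
  ∑ i, ∫ s in Ioo (D.lo i) (D.hi τ i), D.wgt i s * κ i s

/-- The five kernels are measurable and bounded by `C` times the allowed growth. -/
structure Dominated (D : BarrierData) (τ C : ℝ) (κ : Fin 5 → ℝ → ℝ) : Prop where
  aesm : ∀ i, AEStronglyMeasurable (κ i) (volume.restrict (Ioo (D.lo i) (D.hi τ i)))
  bound : ∀ i, ∀ s ∈ Ioo (D.lo i) (D.hi τ i), |κ i s| ≤ C * dom τ i s

/-- The five kernels given by a kernel `K` and its derivative `L`. -/
def curve (D : BarrierData) (K L : ℝ → ℝ → ℝ) : Fin 5 → ℝ → ℝ :=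
  ![fun ξ => K ξ 0, fun s => K (D.z s) s, fun s => K (D.y s) s, fun s => L (D.y s) s,
    fun s => L (D.z s) s]

lemma dom_nonneg (i : Fin 5) (s : ℝ) : 0 ≤ dom τ i s := by
  fin_cases i <;> simp [dom]

lemma Admissible.lo_lt_hi (hD : D.Admissible T) (hτ : τ ∈ Ioc 0 T) (i : Fin 5) :
    D.lo i < D.hi τ i := by
  have := hD.y_lt_z 0 ⟨le_rfl, hτ.1.le.trans hτ.2⟩
  fin_cases i <;> simp [lo, hi, this, hτ.1]

lemma integrableOn_inv_sqrt_sub (hτ : 0 < τ) :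
    IntegrableOn (fun s => 1 / √(τ - s)) (Ioo 0 τ) := by
  have h := (intervalIntegral.intervalIntegrable_rpow' (a := 0) (b := τ) (r := -(1 / 2))
    (by norm_num)).comp_sub_left τ
  rw [sub_zero, sub_self] at h
  have h2 := (intervalIntegrable_iff_integrableOn_Ioo_of_le hτ.le).1 h.symm
  refine h2.congr_fun (fun s hs => ?_) measurableSet_Ioo
  dsimp only
  rw [Real.rpow_neg (by linarith [hs.2]), Real.sqrt_eq_rpow]; simp

lemma Admissible.integrableOn_data (hD : D.Admissible T) (hτ : τ ∈ Ioc 0 T) (i : Fin 5) :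
    IntegrableOn (D.wgt i) (Ioo (D.lo i) (D.hi τ i)) := by
  have hT : 0 ≤ T := hτ.1.le.trans hτ.2
  have hsub : Ioo 0 τ ⊆ Ioo 0 T := Ioo_subset_Ioo_right hτ.2
  have hsub2 : Ioo 0 τ ⊆ Icc 0 T := hsub.trans Ioo_subset_Icc_self
  have c {f : ℝ → ℝ} (hf : ContinuousOn f (Icc 0 T)) : IntegrableOn f (Ioo 0 τ) :=
    (hf.integrableOn_Icc).mono_set hsub2
  have m {f g : ℝ → ℝ} (hf : ContinuousOn f (Icc 0 T)) (hg : IntervalIntegrable g volume 0 T) :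
      IntegrableOn (fun s => f s * g s) (Ioo 0 τ) := by
    refine ((intervalIntegrable_iff_integrableOn_Ioo_of_le hT).1
      (hg.continuousOn_mul ?_)).mono_set hsub
    rwa [uIcc_of_le hT]
  have g {f : ℝ → ℝ} (hf : IntervalIntegrable f volume 0 T) : IntegrableOn f (Ioo 0 τ) :=
    ((intervalIntegrable_iff_integrableOn_Ioo_of_le hT).1 hf).mono_set hsub
  fin_cases i
  · exact (intervalIntegrable_iff_integrableOn_Ioo_of_le
      (hD.y_lt_z 0 ⟨le_rfl, hT⟩).le).1 hD.U0_int
  · exact (g hD.Φ_int).add (m hD.fp_cont hD.dz_int)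
  · exact (g hD.Ψ_int).sub (m hD.fm_cont hD.dy_int)
  · exact c hD.fm_cont
  · exact (c hD.fp_cont).neg

/-- The first three densities are merely integrable and tolerate only bounded kernels. The two
double-layer densities are bounded, so they may be paired with the integrable singularity `1 / √(τ -
s)`. -/
lemma Admissible.integrableOn_wgt (hD : D.Admissible T) (hτ : τ ∈ Ioc 0 T) (i : Fin 5) :
    IntegrableOn (fun s => D.wgt i s * dom τ i s) (Ioo (D.lo i) (D.hi τ i)) := by
  have hT : 0 ≤ T := hτ.1.le.trans hτ.2
  have hsub2 : Ioo 0 τ ⊆ Icc 0 T :=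
    (Ioo_subset_Ioo_right hτ.2).trans Ioo_subset_Icc_self
  have c {f : ℝ → ℝ} (hf : ContinuousOn f (Icc 0 T)) :
      IntegrableOn (fun s => f s * (1 / √(τ - s))) (Ioo 0 τ) := by
    obtain ⟨M, hM⟩ := isCompact_Icc.exists_bound_of_continuousOn hf
    refine (integrableOn_inv_sqrt_sub hτ.1).bdd_mul (c := M)
      ((hf.mono hsub2).aestronglyMeasurable measurableSet_Ioo) ?_
    exact (ae_restrict_mem measurableSet_Ioo).mono fun s hs => hM s (hsub2 hs)
  have h := hD.integrableOn_data hτ i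
  fin_cases i
  · simpa [dom] using h
  · simpa [dom] using h
  · simpa [dom] using h
  · exact c hD.fm_cont
  · exact c hD.fp_cont.neg

lemma Dominated.integrableOn {C : ℝ} {κ : Fin 5 → ℝ → ℝ} (hD : D.Admissible T)
    (hτ : τ ∈ Ioc 0 T) (h : D.Dominated τ C κ) (i : Fin 5) :
    IntegrableOn (fun s => D.wgt i s * κ i s) (Ioo (D.lo i) (D.hi τ i)) := by
  refine ((hD.integrableOn_wgt hτ i).norm.const_mul C).mono'
    ((hD.integrableOn_data hτ i).aestronglyMeasurable.mul (h.aesm i)) ?_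
  refine (ae_restrict_mem measurableSet_Ioo).mono fun s hs => ?_
  rw [norm_mul, norm_mul, Real.norm_eq_abs, Real.norm_eq_abs, Real.norm_eq_abs,
    abs_of_nonneg (dom_nonneg i s)]
  nlinarith [h.bound i s hs, abs_nonneg (D.wgt i s)]

lemma Dominated.mono {C C' : ℝ} {κ : Fin 5 → ℝ → ℝ} (h : D.Dominated τ C κ) (hC : C ≤ C') :
    D.Dominated τ C' κ :=
  ⟨h.aesm, fun i s hs => (h.bound i s hs).trans
    (mul_le_mul_of_nonneg_right hC (dom_nonneg i s))⟩

lemma Dominated.add {C C' : ℝ} {κ κ' : Fin 5 → ℝ → ℝ} (h : D.Dominated τ C κ)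
    (h' : D.Dominated τ C' κ') : D.Dominated τ (C + C') (κ + κ') :=
  ⟨fun i => (h.aesm i).add (h'.aesm i), fun i s hs => by
    rw [add_mul]
    exact (abs_add_le _ _).trans (add_le_add (h.bound i s hs) (h'.bound i s hs))⟩

lemma Dominated.sub {C C' : ℝ} {κ κ' : Fin 5 → ℝ → ℝ} (h : D.Dominated τ C κ)
    (h' : D.Dominated τ C' κ') : D.Dominated τ (C + C') (κ - κ') :=
  ⟨fun i => (h.aesm i).sub (h'.aesm i), fun i s hs => by
    rw [add_mul]
    exact (abs_sub _ _).trans (add_le_add (h.bound i s hs) (h'.bound i s hs))⟩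

lemma Dominated.sum {ι : Type*} {c : ι → ℝ} {κ : ι → Fin 5 → ℝ → ℝ} (S : Finset ι)
    (h : ∀ n ∈ S, D.Dominated τ (c n) (κ n)) :
    D.Dominated τ (∑ n ∈ S, c n) (∑ n ∈ S, κ n) := by
  classical
  induction S using Finset.induction_on with
  | empty =>
    simp only [Finset.sum_empty]
    exact ⟨fun i => aestronglyMeasurable_const, fun i s hs => by simp⟩
  | insert a S ha ih =>
    rw [Finset.sum_insert ha, Finset.sum_insert ha]
    exact (h a (Finset.mem_insert_self a S)).add
      (ih fun n hn => h n (Finset.mem_insert_of_mem hn))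

lemma Rep_add {C C' : ℝ} {κ κ' : Fin 5 → ℝ → ℝ} (hD : D.Admissible T) (hτ : τ ∈ Ioc 0 T)
    (h : D.Dominated τ C κ) (h' : D.Dominated τ C' κ') :
    D.Rep τ (κ + κ') = D.Rep τ κ + D.Rep τ κ' := by
  rw [Rep, Rep, Rep, ← Finset.sum_add_distrib]
  refine Finset.sum_congr rfl fun i _ => ?_
  rw [← integral_add (h.integrableOn hD hτ i) (h'.integrableOn hD hτ i)]
  simp [mul_add]

lemma Rep_sub {C C' : ℝ} {κ κ' : Fin 5 → ℝ → ℝ} (hD : D.Admissible T) (hτ : τ ∈ Ioc 0 T)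
    (h : D.Dominated τ C κ) (h' : D.Dominated τ C' κ') :
    D.Rep τ (κ - κ') = D.Rep τ κ - D.Rep τ κ' := by
  rw [Rep, Rep, Rep, ← Finset.sum_sub_distrib]
  refine Finset.sum_congr rfl fun i _ => ?_
  rw [← integral_sub (h.integrableOn hD hτ i) (h'.integrableOn hD hτ i)]
  simp [mul_sub]

lemma Rep_sum {ι : Type*} {c : ι → ℝ} {κ : ι → Fin 5 → ℝ → ℝ} (hD : D.Admissible T)
    (hτ : τ ∈ Ioc 0 T) (S : Finset ι) (h : ∀ n ∈ S, D.Dominated τ (c n) (κ n)) :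
    D.Rep τ (∑ n ∈ S, κ n) = ∑ n ∈ S, D.Rep τ (κ n) := by
  classical
  induction S using Finset.induction_on with
  | empty => simp [Rep]
  | insert a S ha ih =>
    have h2 : ∀ n ∈ S, D.Dominated τ (c n) (κ n) := fun n hn => h n (Finset.mem_insert_of_mem hn)
    rw [Finset.sum_insert ha, Finset.sum_insert ha,
      Rep_add hD hτ (h a (Finset.mem_insert_self a S)) (Dominated.sum S h2), ih h2]

lemma Rep_smul (c : ℝ) (κ : Fin 5 → ℝ → ℝ) : D.Rep τ (c • κ) = c * D.Rep τ κ := by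
  rw [Rep, Rep, Finset.mul_sum]
  refine Finset.sum_congr rfl fun i _ => ?_
  rw [← integral_const_mul]
  refine integral_congr_ae (Eventually.of_forall fun s => ?_)
  simp only [Pi.smul_apply, smul_eq_mul]
  ring

/-- Dominated convergence in the five integrals at once; the sum over images, the limit of the
Fourier partial sums and the limit of the regular part at the boundary all rest on it. -/
lemma tendsto_Rep {ι : Type*} {F : Filter ι} [F.IsCountablyGenerated]
    {κ : ι → Fin 5 → ℝ → ℝ} {κ' : Fin 5 → ℝ → ℝ} {C : ℝ} (hD : D.Admissible T)
    (hτ : τ ∈ Ioc 0 T) (h : ∀ᶠ n in F, D.Dominated τ C (κ n))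
    (hl : ∀ i, ∀ s ∈ Ioo (D.lo i) (D.hi τ i), Tendsto (fun n => κ n i s) F (𝓝 (κ' i s))) :
    Tendsto (fun n => D.Rep τ (κ n)) F (𝓝 (D.Rep τ κ')) := by
  refine tendsto_finsetSum _ fun i _ => ?_
  refine tendsto_integral_filter_of_dominated_convergence
    (fun s => C * ‖D.wgt i s * dom τ i s‖) ?_ ?_ ((hD.integrableOn_wgt hτ i).norm.const_mul C) ?_
  · filter_upwards [h] with n hn
    exact (hD.integrableOn_data hτ i).aestronglyMeasurable.mul (hn.aesm i)
  · filter_upwards [h] with n hn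
    refine (ae_restrict_mem measurableSet_Ioo).mono fun s hs => ?_
    rw [norm_mul, norm_mul, Real.norm_eq_abs, Real.norm_eq_abs, Real.norm_eq_abs,
      abs_of_nonneg (dom_nonneg i s)]
    nlinarith [hn.bound i s hs, abs_nonneg (D.wgt i s)]
  · exact (ae_restrict_mem measurableSet_Ioo).mono fun s hs => (hl i s hs).const_mul _

lemma Dominated.of_tendsto {ι : Type*} {F : Filter ι} [F.NeBot] [F.IsCountablyGenerated]
    {κ : ι → Fin 5 → ℝ → ℝ} {κ' : Fin 5 → ℝ → ℝ} {C : ℝ} (h : ∀ n, D.Dominated τ C (κ n))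
    (hl : ∀ i, ∀ s ∈ Ioo (D.lo i) (D.hi τ i), Tendsto (fun n => κ n i s) F (𝓝 (κ' i s))) :
    D.Dominated τ C κ' where
  aesm i := aestronglyMeasurable_of_tendsto_ae F (fun n => (h n).aesm i)
    ((ae_restrict_mem measurableSet_Ioo).mono fun s hs => hl i s hs)
  bound i s hs := le_of_tendsto (hl i s hs).abs
    (Eventually.of_forall fun n => (h n).bound i s hs)

lemma Dominated.summable {ι : Type*} {c : ι → ℝ} {κ : ι → Fin 5 → ℝ → ℝ} (hc : Summable c)
    (h : ∀ n, D.Dominated τ (c n) (κ n)) (i : Fin 5) {s : ℝ}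
    (hs : s ∈ Ioo (D.lo i) (D.hi τ i)) : Summable fun n => κ n i s :=
  Summable.of_abs (Summable.of_nonneg_of_le (fun _ => abs_nonneg _)
    (fun n => (h n).bound i s hs) (hc.mul_right _))

lemma tendsto_sum_kernel {ι : Type*} {c : ι → ℝ} {κ : ι → Fin 5 → ℝ → ℝ} (hc : Summable c)
    (h : ∀ n, D.Dominated τ (c n) (κ n)) (i : Fin 5) (s : ℝ) (hs : s ∈ Ioo (D.lo i) (D.hi τ i)) :
    Tendsto (fun S : Finset ι => (∑ n ∈ S, κ n) i s) atTop (𝓝 (∑' n, κ n i s)) := by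
  simpa [HasSum] using (Dominated.summable hc h i hs).hasSum

lemma Dominated.tsum {ι : Type*} [Countable ι] {c : ι → ℝ} {κ : ι → Fin 5 → ℝ → ℝ}
    (hc : Summable c) (hc0 : ∀ n, 0 ≤ c n) (h : ∀ n, D.Dominated τ (c n) (κ n)) :
    D.Dominated τ (∑' n, c n) (fun i s => ∑' n, κ n i s) :=
  Dominated.of_tendsto (F := atTop) (κ := fun S : Finset ι => ∑ n ∈ S, κ n)
    (fun S => (Dominated.sum S fun n _ => h n).mono (hc.sum_le_tsum S fun n _ => hc0 n))
    (tendsto_sum_kernel hc h)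

lemma hasSum_Rep {ι : Type*} [Countable ι] {c : ι → ℝ} {κ : ι → Fin 5 → ℝ → ℝ}
    (hD : D.Admissible T) (hτ : τ ∈ Ioc 0 T) (hc : Summable c) (hc0 : ∀ n, 0 ≤ c n)
    (h : ∀ n, D.Dominated τ (c n) (κ n)) :
    HasSum (fun n => D.Rep τ (κ n)) (D.Rep τ fun i s => ∑' n, κ n i s) := by
  have := tendsto_Rep (F := atTop) (κ := fun S : Finset ι => ∑ n ∈ S, κ n) hD hτ
    (Eventually.of_forall fun S => (Dominated.sum S fun n _ => h n).mono
      (hc.sum_le_tsum S fun n _ => hc0 n)) (tendsto_sum_kernel hc h)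
  simp only [fun S : Finset ι => Rep_sum hD hτ S fun n _ => h n] at this
  simpa [HasSum] using this

lemma curve_sub (K L K' L' : ℝ → ℝ → ℝ) :
    D.curve (K - K') (L - L') = D.curve K L - D.curve K' L' := by
  ext i s; fin_cases i <;> rfl

lemma Dominated.intervalIntegrable {C : ℝ} {κ : Fin 5 → ℝ → ℝ} (hD : D.Admissible T)
    (hτ : τ ∈ Ioc 0 T) (h : D.Dominated τ C κ) (i : Fin 5) :
    IntervalIntegrable (fun s => D.wgt i s * κ i s) volume (D.lo i) (D.hi τ i) :=
  (intervalIntegrable_iff_integrableOn_Ioo_of_le (hD.lo_lt_hi hτ i).le).2 (h.integrableOn hD hτ i)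

lemma Rep_curve {C : ℝ} {K L : ℝ → ℝ → ℝ} (hD : D.Admissible T) (hτ : τ ∈ Ioc 0 T)
    (h : D.Dominated τ C (D.curve K L)) :
    D.Rep τ (D.curve K L) = (∫ ξ in (D.y 0)..(D.z 0), D.U0 ξ * K ξ 0)
      + (∫ s in (0)..τ, (D.Φ s + D.fp s * D.dz s) * K (D.z s) s)
      + (∫ s in (0)..τ, (D.Ψ s - D.fm s * D.dy s) * K (D.y s) s)
      + ∫ s in (0)..τ, (D.fm s * L (D.y s) s - D.fp s * L (D.z s) s) := by
  have hint := h.intervalIntegrable hD hτ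
  have h3 : IntervalIntegrable (fun s => D.fm s * L (D.y s) s) volume 0 τ := hint 3
  have h4 : IntervalIntegrable (fun s => -D.fp s * L (D.z s) s) volume 0 τ := hint 4
  have e : ∀ i, ∫ s in Ioo (D.lo i) (D.hi τ i), D.wgt i s * D.curve K L i s
      = ∫ s in (D.lo i)..(D.hi τ i), D.wgt i s * D.curve K L i s := fun i => by
    rw [intervalIntegral.integral_of_le (hD.lo_lt_hi hτ i).le, integral_Ioc_eq_integral_Ioo]
  have e34 : ∫ s in (0)..τ, (D.fm s * L (D.y s) s - D.fp s * L (D.z s) s)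
      = (∫ s in (0)..τ, D.fm s * L (D.y s) s) + ∫ s in (0)..τ, -D.fp s * L (D.z s) s := by
    rw [← intervalIntegral.integral_add h3 h4]
    simp only [neg_mul, sub_eq_add_neg]
  rw [Rep, Finset.sum_congr rfl fun i _ => e i, Fin.sum_univ_five, e34, ← add_assoc]
  rfl

end BarrierData

end

noncomputable section

namespace BarrierData

variable {D : BarrierData} {T τ : ℝ}

/-! ### Points on the five curves -/

/-- Differentiability at `τ` alone suffices: it gives the estimate on a `δ`-neighbourhood, and
further away boundedness of `g` gives it with slope `2 * M / δ`. The derivative may be unbounded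
near time `0`. -/
lemma exists_lipschitz_at {g : ℝ → ℝ} {g' : ℝ} (hg : ContinuousOn g (Icc 0 T))
    (hτ : τ ∈ Ioc 0 T) (hd : HasDerivWithinAt g g' (Icc 0 T) τ) :
    ∃ A, 0 ≤ A ∧ ∀ s ∈ Ico 0 τ, |g s - g τ| ≤ A * (τ - s) := by
  obtain ⟨M, hM⟩ := isCompact_Icc.exists_bound_of_continuousOn hg
  obtain ⟨c, hc⟩ := hd.differentiableWithinAt.isBigO_sub.bound
  rw [eventually_nhdsWithin_iff, Metric.eventually_nhds_iff] at hc
  obtain ⟨δ, hδ, hc⟩ := hc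
  have hM0 : 0 ≤ M := (norm_nonneg _).trans (hM τ ⟨hτ.1.le, hτ.2⟩)
  refine ⟨|c| + 2 * M / δ, by positivity, fun s hs => ?_⟩
  have hsT : s ∈ Icc 0 T := ⟨hs.1, hs.2.le.trans hτ.2⟩
  have hst : 0 < τ - s := sub_pos.2 hs.2
  rw [add_mul]
  rcases lt_or_ge (τ - s) δ with h | h
  · have h1 := hc (y := s) (by rw [Real.dist_eq, abs_sub_comm, abs_of_pos hst]; exact h) hsT
    rw [Real.norm_eq_abs, Real.norm_eq_abs, abs_sub_comm s τ, abs_of_pos hst] at h1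
    have : 0 ≤ 2 * M / δ * (τ - s) := by positivity
    nlinarith [le_abs_self c]
  · have h1 : |g s - g τ| ≤ 2 * M := by
      have := hM s hsT
      have := hM τ ⟨hτ.1.le, hτ.2⟩
      rw [Real.norm_eq_abs] at *
      linarith [abs_sub (g s) (g τ)]
    have h2 : 2 * M ≤ 2 * M / δ * (τ - s) := by
      rw [div_mul_eq_mul_div, le_div_iff₀ hδ]; gcongr
    have : 0 ≤ |c| * (τ - s) := by positivity
    linarith

/-- This reduces the five integrals to one case: each kernel is evaluated at a single point `(ξ, t)`
that approaches an endpoint of the strip at time `τ` no slower than linearly in `τ - t`. The initial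
interval is grouped with the upper boundary, which is harmless because there `τ - t = τ` is bounded
below. -/
lemma Admissible.exists_curve_point (hD : D.Admissible T) (hτ : τ ∈ Ioc 0 T) :
    ∃ A M, 0 < A ∧ ∀ i, ∀ s ∈ Ioo (D.lo i) (D.hi τ i), ∃ ξ t, 0 ≤ t ∧ t < τ ∧ |ξ| ≤ M ∧
      (i = 2 ∨ i = 3 → |ξ - D.y τ| ≤ A * (τ - t)) ∧
      (i ≠ 2 → i ≠ 3 → |ξ - D.z τ| ≤ A * (τ - t)) ∧
      (((∀ K L, D.curve K L i s = K ξ t) ∧ dom τ i s = 1) ∨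
        ((∀ K L, D.curve K L i s = L ξ t) ∧ dom τ i s = 1 / √(τ - t))) := by
  obtain ⟨A1, hA1, h1⟩ := exists_lipschitz_at hD.y_cont hτ (hD.y_deriv τ hτ)
  obtain ⟨A2, hA2, h2⟩ := exists_lipschitz_at hD.z_cont hτ (hD.z_deriv τ hτ)
  obtain ⟨M1, hM1⟩ := isCompact_Icc.exists_bound_of_continuousOn hD.y_cont
  obtain ⟨M2, hM2⟩ := isCompact_Icc.exists_bound_of_continuousOn hD.z_cont
  have hτ0 := hτ.1
  have hT0 : (0:ℝ) ∈ Icc 0 T := ⟨le_rfl, hτ.1.le.trans hτ.2⟩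
  have n1 : 0 ≤ M1 := (norm_nonneg _).trans (hM1 0 hT0)
  have n2 : 0 ≤ M2 := (norm_nonneg _).trans (hM2 0 hT0)
  -- The term `2 * (M1 + M2) / τ` serves the initial interval, where `t = 0` and all distances are
  -- at most `2 * (M1 + M2)`; the final `1` makes `A` positive.
  set A := A1 + A2 + 2 * (M1 + M2) / τ + 1 with hA
  have hM0 : 0 ≤ 2 * (M1 + M2) / τ := by positivity
  have hy : ∀ s ∈ Ioo 0 τ, |D.y s - D.y τ| ≤ A * (τ - s) := fun s hs =>
    (h1 s ⟨hs.1.le, hs.2⟩).trans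
      (mul_le_mul_of_nonneg_right (by linarith) (sub_pos.2 hs.2).le)
  have hz : ∀ s ∈ Ioo 0 τ, |D.z s - D.z τ| ≤ A * (τ - s) := fun s hs =>
    (h2 s ⟨hs.1.le, hs.2⟩).trans
      (mul_le_mul_of_nonneg_right (by linarith) (sub_pos.2 hs.2).le)
  have hyM : ∀ s ∈ Ioo 0 τ, |D.y s| ≤ M1 + M2 := fun s hs =>
    (hM1 s ⟨hs.1.le, hs.2.le.trans hτ.2⟩).trans (by linarith)
  have hzM : ∀ s ∈ Ioo 0 τ, |D.z s| ≤ M1 + M2 := fun s hs =>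
    (hM2 s ⟨hs.1.le, hs.2.le.trans hτ.2⟩).trans (by linarith)
  refine ⟨A, M1 + M2, by positivity, fun i s hs => ?_⟩
  fin_cases i
  · have hs' : s ∈ Ioo (D.y 0) (D.z 0) := hs
    have a1 := hM1 0 hT0
    have a2 := hM2 0 hT0
    have a3 := hM2 τ ⟨hτ.1.le, hτ.2⟩
    rw [Real.norm_eq_abs, abs_le] at a1 a2 a3
    refine ⟨s, 0, le_rfl, hτ0, abs_le.2 ⟨by linarith [hs'.1], by linarith [hs'.2]⟩,
      by simp, fun _ _ => ?_, Or.inl ⟨fun _ _ => rfl, rfl⟩⟩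
    have : 2 * (M1 + M2) ≤ A * (τ - 0) := by
      rw [sub_zero, hA, add_mul, add_mul, div_mul_cancel₀ _ hτ0.ne']
      nlinarith [mul_nonneg hA1 hτ0.le, mul_nonneg hA2 hτ0.le]
    exact (abs_le.2 ⟨by linarith [hs'.1], by linarith [hs'.2]⟩ :
      |s - D.z τ| ≤ 2 * (M1 + M2)).trans this
  · exact ⟨D.z s, s, (hs : s ∈ Ioo 0 τ).1.le, hs.2, hzM s hs, by simp, fun _ _ => hz s hs,
      Or.inl ⟨fun _ _ => rfl, rfl⟩⟩
  · exact ⟨D.y s, s, (hs : s ∈ Ioo 0 τ).1.le, hs.2, hyM s hs, fun _ => hy s hs, by simp,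
      Or.inl ⟨fun _ _ => rfl, rfl⟩⟩
  · exact ⟨D.y s, s, (hs : s ∈ Ioo 0 τ).1.le, hs.2, hyM s hs, fun _ => hy s hs, by simp,
      Or.inr ⟨fun _ _ => rfl, rfl⟩⟩
  · exact ⟨D.z s, s, (hs : s ∈ Ioo 0 τ).1.le, hs.2, hzM s hs, by simp, fun _ _ => hz s hs,
      Or.inr ⟨fun _ _ => rfl, rfl⟩⟩

lemma Admissible.aestronglyMeasurable_curve (hD : D.Admissible T) (hτ : τ ∈ Ioc 0 T)
    {K L : ℝ → ℝ → ℝ} (hK : Measurable (Function.uncurry K))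
    (hL : Measurable (Function.uncurry L)) (i : Fin 5) :
    AEStronglyMeasurable (D.curve K L i) (volume.restrict (Ioo (D.lo i) (D.hi τ i))) := by
  have hsub2 : Ioo 0 τ ⊆ Icc 0 T :=
    (Ioo_subset_Ioo_right hτ.2).trans Ioo_subset_Icc_self
  have hy : AEMeasurable D.y (volume.restrict (Ioo 0 τ)) :=
    (hD.y_cont.mono hsub2).aemeasurable measurableSet_Ioo
  have hz : AEMeasurable D.z (volume.restrict (Ioo 0 τ)) :=
    (hD.z_cont.mono hsub2).aemeasurable measurableSet_Ioo
  fin_cases i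
  · exact (hK.comp (measurable_id.prodMk measurable_const)).aestronglyMeasurable
  · exact (hK.comp_aemeasurable (hz.prodMk aemeasurable_id)).aestronglyMeasurable
  · exact (hK.comp_aemeasurable (hy.prodMk aemeasurable_id)).aestronglyMeasurable
  · exact (hL.comp_aemeasurable (hy.prodMk aemeasurable_id)).aestronglyMeasurable
  · exact (hL.comp_aemeasurable (hz.prodMk aemeasurable_id)).aestronglyMeasurable

/-! ### A single Gaussian source -/

/-- The Gaussian kernel with centre `c` and final time `τ`, in the variables `ξ`, `s`. -/
def ctrK (τ c : ℝ) : ℝ → ℝ → ℝ := fun ξ s => gaussK (τ - s) (c - ξ)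

/-- The `ξ`-derivative of `ctrK`. -/
def ctrL (τ c : ℝ) : ℝ → ℝ → ℝ := fun ξ s => gaussQ (τ - s) (c - ξ)

lemma measurable_ctrK (τ c : ℝ) : Measurable (Function.uncurry (ctrK τ c)) :=
  measurable_gaussK.comp (f := fun p : ℝ × ℝ => (τ - p.2, c - p.1)) (by fun_prop)

lemma measurable_ctrL (τ c : ℝ) : Measurable (Function.uncurry (ctrL τ c)) :=
  measurable_gaussQ.comp (f := fun p : ℝ × ℝ => (τ - p.2, c - p.1)) (by fun_prop)

lemma one_le_inv_sqrt_mul {t : ℝ} (ht : 0 ≤ t) (htτ : t < τ) :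
    1 ≤ (1 + √τ) * (1 / √(τ - t)) := by
  have h : 0 < √(τ - t) := Real.sqrt_pos.2 (sub_pos.2 htτ)
  rw [mul_one_div, le_div_iff₀ h, one_mul]
  exact (Real.sqrt_le_sqrt (by linarith : τ - t ≤ τ)).trans (by linarith)

/-- By the triangle inequality a centre at distance `d` from both endpoints satisfies the hypothesis
of `exists_gauss_bound` at every curve point. The constant does not depend on `c`, and the decay in
`c` makes the images summable. -/
lemma Admissible.exists_dominated_ctr (hD : D.Admissible T) (hτ : τ ∈ Ioc 0 T) {d : ℝ}
    (hd : 0 < d) : ∃ B, 0 ≤ B ∧ ∀ c, d ≤ |c - D.y τ| → d ≤ |c - D.z τ| →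
      D.Dominated τ (B / (1 + c ^ 2)) (D.curve (ctrK τ c) (ctrL τ c)) := by
  obtain ⟨A, M, hA, hpt⟩ := hD.exists_curve_point hτ
  obtain ⟨B, hB, hb⟩ := exists_gauss_bound (τ := τ) hd hA
  refine ⟨B * (2 * (1 + M ^ 2)) * (1 + √τ), by positivity, fun c hcy hcz =>
    ⟨hD.aestronglyMeasurable_curve hτ (measurable_ctrK τ c) (measurable_ctrL τ c), ?_⟩⟩
  intro i s hs
  obtain ⟨ξ, t, ht0, htτ, hξ, hξy, hξz, h⟩ := hpt i s hs
  have hw : d ≤ A * (τ - t) + |c - ξ| := by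
    by_cases hi : i = 2 ∨ i = 3
    · linarith [hξy hi, abs_sub_le c ξ (D.y τ)]
    · push Not at hi
      linarith [hξz hi.1 hi.2, abs_sub_le c ξ (D.z τ)]
  obtain ⟨b1, b2⟩ := hb (τ - t) (c - ξ) (sub_pos.2 htτ) (by linarith) hw
  -- Since `|ξ| ≤ M`, one has `1 + c² ≤ 2 (1 + M²) (1 + (c - ξ)²)`.
  have hc : B / (1 + (c - ξ) ^ 2) ≤ B * (2 * (1 + M ^ 2)) / (1 + c ^ 2) := by
    have hξ2 : ξ ^ 2 ≤ M ^ 2 := by rw [← sq_abs]; gcongr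
    rw [div_le_div_iff₀ (by positivity) (by positivity), mul_assoc]
    gcongr
    nlinarith [sq_nonneg (c - ξ - ξ), mul_nonneg (sq_nonneg (c - ξ)) (sq_nonneg M)]
  have h0 : 0 ≤ B * (2 * (1 + M ^ 2)) / (1 + c ^ 2) := by positivity
  have h1 := one_le_inv_sqrt_mul ht0 htτ
  have e : ∀ r, B * (2 * (1 + M ^ 2)) * (1 + √τ) / (1 + c ^ 2) * r
      = B * (2 * (1 + M ^ 2)) / (1 + c ^ 2) * ((1 + √τ) * r) := fun r => by ring
  rcases h with ⟨h, hdom⟩ | ⟨h, hdom⟩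
  · rw [h, hdom, e, ctrK, abs_of_nonneg (gaussK_nonneg _ _), mul_one]
    exact (b1.trans hc).trans (le_mul_of_one_le_right h0 (by linarith [Real.sqrt_nonneg τ]))
  · rw [h, hdom, e, ctrL]
    exact (b2.trans hc).trans (le_mul_of_one_le_right h0 h1)

/-! ### The image kernels -/

/-- The five kernels of the `n`-th image term. -/
def imageKer (D : BarrierData) (τ x : ℝ) (n : ℤ) : Fin 5 → ℝ → ℝ :=
  D.curve (fun ξ s => D.Upsilon n x τ ξ s) (fun ξ s => D.Lam n x τ ξ s)

lemma Upsilon_eq (n : ℤ) (x ξ s : ℝ) : D.Upsilon n x τ ξ s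
    = gaussK (τ - s) (2 * n * D.l τ + (x - ξ))
      - gaussK (τ - s) (2 * n * D.l τ + (x + ξ - 2 * D.y τ)) := by
  rw [Upsilon, gaussK, gaussK, mul_sub]
  ring_nf

lemma Lam_eq (n : ℤ) (x ξ s : ℝ) : D.Lam n x τ ξ s
    = gaussQ (τ - s) (2 * n * D.l τ + (x - ξ))
      + gaussQ (τ - s) (2 * n * D.l τ + (x + ξ - 2 * D.y τ)) := by
  rw [Lam, gaussQ, gaussQ]
  ring_nf

/-- The second centre is the reflection of the first in `y τ`. As `gaussK` is even and `gaussQ` odd,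
the minus sign in `Upsilon` and the plus sign in `Lam` both become the same difference of sources.
-/
lemma imageKer_eq (x : ℝ) (n : ℤ) : D.imageKer τ x n
    = D.curve (ctrK τ (2 * n * D.l τ + x)) (ctrL τ (2 * n * D.l τ + x))
      - D.curve (ctrK τ (2 * D.y τ - x - 2 * n * D.l τ))
          (ctrL τ (2 * D.y τ - x - 2 * n * D.l τ)) := by
  rw [← curve_sub, imageKer]
  congr 1
  · ext ξ s
    rw [Upsilon_eq, Pi.sub_apply, Pi.sub_apply, ctrK, ctrK, ← gaussK_neg _ (2 * D.y τ - _ - _ - _)]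
    ring_nf
  · ext ξ s
    rw [Lam_eq, Pi.sub_apply, Pi.sub_apply, ctrL, ctrL, ← neg_neg (2 * D.y τ - _ - _ - _),
      gaussQ_neg]
    ring_nf

lemma summable_image_bound {l : ℝ} (hl : 0 < l) :
    Summable fun n : ℤ => 1 / (1 + (2 * (n : ℝ) * l) ^ 2) := by
  have h1 : Summable fun n : ℤ => 1 / (4 * l ^ 2) * (1 / (n : ℝ) ^ 2) :=
    (Real.summable_one_div_int_pow.2 (by norm_num)).mul_left _
  have h2 : Summable fun n : ℤ => if n = 0 then (1 : ℝ) else 0 := (hasSum_ite_eq 0 1).summable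
  refine Summable.of_nonneg_of_le (fun n => by positivity) (fun n => ?_) (h1.add h2)
  by_cases hn : n = 0
  · simp [hn]
  · have hn' : (n : ℝ) ≠ 0 := Int.cast_ne_zero.2 hn
    simp only [hn, if_false, add_zero]
    rw [one_div_mul_one_div]
    have : 0 < (n : ℝ) ^ 2 := by positivity
    gcongr
    nlinarith

/-- Up to sign, the distances of the two centres from `y τ` and `z τ` are `m * l + (x - y τ)` with
`m = 2n, 2n - 1` for the first and `m = 2n, 2n + 1` for the second. The bound is uniform in `x`, as
the limit at the boundary requires. -/
lemma Admissible.exists_dominated_image (hD : D.Admissible T) (hτ : τ ∈ Ioc 0 T) {d : ℝ}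
    (hd : 0 < d) : ∃ B, 0 ≤ B ∧ ∀ x ∈ Icc (D.y τ) (D.z τ), ∀ n : ℤ,
      (∀ m : ℤ, (m = 2 * n ∨ m = 2 * n - 1 ∨ m = 2 * n + 1) →
        d ≤ |m * D.l τ + (x - D.y τ)|) →
      D.Dominated τ (B * (1 / (1 + (2 * (n : ℝ) * D.l τ) ^ 2))) (D.imageKer τ x n) := by
  obtain ⟨B, hB, hb⟩ := hD.exists_dominated_ctr hτ hd
  set E := 2 * |D.y τ| + |D.y τ| + |D.z τ| with hE
  refine ⟨B * (2 * (1 + E ^ 2)) + B * (2 * (1 + E ^ 2)), by positivity, fun x hx n hn => ?_⟩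
  have hz : D.z τ = D.y τ + D.l τ := by rw [l]; ring
  have hxE : |x| ≤ |D.y τ| + |D.z τ| := by
    rw [abs_le]
    constructor
    · linarith [hx.1, neg_abs_le (D.y τ), abs_nonneg (D.z τ)]
    · linarith [hx.2, le_abs_self (D.z τ), abs_nonneg (D.y τ)]
  have key : ∀ c e : ℝ, |e| ≤ E → (2 * n * D.l τ) ^ 2 = (c + e) ^ 2 →
      B / (1 + c ^ 2) ≤ B * (2 * (1 + E ^ 2)) * (1 / (1 + (2 * (n : ℝ) * D.l τ) ^ 2)) := by
    intro c e he h
    have he2 : e ^ 2 ≤ E ^ 2 := by rw [← sq_abs]; gcongr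
    rw [mul_one_div, h, div_le_div_iff₀ (by positivity) (by positivity), mul_assoc]
    gcongr
    nlinarith [sq_nonneg (c - e), mul_nonneg (sq_nonneg c) (sq_nonneg E)]
  rw [imageKer_eq, add_mul]
  refine Dominated.sub ((hb _ ?_ ?_).mono (key _ (-x) ?_ (by ring)))
    ((hb _ ?_ ?_).mono (key _ (x - 2 * D.y τ) ?_ (by ring)))
  · convert hn (2 * n) (by simp) using 2
    push_cast; ring
  · convert hn (2 * n - 1) (by simp) using 2
    rw [hz]; push_cast; ring
  · rw [abs_neg]; linarith [abs_nonneg (D.y τ)]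
  · rw [← abs_neg]
    convert hn (2 * n) (by simp) using 2
    push_cast; ring
  · rw [← abs_neg]
    convert hn (2 * n + 1) (by simp) using 2
    rw [hz]; push_cast; ring
  · refine (abs_sub _ _).trans ?_
    rw [abs_mul, abs_of_pos (by norm_num : (0 : ℝ) < 2)]
    linarith

lemma le_abs_int_mul_add {l h d : ℝ} (hl : 0 < l) (h1 : d ≤ h) (h2 : h ≤ l - d) (m : ℤ) :
    d ≤ |m * l + h| := by
  rcases le_or_gt 0 m with hm | hm
  · have : (0 : ℝ) ≤ m := by exact_mod_cast hm
    exact le_trans (by nlinarith) (le_abs_self _)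
  · have : (m : ℝ) ≤ -1 := by exact_mod_cast Int.le_sub_one_of_lt hm
    exact le_trans (by nlinarith) (neg_le_abs _)

lemma Admissible.exists_dominated_image_interior (hD : D.Admissible T) (hτ : τ ∈ Ioc 0 T) {x : ℝ}
    (hx : x ∈ Ioo (D.y τ) (D.z τ)) : ∃ B, 0 ≤ B ∧ ∀ n : ℤ,
      D.Dominated τ (B * (1 / (1 + (2 * (n : ℝ) * D.l τ) ^ 2))) (D.imageKer τ x n) := by
  have hl : 0 < D.l τ := sub_pos.2 (hx.1.trans hx.2)
  obtain ⟨B, hB, hb⟩ := hD.exists_dominated_image hτ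
    (lt_min (sub_pos.2 hx.1) (sub_pos.2 hx.2))
  refine ⟨B, hB, fun n => hb x (Ioo_subset_Icc_self hx) n fun m _ =>
    le_abs_int_mul_add hl (min_le_left _ _) ?_ m⟩
  rw [l]
  linarith [min_le_right (x - D.y τ) (D.z τ - x)]

lemma imageTerm_eq_Rep {C : ℝ} (hD : D.Admissible T) (hτ : τ ∈ Ioc 0 T) {x : ℝ} {n : ℤ}
    (h : D.Dominated τ C (D.imageKer τ x n)) : D.imageTerm τ x n = D.Rep τ (D.imageKer τ x n) :=
  (Rep_curve hD hτ h).symm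

lemma imageIntegrable_of_dominated {C : ℝ} (hD : D.Admissible T) (hτ : τ ∈ Ioc 0 T) {x : ℝ}
    {n : ℤ} (h : D.Dominated τ C (D.imageKer τ x n)) : D.ImageIntegrable τ x n := by
  have hint := h.intervalIntegrable hD hτ
  have h3 : IntervalIntegrable (fun s => D.fm s * D.Lam n x τ (D.y s) s) volume 0 τ := hint 3
  have h4 : IntervalIntegrable (fun s => -D.fp s * D.Lam n x τ (D.z s) s) volume 0 τ := hint 4
  refine ⟨hint 0, hint 1, hint 2, ?_⟩
  simpa only [neg_mul, sub_eq_add_neg] using h3.add h4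

end BarrierData

end

noncomputable section

namespace BarrierData

variable {D : BarrierData} {T τ : ℝ}

/-! ### The Fourier kernels -/

/-- The `n`-th sine mode in the variables `ξ`, `s`. -/
def sinK (D : BarrierData) (τ : ℝ) (n : ℕ) : ℝ → ℝ → ℝ := fun ξ s =>
  exp (-(D.freq τ n) ^ 2 * (τ - s)) * sin (D.freq τ n * (ξ - D.y τ))

/-- The `ξ`-derivative of `sinK`. -/
def sinL (D : BarrierData) (τ : ℝ) (n : ℕ) : ℝ → ℝ → ℝ := fun ξ s =>
  exp (-(D.freq τ n) ^ 2 * (τ - s)) * (D.freq τ n * cos (D.freq τ n * (ξ - D.y τ)))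

/-- The five kernels of the `n`-th Fourier term. -/
def fourierKer (D : BarrierData) (τ x : ℝ) (n : ℕ) : Fin 5 → ℝ → ℝ :=
  (2 / D.l τ * sin (D.freq τ n * (x - D.y τ))) • D.curve (D.sinK τ n) (D.sinL τ n)

lemma measurable_sinK (n : ℕ) : Measurable (Function.uncurry (D.sinK τ n)) := by
  unfold Function.uncurry sinK; fun_prop

lemma measurable_sinL (n : ℕ) : Measurable (Function.uncurry (D.sinL τ n)) := by
  unfold Function.uncurry sinL; fun_prop

lemma Admissible.exists_dominated_sin (hD : D.Admissible T) (hτ : τ ∈ Ioc 0 T) (n : ℕ) :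
    ∃ C, D.Dominated τ C (D.curve (D.sinK τ n) (D.sinL τ n)) := by
  obtain ⟨A, M, hA, hpt⟩ := hD.exists_curve_point hτ
  set w := D.freq τ n with hw
  refine ⟨(1 + |w|) * (1 + √τ), hD.aestronglyMeasurable_curve hτ (measurable_sinK n)
    (measurable_sinL n), fun i s hs => ?_⟩
  obtain ⟨ξ, t, ht0, htτ, -, -, -, h⟩ := hpt i s hs
  have hE : exp (-w ^ 2 * (τ - t)) ≤ 1 := Real.exp_le_one_iff.2 (by
    nlinarith [mul_nonneg (sq_nonneg w) (sub_pos.2 htτ).le])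
  have h1 := one_le_inv_sqrt_mul ht0 htτ
  have hw0 := abs_nonneg w
  rcases h with ⟨h, hdom⟩ | ⟨h, hdom⟩
  · rw [h, hdom, sinK, abs_mul, abs_of_pos (Real.exp_pos _)]
    have := abs_sin_le_one (w * (ξ - D.y τ))
    calc _ ≤ (1 : ℝ) * 1 := by gcongr
      _ ≤ (1 + |w|) * (1 + √τ) * 1 := by nlinarith [Real.sqrt_nonneg τ]
  · rw [h, hdom, sinL, abs_mul, abs_mul, abs_of_pos (Real.exp_pos _), mul_assoc]
    have := abs_cos_le_one (w * (ξ - D.y τ))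
    calc _ ≤ (1 : ℝ) * (|w| * 1) := by gcongr
      _ ≤ (1 + |w|) * 1 := by linarith
      _ ≤ (1 + |w|) * ((1 + √τ) * (1 / √(τ - t))) := by gcongr

lemma Dominated.smul {C : ℝ} {κ : Fin 5 → ℝ → ℝ} (c : ℝ) (h : D.Dominated τ C κ) :
    D.Dominated τ (|c| * C) (c • κ) :=
  ⟨fun i => (h.aesm i).const_mul c, fun i s hs => by
    rw [Pi.smul_apply, Pi.smul_apply, smul_eq_mul, abs_mul, mul_assoc]
    exact mul_le_mul_of_nonneg_left (h.bound i s hs) (abs_nonneg c)⟩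

lemma Admissible.exists_dominated_fourierKer (hD : D.Admissible T) (hτ : τ ∈ Ioc 0 T) (x : ℝ)
    (n : ℕ) : ∃ C, D.Dominated τ C (D.fourierKer τ x n) := by
  obtain ⟨C, h⟩ := hD.exists_dominated_sin hτ n
  exact ⟨_, h.smul _⟩

/-- The sine terms of `beta`, which carry `dy` and `dz`, join the single layers; its cosine terms
are the double layers. -/
lemma fourierIntegrand_eq (n : ℕ) (s : ℝ) : D.fourierIntegrand τ n s
    = D.wgt 1 s * D.curve (D.sinK τ n) (D.sinL τ n) 1 s
      + D.wgt 2 s * D.curve (D.sinK τ n) (D.sinL τ n) 2 s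
      + (D.wgt 3 s * D.curve (D.sinK τ n) (D.sinL τ n) 3 s
      + D.wgt 4 s * D.curve (D.sinK τ n) (D.sinL τ n) 4 s) := by
  simp only [fourierIntegrand, beta, wgt, curve, sinK, sinL, Matrix.cons_val]
  ring

lemma Admissible.fourierIntegrable (hD : D.Admissible T) (hτ : τ ∈ Ioc 0 T) (n : ℕ) :
    D.FourierIntegrable τ n := by
  obtain ⟨C, h⟩ := hD.exists_dominated_sin hτ n
  have hint := h.intervalIntegrable hD hτ
  constructor
  · have h0 : IntervalIntegrable (fun ξ => D.U0 ξ * D.sinK τ n ξ 0) volume (D.y 0) (D.z 0) := hint 0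
    refine (h0.const_mul (exp (D.freq τ n ^ 2 * τ))).congr ?_
    refine fun ξ _ => ?_
    have : exp (D.freq τ n ^ 2 * τ) * exp (-(D.freq τ n) ^ 2 * (τ - 0)) = 1 := by
      rw [← Real.exp_add]; ring_nf; simp
    simp only [sinK]
    linear_combination D.U0 ξ * sin (D.freq τ n * (ξ - D.y τ)) * this
  · refine (((hint 1).add (hint 2)).add ((hint 3).add (hint 4))).congr ?_
    exact fun s _ => (fourierIntegrand_eq n s).symm

lemma Admissible.fourierTerm_eq_Rep (hD : D.Admissible T) (hτ : τ ∈ Ioc 0 T) (x : ℝ) (n : ℕ) :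
    D.fourierTerm τ x n = D.Rep τ (D.fourierKer τ x n) := by
  obtain ⟨C, h⟩ := hD.exists_dominated_sin hτ n
  have hint := h.intervalIntegrable hD hτ
  have e : ∫ s in (0)..τ, D.fourierIntegrand τ n s
      = (∫ s in (0)..τ, (D.Φ s + D.fp s * D.dz s) * D.sinK τ n (D.z s) s)
      + (∫ s in (0)..τ, (D.Ψ s - D.fm s * D.dy s) * D.sinK τ n (D.y s) s)
      + ∫ s in (0)..τ, (D.fm s * D.sinL τ n (D.y s) s - D.fp s * D.sinL τ n (D.z s) s) := by
    have h1 : IntervalIntegrable (fun s => (D.Φ s + D.fp s * D.dz s) * D.sinK τ n (D.z s) s)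
      volume 0 τ := hint 1
    have h2 : IntervalIntegrable (fun s => (D.Ψ s - D.fm s * D.dy s) * D.sinK τ n (D.y s) s)
      volume 0 τ := hint 2
    have h3 : IntervalIntegrable (fun s => D.fm s * D.sinL τ n (D.y s) s) volume 0 τ := hint 3
    have h4 : IntervalIntegrable (fun s => -D.fp s * D.sinL τ n (D.z s) s) volume 0 τ := hint 4
    have h34 : IntervalIntegrable
        (fun s => D.fm s * D.sinL τ n (D.y s) s - D.fp s * D.sinL τ n (D.z s) s) volume 0 τ := by
      simpa only [neg_mul, sub_eq_add_neg] using h3.add h4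
    rw [← intervalIntegral.integral_add h1 h2, ← intervalIntegral.integral_add (h1.add h2) h34]
    congr 1
    ext s
    simp only [fourierIntegrand, beta, sinK, sinL]
    ring
  have e0 : exp (-(D.freq τ n) ^ 2 * τ) *
      (∫ ξ in (D.y 0)..(D.z 0), D.U0 ξ * sin (D.freq τ n * (ξ - D.y τ)))
      = ∫ ξ in (D.y 0)..(D.z 0), D.U0 ξ * D.sinK τ n ξ 0 := by
    rw [← intervalIntegral.integral_const_mul]
    congr 1
    ext ξ
    simp only [sinK, sub_zero]
    ring
  rw [fourierKer, Rep_smul, Rep_curve hD hτ h, fourierTerm, e, e0]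
  ring

lemma freq_eq (n : ℕ) : D.freq τ n = waveNum (D.l τ) n := rfl

/-- The product of sines becomes a difference of two cosines, matching the two Gaussians of
`Upsilon` mode by mode. -/
lemma fourierKer_apply_K {x ξ t s : ℝ} {n : ℕ} {i : Fin 5}
    (h : ∀ K L, D.curve K L i s = K ξ t) : D.fourierKer τ x n i s
    = 1 / D.l τ * (exp (-waveNum (D.l τ) n ^ 2 * (τ - t)) * cos (waveNum (D.l τ) n * (x - ξ)))
      - 1 / D.l τ * (exp (-waveNum (D.l τ) n ^ 2 * (τ - t))
        * cos (waveNum (D.l τ) n * (x + ξ - 2 * D.y τ))) := by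
  rw [fourierKer, Pi.smul_apply, Pi.smul_apply, h, smul_eq_mul, sinK, freq_eq]
  set w := waveNum (D.l τ) n
  rw [show w * (x - ξ) = w * (x - D.y τ) - w * (ξ - D.y τ) by ring,
    show w * (x + ξ - 2 * D.y τ) = w * (x - D.y τ) + w * (ξ - D.y τ) by ring, cos_sub, cos_add]
  ring

lemma fourierKer_apply_L {x ξ t s : ℝ} {n : ℕ} {i : Fin 5}
    (h : ∀ K L, D.curve K L i s = L ξ t) : D.fourierKer τ x n i s
    = 1 / D.l τ * (waveNum (D.l τ) n * exp (-waveNum (D.l τ) n ^ 2 * (τ - t))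
        * sin (waveNum (D.l τ) n * (x - ξ)))
      + 1 / D.l τ * (waveNum (D.l τ) n * exp (-waveNum (D.l τ) n ^ 2 * (τ - t))
        * sin (waveNum (D.l τ) n * (x + ξ - 2 * D.y τ))) := by
  rw [fourierKer, Pi.smul_apply, Pi.smul_apply, h, smul_eq_mul, sinL, freq_eq]
  set w := waveNum (D.l τ) n
  rw [show w * (x - ξ) = w * (x - D.y τ) - w * (ξ - D.y τ) by ring,
    show w * (x + ξ - 2 * D.y τ) = w * (x - D.y τ) + w * (ξ - D.y τ) by ring, sin_sub, sin_add]
  ring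

/-- Poisson summation: the image kernels and the Fourier kernels have the same sum. -/
lemma Admissible.hasSum_fourierKer (hD : D.Admissible T) (hτ : τ ∈ Ioc 0 T) (x : ℝ)
    (i : Fin 5) {s : ℝ} (hs : s ∈ Ioo (D.lo i) (D.hi τ i)) :
    HasSum (fun n : ℕ => D.fourierKer τ x (n + 1) i s) (∑' n : ℤ, D.imageKer τ x n i s) := by
  have hl : 0 < D.l τ := sub_pos.2 (hD.y_lt_z τ ⟨hτ.1.le, hτ.2⟩)
  obtain ⟨A, M, hA, hpt⟩ := hD.exists_curve_point hτ
  obtain ⟨ξ, t, ht0, htτ, -, -, -, h⟩ := hpt i s hs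
  have hσ : 0 < τ - t := sub_pos.2 htτ
  rcases h with ⟨h, -⟩ | ⟨h, -⟩
  · obtain ⟨θ1, a1, b1⟩ := exists_hasSum_gaussK hl hσ (x - ξ)
    obtain ⟨θ2, a2, b2⟩ := exists_hasSum_gaussK hl hσ (x + ξ - 2 * D.y τ)
    have e : (fun n : ℤ => D.imageKer τ x n i s) = fun n : ℤ => _ :=
      funext fun n => (h _ _).trans (Upsilon_eq n x ξ t)
    rw [e, (a1.sub a2).tsum_eq]
    have := b1.sub b2
    -- The two zero modes `1 / (2 * l)` cancel here.
    rw [sub_sub_sub_cancel_right] at this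
    exact hasSum_of_eq this fun n => fourierKer_apply_K h
  · obtain ⟨θ1, a1, b1⟩ := exists_hasSum_gaussQ hl hσ (x - ξ)
    obtain ⟨θ2, a2, b2⟩ := exists_hasSum_gaussQ hl hσ (x + ξ - 2 * D.y τ)
    have e : (fun n : ℤ => D.imageKer τ x n i s) = fun n : ℤ => _ :=
      funext fun n => (h _ _).trans (Lam_eq n x ξ t)
    rw [e, (a1.add a2).tsum_eq]
    exact hasSum_of_eq (b1.add b2) fun n => fourierKer_apply_L h

lemma abs_sin_sub_le (a b : ℝ) : |sin a - sin b| ≤ |a - b| := by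
  have := Convex.norm_image_sub_le_of_norm_hasDerivWithin_le (f := sin) (s := univ)
    (f' := cos) (C := 1) (x := b) (y := a)
    (fun x _ => (hasDerivAt_sin x).hasDerivWithinAt)
    (fun x _ => abs_cos_le_one x) convex_univ trivial trivial
  simpa using this

/-- As `s` tends to `τ` along the boundaries, the arguments `x - ξ` and `x + ξ - 2 y τ` tend to `h`
on the lower curve and to `h - l` and `h + l` on the upper one, where `h = x - y τ`. The half-angle
sines there are `sin φ` and `∓ cos φ` with `0 < φ < π / 2`, hence nonzero, and `near` carries this
over to earlier times at a cost linear in `τ - t`. -/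
lemma Admissible.exists_dominated_fourier (hD : D.Admissible T) (hτ : τ ∈ Ioc 0 T) {x : ℝ}
    (hx : x ∈ Ioo (D.y τ) (D.z τ)) :
    ∃ C, ∀ N, D.Dominated τ C (∑ n ∈ Finset.range N, D.fourierKer τ x (n + 1)) := by
  have hl : 0 < D.l τ := sub_pos.2 (hx.1.trans hx.2)
  have hz : D.z τ = D.y τ + D.l τ := by rw [l]; ring
  obtain ⟨A, M, hA, hpt⟩ := hD.exists_curve_point hτ
  set h := x - D.y τ with hh
  have hh0 : 0 < h := sub_pos.2 hx.1
  have hhl : h < D.l τ := by rw [l]; linarith [hx.2]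
  set φ := π * h / (2 * D.l τ) with hφ
  have hφ0 : 0 < φ := by positivity
  have hφ2 : φ < π / 2 := by
    rw [hφ, div_lt_div_iff₀ (by positivity) (by positivity)]
    nlinarith [pi_pos]
  have hs0 : 0 < sin φ := sin_pos_of_pos_of_lt_pi hφ0 (by linarith [pi_pos])
  have hc0 : 0 < cos φ := cos_pos_of_mem_Ioo ⟨by linarith [pi_pos], hφ2⟩
  set d := min (sin φ) (cos φ) with hd
  have hd0 : 0 < d := lt_min hs0 hc0
  have hA' : 0 < π / (2 * D.l τ) * A := by positivity
  obtain ⟨B, hB, hb⟩ := exists_fourier_bound τ hl hd0 hA'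
  have near : ∀ {u u0 r : ℝ}, 0 ≤ r → |u - u0| ≤ A * r → d ≤ |sin (π * u0 / (2 * D.l τ))| →
      d ≤ π / (2 * D.l τ) * A * r + |sin (π * u / (2 * D.l τ))| := by
    intro u u0 r _ h1 h2
    have h3 := abs_sin_sub_le (π * u0 / (2 * D.l τ)) (π * u / (2 * D.l τ))
    rw [show π * u0 / (2 * D.l τ) - π * u / (2 * D.l τ) = -(π / (2 * D.l τ) * (u - u0)) by ring,
      abs_neg, abs_mul, abs_of_pos (by positivity : 0 < π / (2 * D.l τ))] at h3
    have h4 : π / (2 * D.l τ) * |u - u0| ≤ π / (2 * D.l τ) * (A * r) := by gcongr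
    linarith [abs_sub_abs_le_abs_sub (sin (π * u0 / (2 * D.l τ))) (sin (π * u / (2 * D.l τ)))]
  have s1 : d ≤ |sin (π * h / (2 * D.l τ))| := by
    rw [← hφ, abs_of_pos hs0]; exact min_le_left _ _
  have s2 : d ≤ |sin (π * (h - D.l τ) / (2 * D.l τ))| := by
    rw [show π * (h - D.l τ) / (2 * D.l τ) = φ - π / 2 by rw [hφ]; field_simp, sin_sub_pi_div_two,
      abs_neg, abs_of_pos hc0]
    exact min_le_right _ _
  have s3 : d ≤ |sin (π * (h + D.l τ) / (2 * D.l τ))| := by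
    rw [show π * (h + D.l τ) / (2 * D.l τ) = φ + π / 2 by rw [hφ]; field_simp, sin_add_pi_div_two,
      abs_of_pos hc0]
    exact min_le_right _ _
  refine ⟨2 * (1 / D.l τ * B), fun N => ⟨?_, fun i s hs => ?_⟩⟩
  · choose C hC using hD.exists_dominated_fourierKer hτ x
    exact (Dominated.sum (Finset.range N) fun n _ => hC (n + 1)).aesm
  obtain ⟨ξ, t, ht0, htτ, -, hξy, hξz, hcase⟩ := hpt i s hs
  have hσ : 0 < τ - t := sub_pos.2 htτ
  have u12 : d ≤ π / (2 * D.l τ) * A * (τ - t) + |sin (π * (x - ξ) / (2 * D.l τ))| ∧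
      d ≤ π / (2 * D.l τ) * A * (τ - t) + |sin (π * (x + ξ - 2 * D.y τ) / (2 * D.l τ))| := by
    by_cases hi : i = 2 ∨ i = 3
    · refine ⟨near hσ.le ?_ s1, near hσ.le ?_ s1⟩
      · rw [← abs_neg]; convert hξy hi using 2; rw [hh]; ring
      · convert hξy hi using 2; rw [hh]; ring
    · push Not at hi
      refine ⟨near hσ.le ?_ s2, near hσ.le ?_ s3⟩
      · rw [← abs_neg]; convert hξz hi.1 hi.2 using 2; rw [hh, hz]; ring
      · convert hξz hi.1 hi.2 using 2; rw [hh, hz]; ring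
  have b1 := hb (τ - t) _ hσ (by linarith) u12.1 N
  have b2 := hb (τ - t) _ hσ (by linarith) u12.2 N
  have hl1 : 0 < 1 / D.l τ := by positivity
  rw [Finset.sum_apply, Finset.sum_apply]
  rcases hcase with ⟨hc, hdom⟩ | ⟨hc, hdom⟩
  · simp only [fun n => fourierKer_apply_K (τ := τ) (x := x) (n := n) hc]
    rw [Finset.sum_sub_distrib, ← Finset.mul_sum, ← Finset.mul_sum, hdom, mul_one]
    refine (abs_sub _ _).trans ?_
    rw [abs_mul, abs_mul, abs_of_pos hl1]
    linarith [mul_le_mul_of_nonneg_left b1.1 hl1.le, mul_le_mul_of_nonneg_left b2.1 hl1.le]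
  · simp only [fun n => fourierKer_apply_L (τ := τ) (x := x) (n := n) hc]
    rw [Finset.sum_add_distrib, ← Finset.mul_sum, ← Finset.mul_sum, hdom]
    refine (abs_add_le _ _).trans ?_
    rw [abs_mul, abs_mul, abs_of_pos hl1]
    linarith [mul_le_mul_of_nonneg_left b1.2 hl1.le, mul_le_mul_of_nonneg_left b2.2 hl1.le]

/-! ### The two series coincide -/

/-- The five summed image kernels. -/
def greenKer (D : BarrierData) (τ x : ℝ) : Fin 5 → ℝ → ℝ :=
  fun i s => ∑' n : ℤ, D.imageKer τ x n i s

lemma Admissible.hasSum_imageTerm (hD : D.Admissible T) (hτ : τ ∈ Ioc 0 T) {x : ℝ}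
    (hx : x ∈ Ioo (D.y τ) (D.z τ)) :
    HasSum (fun n : ℤ => D.imageTerm τ x n) (D.Rep τ (D.greenKer τ x)) := by
  have hl : 0 < D.l τ := sub_pos.2 (hx.1.trans hx.2)
  obtain ⟨B, hB, hb⟩ := hD.exists_dominated_image_interior hτ hx
  exact hasSum_of_eq (hasSum_Rep hD hτ ((summable_image_bound hl).mul_left B)
    (fun n => by positivity) hb) fun n => imageTerm_eq_Rep hD hτ (hb n)

/-- The domination is of the partial sums, not of the single terms, so only convergence of the
ordered series is obtained. -/
lemma Admissible.tendsto_fourierTerm (hD : D.Admissible T) (hτ : τ ∈ Ioc 0 T) {x : ℝ}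
    (hx : x ∈ Ioo (D.y τ) (D.z τ)) :
    Tendsto (fun N : ℕ => ∑ n ∈ Finset.Icc 1 N, D.fourierTerm τ x n) atTop
      (𝓝 (D.Rep τ (D.greenKer τ x))) := by
  obtain ⟨C, hC⟩ := hD.exists_dominated_fourier hτ hx
  have h := tendsto_Rep (F := atTop) (κ' := D.greenKer τ x) hD hτ (Eventually.of_forall hC)
    (fun i s hs => by
      simpa only [Finset.sum_apply, greenKer] using
        (hD.hasSum_fourierKer hτ x i hs).tendsto_sum_nat)
  refine h.congr fun N => ?_
  choose C' hC' using hD.exists_dominated_fourierKer hτ x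
  rw [Rep_sum hD hτ (Finset.range N) fun n _ => hC' (n + 1), Finset.range_eq_Ico,
    Finset.sum_Ico_add' (fun n => D.Rep τ (D.fourierKer τ x n)) 0 N 1]
  refine Finset.sum_congr ?_ fun n _ => (hD.fourierTerm_eq_Rep hτ x n).symm
  ext n
  simp only [Finset.mem_Ico, Finset.mem_Icc]
  lia

end BarrierData

end

noncomputable section

/-! ### The jump of the double layer potential -/

/-- The substitution `σ = h² / (4 v²)` turns `2 * gaussQ σ h` together with the Jacobian into a
probability density on `v > 0` that no longer depends on `h`. -/
lemma two_mul_gaussQ_subst {h v : ℝ} (hh : 0 < h) (hv : 0 < v) :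
    |h ^ 2 / (2 * v ^ 3)| * (2 * gaussQ (h ^ 2 / (4 * v ^ 2)) h) = 2 / √π * exp (-v ^ 2) := by
  have hσ : 0 < h ^ 2 / (4 * v ^ 2) := by positivity
  have e1 : -h ^ 2 / (4 * (h ^ 2 / (4 * v ^ 2))) = -v ^ 2 := by field_simp
  have e2 : √(π * (h ^ 2 / (4 * v ^ 2)) ^ 3) = √π * (h ^ 3 / (8 * v ^ 3)) := by
    rw [Real.sqrt_mul pi_pos.le, show (h ^ 2 / (4 * v ^ 2)) ^ 3 = (h ^ 3 / (8 * v ^ 3)) ^ 2 by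
      field_simp; norm_num, Real.sqrt_sq (by positivity)]
  rw [gaussQ, e1, e2, abs_of_pos (by positivity)]
  have : 0 < √π := Real.sqrt_pos.2 pi_pos
  field_simp
  norm_num

lemma image_layer_subst {τ h : ℝ} (hτ : 0 < τ) (hh : 0 < h) :
    (fun v => τ - h ^ 2 / (4 * v ^ 2)) '' Ioi (h / (2 * √τ)) = Ioo 0 τ := by
  have hs : 0 < √τ := Real.sqrt_pos.2 hτ
  have hs2 : √τ ^ 2 = τ := Real.sq_sqrt hτ.le
  ext s
  simp only [mem_image, mem_Ioi, mem_Ioo]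
  constructor
  · rintro ⟨v, hv, rfl⟩
    have hv0 : 0 < v := lt_trans (by positivity) hv
    rw [div_lt_iff₀ (by positivity)] at hv
    have h2 : h ^ 2 < (v * (2 * √τ)) ^ 2 := by gcongr
    rw [mul_pow, mul_pow, hs2] at h2
    refine ⟨?_, by have : 0 < h ^ 2 / (4 * v ^ 2) := by positivity
                   linarith⟩
    rw [sub_pos, div_lt_iff₀ (by positivity)]
    linarith
  · rintro ⟨h0, h1⟩
    have hts : 0 < τ - s := sub_pos.2 h1
    have hr : 0 < √(τ - s) := Real.sqrt_pos.2 hts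
    refine ⟨h / (2 * √(τ - s)), ?_, ?_⟩
    · have : √(τ - s) < √τ := Real.sqrt_lt_sqrt hts.le (by linarith)
      gcongr
    · rw [div_pow, mul_pow, Real.sq_sqrt hts.le]
      field_simp
      ring

/-- After the substitution `h` remains only in the argument of `g` and in the cutoff; the indicator
keeps the domain fixed for dominated convergence. -/
lemma integral_layer_subst {τ h : ℝ} (hτ : 0 < τ) (hh : 0 < h) (g : ℝ → ℝ) :
    ∫ s in Ioo 0 τ, g s * (2 * gaussQ (τ - s) h)
      = ∫ v in Ioi 0, (Ioi (h / (2 * √τ))).indicator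
          (fun v => g (τ - h ^ 2 / (4 * v ^ 2)) * (2 / √π * exp (-v ^ 2))) v := by
  have hs : 0 < √τ := Real.sqrt_pos.2 hτ
  have ha : 0 < h / (2 * √τ) := by positivity
  have hd : ∀ v ∈ Ioi (h / (2 * √τ)), HasDerivWithinAt (fun v => τ - h ^ 2 / (4 * v ^ 2))
      (h ^ 2 / (2 * v ^ 3)) (Ioi (h / (2 * √τ))) v := by
    intro v hv
    have hv0 : 0 < v := ha.trans hv
    have h1 : HasDerivAt (fun v : ℝ => 4 * v ^ 2) (4 * (2 * v)) v := by
      simpa using (hasDerivAt_pow 2 v).const_mul 4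
    have h2 := ((hasDerivAt_const v (h ^ 2)).div h1 (by positivity)).const_sub τ
    refine (h2.congr_deriv ?_).hasDerivWithinAt
    field_simp
    ring
  have hinj : InjOn (fun v => τ - h ^ 2 / (4 * v ^ 2)) (Ioi (h / (2 * √τ))) := by
    intro v hv w hw hvw
    have hv0 : 0 < v := ha.trans hv
    have hw0 : 0 < w := ha.trans hw
    simp only at hvw
    have h1 : h ^ 2 / (4 * v ^ 2) = h ^ 2 / (4 * w ^ 2) := by linarith
    rw [div_eq_div_iff (by positivity) (by positivity)] at h1
    have h2 : v ^ 2 = w ^ 2 := by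
      have : h ^ 2 ≠ 0 := by positivity
      have := mul_left_cancel₀ this h1
      linarith
    exact (pow_left_inj₀ hv0.le hw0.le two_ne_zero).1 h2
  rw [← image_layer_subst hτ hh,
    integral_image_eq_integral_abs_deriv_smul measurableSet_Ioi hd hinj,
    setIntegral_indicator measurableSet_Ioi,
    inter_eq_right.2 (Ioi_subset_Ioi ha.le)]
  refine setIntegral_congr_fun measurableSet_Ioi fun v hv => ?_
  have hv0 : 0 < v := ha.trans hv
  simp only [smul_eq_mul, sub_sub_cancel]
  rw [← two_mul_gaussQ_subst hh hv0]
  ring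

lemma tendsto_layer {τ T : ℝ} (hτ : τ ∈ Ioc 0 T) {f : ℝ → ℝ} (hf : ContinuousOn f (Icc 0 T)) :
    Tendsto (fun h => ∫ s in Ioo 0 τ, f s * (2 * gaussQ (τ - s) h)) (𝓝[>] 0) (𝓝 (f τ)) := by
  have hT : 0 ≤ T := hτ.1.le.trans hτ.2
  obtain ⟨M, hM⟩ := isCompact_Icc.exists_bound_of_continuousOn hf
  -- The argument `τ - h² / (4 v²)` leaves `[0, T]` for small `v`; the constant extension keeps the
  -- integrand measurable and bounded for all `v`.
  set g : ℝ → ℝ := IccExtend hT ((Icc 0 T).domRestrict f) with hg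
  have hgc : Continuous g := (continuousOn_iff_continuous_domRestrict.1 hf).Icc_extend'
  have hgf : ∀ s ∈ Icc 0 T, g s = f s := fun s hs => by
    rw [hg, IccExtend_of_mem _ _ hs]; rfl
  have hgM : ∀ s, ‖g s‖ ≤ M := fun s => hM _ (projIcc 0 T hT s).2
  have hsub2 : Ioo 0 τ ⊆ Icc 0 T :=
    (Ioo_subset_Ioo_right hτ.2).trans Ioo_subset_Icc_self
  have e : ∀ᶠ h in 𝓝[>] (0:ℝ), (∫ v in Ioi 0, (Ioi (h / (2 * √τ))).indicator
          (fun v => g (τ - h ^ 2 / (4 * v ^ 2)) * (2 / √π * exp (-v ^ 2))) v)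
      = ∫ s in Ioo 0 τ, f s * (2 * gaussQ (τ - s) h) := by
    filter_upwards [self_mem_nhdsWithin] with h hh
    rw [← integral_layer_subst hτ.1 hh]
    exact setIntegral_congr_fun measurableSet_Ioo fun s hs => by
      simp only [hgf s (hsub2 hs)]
  refine Tendsto.congr' e ?_
  have hI : ∫ v in Ioi (0:ℝ), f τ * (2 / √π * exp (-v ^ 2)) = f τ := by
    have := integral_gaussian_Ioi 1
    simp only [neg_mul, one_mul, div_one] at this
    rw [integral_const_mul, integral_const_mul, this]
    have : 0 < √π := Real.sqrt_pos.2 pi_pos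
    field_simp
  have hint : Integrable (fun v : ℝ => 2 / √π * exp (-v ^ 2)) := by
    have := (integrable_exp_neg_mul_sq (b := 1) one_pos).const_mul (2 / √π)
    simpa using this
  rw [← hI]
  refine tendsto_integral_filter_of_dominated_convergence
    (fun v => M * (2 / √π * exp (-v ^ 2))) ?_ ?_ (hint.const_mul M).integrableOn ?_
  · refine Eventually.of_forall fun h => Measurable.aestronglyMeasurable ?_
    refine Measurable.indicator ?_ measurableSet_Ioi
    exact (hgc.measurable.comp (by fun_prop)).mul (by fun_prop)
  · refine Eventually.of_forall fun h => Eventually.of_forall fun v => ?_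
    refine (norm_indicator_le_norm_self _ _).trans ?_
    have h0 : 0 ≤ 2 / √π * exp (-v ^ 2) := by positivity
    rw [norm_mul, Real.norm_of_nonneg h0]
    exact mul_le_mul_of_nonneg_right (hgM _) h0
  · refine (ae_restrict_mem measurableSet_Ioi).mono fun v (hv : 0 < v) => ?_
    have h1 : Tendsto (fun h : ℝ => h / (2 * √τ)) (𝓝[>] 0) (𝓝 0) := by
      have : Continuous fun h : ℝ => h / (2 * √τ) := by fun_prop
      simpa using (this.tendsto 0).mono_left nhdsWithin_le_nhds
    have h2 : Tendsto (fun h : ℝ => g (τ - h ^ 2 / (4 * v ^ 2))) (𝓝[>] 0) (𝓝 (f τ)) := by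
      have : Continuous fun h : ℝ => g (τ - h ^ 2 / (4 * v ^ 2)) := by fun_prop
      have := (this.tendsto 0).mono_left (nhdsWithin_le_nhds (s := Ioi 0))
      simpa [hgf τ ⟨hτ.1.le, hτ.2⟩] using this
    refine (h2.mul_const (2 / √π * exp (-v ^ 2))).congr' ?_
    filter_upwards [h1.eventually (gt_mem_nhds hv)] with h hh
    rw [indicator_of_mem (show v ∈ Ioi (h / (2 * √τ)) from hh)]

namespace BarrierData

variable {D : BarrierData} {T τ : ℝ}

/-! ### The limit at the lower boundary -/

/-- The Fourier form shows the vanishing at `y τ`: each mode contains `sin (w (x - y τ))`, of size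
at most `w |x - y τ|`, and at fixed `s < τ` the Gaussian factor makes the resulting series converge.
-/
lemma Admissible.tendsto_greenKer (hD : D.Admissible T) (hτ : τ ∈ Ioc 0 T) (i : Fin 5) {s : ℝ}
    (hs : s ∈ Ioo (D.lo i) (D.hi τ i)) :
    Tendsto (fun x => D.greenKer τ x i s) (𝓝[>] (D.y τ)) (𝓝 0) := by
  have hl : 0 < D.l τ := sub_pos.2 (hD.y_lt_z τ ⟨hτ.1.le, hτ.2⟩)
  obtain ⟨A, M, hA, hpt⟩ := hD.exists_curve_point hτ
  obtain ⟨ξ, t, ht0, htτ, -, -, -, h⟩ := hpt i s hs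
  have hσ : 0 < τ - t := sub_pos.2 htτ
  set σ := τ - t with hσ'
  set c := 2 / D.l τ * (2 * D.l τ ^ 3 / σ ^ 2 + 2 * D.l τ ^ 2 / σ ^ 2) with hc
  set S := ∑' n : ℕ, 1 / ((n : ℝ) + 1) ^ 2 with hS
  have hterm : ∀ x, ∀ n : ℕ, ‖D.fourierKer τ x (n + 1) i s‖
      ≤ |x - D.y τ| * c * (1 / ((n : ℝ) + 1) ^ 2) := by
    intro x n
    obtain ⟨-, e2, e3⟩ := exp_waveNum_le hl hσ n
    set w := waveNum (D.l τ) (n + 1) with hw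
    have hw0 : 0 ≤ w := waveNum_nonneg hl _
    have hsin : |sin (w * (x - D.y τ))| ≤ w * |x - D.y τ| := by
      refine (abs_sin_sub_le (w * (x - D.y τ)) 0 |>.trans_eq' (by simp)).trans ?_
      rw [sub_zero, abs_mul, abs_of_nonneg hw0]
    have hr : 0 ≤ 1 / ((n : ℝ) + 1) ^ 2 := by positivity
    have p1 : 0 ≤ 2 * D.l τ ^ 3 / σ ^ 2 * (1 / ((n : ℝ) + 1) ^ 2) := by positivity
    have p2 : 0 ≤ 2 * D.l τ ^ 2 / σ ^ 2 * (1 / ((n : ℝ) + 1) ^ 2) := by positivity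
    have hl2 : 0 < 2 / D.l τ := by positivity
    rw [fourierKer, Pi.smul_apply, Pi.smul_apply, smul_eq_mul, freq_eq, ← hw, Real.norm_eq_abs,
      abs_mul, abs_mul, abs_of_pos hl2]
    have fin : ∀ q, |D.curve (D.sinK τ (n + 1)) (D.sinL τ (n + 1)) i s| ≤ q →
        w * q ≤ (2 * D.l τ ^ 3 / σ ^ 2 + 2 * D.l τ ^ 2 / σ ^ 2) * (1 / ((n : ℝ) + 1) ^ 2) →
        2 / D.l τ * |sin (w * (x - D.y τ))|
          * |D.curve (D.sinK τ (n + 1)) (D.sinL τ (n + 1)) i s|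
          ≤ |x - D.y τ| * c * (1 / ((n : ℝ) + 1) ^ 2) := by
      intro q hq hwq
      calc _ ≤ 2 / D.l τ * (w * |x - D.y τ|) * q := by gcongr
        _ = 2 / D.l τ * |x - D.y τ| * (w * q) := by ring
        _ ≤ 2 / D.l τ * |x - D.y τ|
            * ((2 * D.l τ ^ 3 / σ ^ 2 + 2 * D.l τ ^ 2 / σ ^ 2) * (1 / ((n : ℝ) + 1) ^ 2)) := by
          gcongr
        _ = _ := by rw [hc]; ring
    rcases h with ⟨h, -⟩ | ⟨h, -⟩
    · refine fin (exp (-w ^ 2 * σ)) ?_ (by rw [add_mul]; linarith)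
      rw [h, sinK, abs_mul, abs_of_pos (Real.exp_pos _), freq_eq]
      exact mul_le_of_le_one_right (Real.exp_pos _).le (abs_sin_le_one _)
    · refine fin (exp (-w ^ 2 * σ) * w) ?_ (by rw [add_mul]; nlinarith)
      rw [h, sinL, abs_mul, abs_of_pos (Real.exp_pos _), freq_eq, ← hw, abs_mul,
        abs_of_nonneg hw0]
      refine mul_le_mul_of_nonneg_left ?_ (Real.exp_pos _).le
      exact mul_le_of_le_one_right hw0 (abs_cos_le_one _)
  have hb : ∀ x, |D.greenKer τ x i s| ≤ |x - D.y τ| * c * S := by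
    intro x
    have h1 := (hD.hasSum_fourierKer hτ x i hs).tsum_eq
    rw [greenKer, ← h1, ← Real.norm_eq_abs]
    exact tsum_of_norm_bounded (summable_inv_succ_sq.hasSum.mul_left _) (hterm x)
  refine squeeze_zero_norm hb ?_
  have : Continuous fun x : ℝ => |x - D.y τ| * c * S := by fun_prop
  simpa using (this.tendsto (D.y τ)).mono_left (nhdsWithin_le_nhds (s := Ioi (D.y τ)))

/-- The singular part of the summed kernels at distance `h` from the lower boundary. -/
def edgeKer (τ h : ℝ) : Fin 5 → ℝ → ℝ := ![0, 0, 0, fun s => 2 * gaussQ (τ - s) h, 0]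

lemma tendsto_edgeKer (i : Fin 5) {s : ℝ} (hs : s ∈ Ioo (D.lo i) (D.hi τ i)) :
    Tendsto (fun x => edgeKer τ (x - D.y τ) i s) (𝓝[>] (D.y τ)) (𝓝 0) := by
  have h3 : ∀ s < τ, Tendsto (fun x => 2 * gaussQ (τ - s) (x - D.y τ)) (𝓝[>] (D.y τ)) (𝓝 0) := by
    intro s hs
    have hc : Continuous (gaussQ (τ - s)) := continuous_iff_continuousAt.2 fun u =>
      (hasDerivAt_gaussQ (sub_pos.2 hs) u).continuousAt
    have : Continuous fun x => 2 * gaussQ (τ - s) (x - D.y τ) := by fun_prop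
    have := (this.tendsto (D.y τ)).mono_left (nhdsWithin_le_nhds (s := Ioi (D.y τ)))
    simpa [gaussQ] using this
  fin_cases i
  · exact tendsto_const_nhds
  · exact tendsto_const_nhds
  · exact tendsto_const_nhds
  · exact h3 s hs.2
  · exact tendsto_const_nhds

lemma Admissible.dominated_greenKer (hD : D.Admissible T) (hτ : τ ∈ Ioc 0 T) {x : ℝ}
    (hx : x ∈ Ioo (D.y τ) (D.z τ)) : ∃ C, D.Dominated τ C (D.greenKer τ x) := by
  have hl : 0 < D.l τ := sub_pos.2 (hx.1.trans hx.2)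
  obtain ⟨B, hB, hb⟩ := hD.exists_dominated_image_interior hτ hx
  exact ⟨_, Dominated.tsum ((summable_image_bound hl).mul_left B) (fun n => by positivity) hb⟩

/-- On the lower curve `ξ - y τ = O(τ - t)`. The two Gaussians of the single layer then differ by a
bounded amount, and in the double layer both arguments may be replaced by `x - y τ` with error `O(1
/ √(τ - t))`. On the other curves the centres stay at distance at least `l / 2` from `z τ`. -/
lemma Admissible.exists_dominated_principal (hD : D.Admissible T) (hτ : τ ∈ Ioc 0 T) :
    ∃ C, 0 ≤ C ∧ ∀ x ∈ Ioo (D.y τ) (D.y τ + D.l τ / 2),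
      D.Dominated τ C (D.imageKer τ x 0 - edgeKer τ (x - D.y τ)) := by
  have hl : 0 < D.l τ := sub_pos.2 (hD.y_lt_z τ ⟨hτ.1.le, hτ.2⟩)
  have hz : D.z τ = D.y τ + D.l τ := by rw [l]; ring
  obtain ⟨A, M, hA, hpt⟩ := hD.exists_curve_point hτ
  obtain ⟨B, hB, hb⟩ := exists_gauss_bound (τ := τ) (half_pos hl) hA
  refine ⟨2 * A + 2 * B * (1 + √τ), by positivity, fun x hx => ⟨fun i => ?_, fun i s hs => ?_⟩⟩
  · rw [imageKer_eq]
    refine AEStronglyMeasurable.sub (AEStronglyMeasurable.sub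
      (hD.aestronglyMeasurable_curve hτ (measurable_ctrK _ _) (measurable_ctrL _ _) i)
      (hD.aestronglyMeasurable_curve hτ (measurable_ctrK _ _) (measurable_ctrL _ _) i)) ?_
    fin_cases i
    · exact aestronglyMeasurable_const
    · exact aestronglyMeasurable_const
    · exact aestronglyMeasurable_const
    · exact ((measurable_gaussQ.comp (measurable_const.sub measurable_id |>.prodMk
        measurable_const)).const_mul 2).aestronglyMeasurable
    · exact aestronglyMeasurable_const
  · obtain ⟨ξ, t, ht0, htτ, -, hξy, hξz, h⟩ := hpt i s hs
    have hσ : 0 < τ - t := sub_pos.2 htτ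
    have h1 := one_le_inv_sqrt_mul ht0 htτ
    have hsq := Real.sqrt_nonneg τ
    have hr : 0 ≤ 1 / √(τ - t) := by positivity
    have eK : (∀ K L, D.curve K L i s = K ξ t) → D.imageKer τ x 0 i s
        = gaussK (τ - t) (x - ξ) - gaussK (τ - t) (x + ξ - 2 * D.y τ) := fun h => by
      rw [imageKer, h, Upsilon_eq]; simp
    have eL : (∀ K L, D.curve K L i s = L ξ t) → D.imageKer τ x 0 i s
        = gaussQ (τ - t) (x - ξ) + gaussQ (τ - t) (x + ξ - 2 * D.y τ) := fun h => by
      rw [imageKer, h, Lam_eq]; simp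
    rw [Pi.sub_apply, Pi.sub_apply]
    by_cases hi : i = 2 ∨ i = 3
    · have hξ := hξy hi
      rcases hi with rfl | rfl
      · have h2 : (∀ K L, D.curve K L 2 s = K ξ t) ∧ dom τ 2 s = 1 := by
          refine ⟨?_, rfl⟩
          rcases h with ⟨h, -⟩ | ⟨h, -⟩
          · exact h
          -- Constant test kernels distinguish `K` from `L` and exclude the wrong alternative.
          · exact absurd ((h (fun _ _ => 0) (fun _ _ => 1)).symm.trans rfl) one_ne_zero
        rw [eK h2.1, h2.2, show edgeKer τ (x - D.y τ) 2 s = 0 from rfl, sub_zero, mul_one]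
        refine (abs_gaussK_sub_le hσ _ _).trans ?_
        rw [show x - ξ - (x + ξ - 2 * D.y τ) = -(2 * (ξ - D.y τ)) by ring, abs_neg, abs_mul,
          abs_of_pos (by norm_num : (0:ℝ) < 2), one_div_mul_eq_div, div_le_iff₀ hσ]
        nlinarith [mul_nonneg (mul_nonneg hB (by linarith : 0 ≤ 1 + √τ)) hσ.le]
      · have hlast : (∀ K L, D.curve K L 3 s = L ξ t) := by
          rcases h with ⟨h, -⟩ | ⟨h, -⟩
          · exact absurd ((h (fun _ _ => 1) (fun _ _ => 0)).symm.trans rfl) one_ne_zero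
          · exact h
        have hst : s = t := by
          -- Testing with the kernel that returns its time identifies `t` with `s`.
          have := hlast (fun _ _ => 0) (fun _ s => s)
          exact this
        subst hst
        rw [eL hlast, show edgeKer τ (x - D.y τ) 3 s = 2 * gaussQ (τ - s) (x - D.y τ) from rfl,
          show dom τ 3 s = 1 / √(τ - s) from rfl]
        have q1 := abs_gaussQ_sub_le hσ (x - ξ) (x - D.y τ)
        have q2 := abs_gaussQ_sub_le hσ (x + ξ - 2 * D.y τ) (x - D.y τ)
        rw [show x - ξ - (x - D.y τ) = -(ξ - D.y τ) by ring, abs_neg] at q1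
        rw [show x + ξ - 2 * D.y τ - (x - D.y τ) = ξ - D.y τ by ring] at q2
        have q3 : 1 / (τ - s) * (1 / √(τ - s)) * |ξ - D.y τ| ≤ A * (1 / √(τ - s)) := by
          calc _ ≤ 1 / (τ - s) * (1 / √(τ - s)) * (A * (τ - s)) := by gcongr
            _ = _ := by field_simp
        rw [show ∀ a b c : ℝ, a + b - 2 * c = (a - c) + (b - c) by intros; ring]
        refine (abs_add_le _ _).trans ?_
        nlinarith [mul_nonneg (mul_nonneg hB (by linarith : 0 ≤ 1 + √τ)) hr]
    · push Not at hi
      have hξ := hξz hi.1 hi.2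
      have e0 : edgeKer τ (x - D.y τ) i s = 0 := by
        obtain ⟨h2, h3⟩ := hi
        fin_cases i <;> first | rfl | exact absurd rfl h3
      have w1 : D.l τ / 2 ≤ A * (τ - t) + |x - ξ| := by
        have := abs_sub_le x ξ (D.z τ)
        have : D.l τ / 2 ≤ |x - D.z τ| := by
          rw [abs_sub_comm]; exact le_trans (by linarith [hx.2]) (le_abs_self _)
        linarith
      have w2 : D.l τ / 2 ≤ A * (τ - t) + |x + ξ - 2 * D.y τ| := by
        have h3 := le_abs_self (x + ξ - 2 * D.y τ)
        have h4 := neg_abs_le (ξ - D.z τ)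
        linarith [hx.1]
      obtain ⟨k1, q1⟩ := hb (τ - t) _ hσ (by linarith) w1
      obtain ⟨k2, q2⟩ := hb (τ - t) _ hσ (by linarith) w2
      have hB1 : ∀ w : ℝ, B / (1 + w ^ 2) ≤ B := fun w =>
        div_le_self hB (by nlinarith [sq_nonneg w])
      rw [e0, sub_zero]
      rcases h with ⟨h, hdom⟩ | ⟨h, hdom⟩
      · rw [eK h, hdom]
        refine (abs_sub _ _).trans ?_
        rw [abs_of_nonneg (gaussK_nonneg _ _), abs_of_nonneg (gaussK_nonneg _ _)]
        nlinarith [hB1 (x - ξ), hB1 (x + ξ - 2 * D.y τ), mul_nonneg hB hsq]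
      · rw [eL h, hdom]
        refine (abs_add_le _ _).trans ?_
        have := mul_le_mul_of_nonneg_left h1 hB
        nlinarith [hB1 (x - ξ), hB1 (x + ξ - 2 * D.y τ), mul_nonneg hA.le hr]

/-- For `n ≠ 0` the indices `2n` and `2n ± 1` are all nonzero, so with `0 < x - y τ < l / 2` those
images stay at distance at least `l / 2` from both endpoints, uniformly in `x`. Only `n = 0` needs
the edge kernel subtracted. -/
lemma Admissible.exists_dominated_regular (hD : D.Admissible T) (hτ : τ ∈ Ioc 0 T) :
    ∃ C, ∀ x ∈ Ioo (D.y τ) (D.y τ + D.l τ / 2),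
      D.Dominated τ C (D.greenKer τ x - edgeKer τ (x - D.y τ)) := by
  have hl : 0 < D.l τ := sub_pos.2 (hD.y_lt_z τ ⟨hτ.1.le, hτ.2⟩)
  have hz : D.z τ = D.y τ + D.l τ := by rw [l]; ring
  obtain ⟨C, hC, hc⟩ := hD.exists_dominated_principal hτ
  obtain ⟨B, hB, hb⟩ := hD.exists_dominated_image hτ (half_pos hl)
  set c : ℤ → ℝ := fun n => B * (1 / (1 + (2 * (n : ℝ) * D.l τ) ^ 2)) + if n = 0 then C else 0
    with hcdef
  have hcs : Summable c := ((summable_image_bound hl).mul_left B).add (hasSum_ite_eq 0 C).summable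
  have hc0 : ∀ n, 0 ≤ c n := fun n => add_nonneg (by positivity) (by split_ifs <;> simp [hC])
  refine ⟨∑' n, c n, fun x hx => ?_⟩
  have hx' : x ∈ Ioo (D.y τ) (D.z τ) := ⟨hx.1, by linarith [hx.2]⟩
  set κ : ℤ → Fin 5 → ℝ → ℝ := fun n =>
    D.imageKer τ x n - if n = 0 then edgeKer τ (x - D.y τ) else 0 with hκ
  have hdom : ∀ n, D.Dominated τ (c n) (κ n) := by
    intro n
    by_cases hn : n = 0
    · subst hn
      simp only [hκ, hcdef, if_true]
      exact (hc x hx).mono (le_add_of_nonneg_left (by positivity))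
    · simp only [hκ, hcdef, hn, if_false, sub_zero, add_zero]
      refine hb x (Ioo_subset_Icc_self hx') n fun m hm => ?_
      have hm0 : m ≤ -1 ∨ 1 ≤ m := by lia
      rcases hm0 with h | h
      · have : (m : ℝ) ≤ -1 := by exact_mod_cast h
        exact le_trans (by nlinarith [hx.2]) (neg_le_abs _)
      · have : (1 : ℝ) ≤ m := by exact_mod_cast h
        exact le_trans (by nlinarith [hx.1]) (le_abs_self _)
  have h := Dominated.tsum hcs hc0 hdom
  obtain ⟨B', hB', hb'⟩ := hD.exists_dominated_image_interior hτ hx'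
  have e : ∀ i, ∀ s ∈ Ioo (D.lo i) (D.hi τ i),
      ∑' n, κ n i s = (D.greenKer τ x - edgeKer τ (x - D.y τ)) i s := by
    intro i s hs
    have s1 := (Dominated.summable ((summable_image_bound hl).mul_left B') hb' i hs).hasSum
    have s2 := hasSum_ite_eq (0 : ℤ) (edgeKer τ (x - D.y τ) i s)
    refine (hasSum_of_eq (s1.sub s2) fun n => ?_).tsum_eq
    simp only [hκ, Pi.sub_apply]
    split_ifs <;> simp
  exact ⟨fun i => (h.aesm i).congr ((ae_restrict_mem measurableSet_Ioo).mono fun s hs => e i s hs),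
    fun i s hs => by rw [← e i s hs]; exact h.bound i s hs⟩

lemma Admissible.tendsto_Rep_lower (hD : D.Admissible T) (hτ : τ ∈ Ioc 0 T) :
    Tendsto (fun x => D.Rep τ (D.greenKer τ x)) (𝓝[>] (D.y τ)) (𝓝 (D.fm τ)) := by
  have hl : 0 < D.l τ := sub_pos.2 (hD.y_lt_z τ ⟨hτ.1.le, hτ.2⟩)
  have hz : D.z τ = D.y τ + D.l τ := by rw [l]; ring
  obtain ⟨C, hC⟩ := hD.exists_dominated_regular hτ
  have hev : ∀ᶠ x in 𝓝[>] (D.y τ), x ∈ Ioo (D.y τ) (D.y τ + D.l τ / 2) :=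
    Ioo_mem_nhdsGT (by linarith)
  have h1 := tendsto_Rep (F := 𝓝[>] (D.y τ)) (κ' := 0) hD hτ (hev.mono hC) (fun i s hs => by
    have := (hD.tendsto_greenKer hτ i hs).sub (tendsto_edgeKer i hs)
    simpa using this)
  have h2 : Tendsto (fun x => D.Rep τ (edgeKer τ (x - D.y τ))) (𝓝[>] (D.y τ)) (𝓝 (D.fm τ)) := by
    have e : ∀ h, D.Rep τ (edgeKer τ h) = ∫ s in Ioo 0 τ, D.fm s * (2 * gaussQ (τ - s) h) := by
      intro h
      simp [Rep, Fin.sum_univ_five, edgeKer, lo, hi, wgt]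
    simp only [e]
    refine (tendsto_layer hτ hD.fm_cont).comp (tendsto_nhdsWithin_iff.2 ⟨?_, ?_⟩)
    · have : Continuous fun x : ℝ => x - D.y τ := by fun_prop
      simpa using (this.tendsto (D.y τ)).mono_left (nhdsWithin_le_nhds (s := Ioi (D.y τ)))
    · filter_upwards [self_mem_nhdsWithin] with x hx using sub_pos.2 (mem_Ioi.1 hx)
  have h3 := h1.add h2
  have e0 : D.Rep τ 0 + D.fm τ = D.fm τ := by simp [Rep]
  rw [e0] at h3
  refine h3.congr' (hev.mono fun x hx => ?_)
  obtain ⟨C', hC'⟩ := hD.dominated_greenKer hτ ⟨hx.1, by linarith [hx.2]⟩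
  -- The edge kernel is a difference of dominated kernels. The constant may depend on `x`, since it
  -- only serves to split `Rep`.
  have hedge := hC'.sub (hC x hx)
  rw [sub_sub_cancel] at hedge
  rw [Rep_sub hD hτ hC' hedge]
  ring

/-! ### Reflection -/

/-- The data of the problem reflected by `x ↦ -x`. -/
def reflect (D : BarrierData) : BarrierData where
  y t := -D.z t
  z t := -D.y t
  dy t := -D.dz t
  dz t := -D.dy t
  fm := D.fp
  fp := D.fm
  U0 x := D.U0 (-x)
  Φ := D.Ψ
  Ψ := D.Φ

lemma Admissible.reflect (hD : D.Admissible T) : D.reflect.Admissible T where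
  y_lt_z t ht := neg_lt_neg (hD.y_lt_z t ht)
  y_cont := hD.z_cont.neg
  z_cont := hD.y_cont.neg
  y_deriv t ht := (hD.z_deriv t ht).neg
  z_deriv t ht := (hD.y_deriv t ht).neg
  dy_cont := hD.dz_cont.neg
  dz_cont := hD.dy_cont.neg
  dy_int := hD.dz_int.neg
  dz_int := hD.dy_int.neg
  fm_cont := hD.fp_cont
  fp_cont := hD.fm_cont
  U0_int := ((IntervalIntegrable.iff_comp_neg (by finiteness)).1 hD.U0_int).symm
  Φ_int := hD.Ψ_int
  Ψ_int := hD.Φ_int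

/-- Since `w * l = nπ`, reflection sends the phase to `nπ` minus itself. The outer sine and the
bracket each change by the factor `-(-1) ^ n`, and the factors cancel. -/
lemma fourierTerm_reflect (hl : D.l τ ≠ 0) (x : ℝ) (n : ℕ) :
    D.reflect.fourierTerm τ (-x) n = D.fourierTerm τ x n := by
  have el : D.reflect.l τ = D.l τ := by simp only [BarrierData.l, BarrierData.reflect]; ring
  have ef : D.reflect.freq τ n = D.freq τ n := by rw [freq, freq, el]
  set w := D.freq τ n with hw
  have ew : ∀ ξ, w * (-ξ - -D.z τ) = n * π - w * (ξ - D.y τ) := by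
    intro ξ
    have : w * D.l τ = n * π := by rw [hw, freq]; field_simp
    rw [← this, l]; ring
  have es : ∀ ξ, sin (w * (-ξ - -D.z τ)) = -((-1) ^ n * sin (w * (ξ - D.y τ))) := fun ξ => by
    rw [ew, sin_nat_mul_pi_sub]
  have ec : ∀ ξ, cos (w * (-ξ - -D.z τ)) = (-1) ^ n * cos (w * (ξ - D.y τ)) := fun ξ => by
    rw [ew, cos_nat_mul_pi_sub]
  have e1 : ∫ ξ in (D.reflect.y 0)..(D.reflect.z 0), D.reflect.U0 ξ *
      sin (w * (ξ - D.reflect.y τ))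
      = -((-1) ^ n * ∫ ξ in (D.y 0)..(D.z 0), D.U0 ξ * sin (w * (ξ - D.y τ))) := by
    have := intervalIntegral.integral_comp_neg (a := -D.z 0) (b := -D.y 0)
      (fun ξ => D.U0 ξ * sin (w * (-ξ - -D.z τ)))
    simp only [neg_neg] at this
    simp only [BarrierData.reflect]
    rw [this, ← intervalIntegral.integral_const_mul, ← intervalIntegral.integral_neg]
    congr 1
    ext ξ
    rw [es ξ]
    ring
  have e2 : ∀ s, D.reflect.fourierIntegrand τ n s = -((-1) ^ n * D.fourierIntegrand τ n s) := by
    intro s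
    simp only [fourierIntegrand, beta, ef, ← hw]
    simp only [BarrierData.reflect, es, ec]
    ring
  have e3 : ∫ s in (0)..τ, D.reflect.fourierIntegrand τ n s
      = -((-1) ^ n * ∫ s in (0)..τ, D.fourierIntegrand τ n s) := by
    rw [← intervalIntegral.integral_const_mul, ← intervalIntegral.integral_neg]
    simp only [e2]
  have e4 : ((-1 : ℝ) ^ n) * (-1) ^ n = 1 := by rw [← mul_pow]; simp
  rw [fourierTerm, fourierTerm, ef, ← hw, e1, e3, el,
    show sin (w * (-x - D.reflect.y τ)) = -((-1) ^ n * sin (w * (x - D.y τ))) from es x]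
  linear_combination (2 / D.l τ * sin (w * (x - D.y τ)) * (exp (-w ^ 2 * τ) *
    (∫ ξ in (D.y 0)..(D.z 0), D.U0 ξ * sin (w * (ξ - D.y τ)))
      + ∫ s in (0)..τ, D.fourierIntegrand τ n s)) * e4

/-- The Fourier terms are individually invariant, unlike the image terms: reflection moves the two
sources of the `n`-th image to the different indices `-n` and `-n - 1`. -/
lemma Admissible.Rep_reflect (hD : D.Admissible T) (hτ : τ ∈ Ioc 0 T) {x : ℝ}
    (hx : x ∈ Ioo (D.y τ) (D.z τ)) :
    D.reflect.Rep τ (D.reflect.greenKer τ (-x)) = D.Rep τ (D.greenKer τ x) := by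
  have hl : D.l τ ≠ 0 := (sub_pos.2 (hx.1.trans hx.2)).ne'
  have h1 := hD.reflect.tendsto_fourierTerm hτ (x := -x) ⟨neg_lt_neg hx.2, neg_lt_neg hx.1⟩
  simp only [fourierTerm_reflect hl] at h1
  exact tendsto_nhds_unique h1 (hD.tendsto_fourierTerm hτ hx)

lemma Admissible.tendsto_Rep_upper (hD : D.Admissible T) (hτ : τ ∈ Ioc 0 T) :
    Tendsto (fun x => D.Rep τ (D.greenKer τ x)) (𝓝[<] (D.z τ)) (𝓝 (D.fp τ)) := by
  have h1 : Tendsto (fun x => D.reflect.Rep τ (D.reflect.greenKer τ (-x))) (𝓝[<] (D.z τ))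
      (𝓝 (D.fp τ)) := by
    refine (hD.reflect.tendsto_Rep_lower hτ).comp (tendsto_nhdsWithin_iff.2 ⟨?_, ?_⟩)
    · exact (continuous_neg.tendsto (D.z τ)).mono_left nhdsWithin_le_nhds
    · filter_upwards [self_mem_nhdsWithin] with x hx using neg_lt_neg (mem_Iio.1 hx)
  refine h1.congr' ?_
  filter_upwards [Ioo_mem_nhdsLT (hD.y_lt_z τ ⟨hτ.1.le, hτ.2⟩)] with x hx
  exact hD.Rep_reflect hτ hx

end BarrierData

end

noncomputable section

/-! ### A divergence theorem on a strip -/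

lemma intervalIntegral_swap_of_continuousOn {e : ℝ → ℝ → ℝ} {a b c d : ℝ} (hab : a ≤ b)
    (hcd : c ≤ d) (he : ContinuousOn (Function.uncurry e) (Icc a b ×ˢ Icc c d)) :
    ∫ s in a..b, ∫ r in c..d, e s r = ∫ r in c..d, ∫ s in a..b, e s r := by
  simp only [intervalIntegral.integral_of_le hab, intervalIntegral.integral_of_le hcd,
    ← integral_Icc_eq_integral_Ioc]
  refine integral_integral_swap ?_
  rw [Measure.prod_restrict]
  exact he.integrableOn_compact (isCompact_Icc.prod isCompact_Icc)

/-- The common derivative `e` is controlled only for `0 < r < 1`, as `U_xx` is in the application.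
Fubini is therefore used on `[η, 1 - η]`, and only the integrals of `F` and the boundary values of
`E` are passed to the limit `η → 0`. -/
lemma integral_sub_integral_eq_of_hasDerivAt {F E e : ℝ → ℝ → ℝ} {a b : ℝ} (hab : a ≤ b)
    (hE : ContinuousOn (Function.uncurry E) (Icc a b ×ˢ Icc 0 1))
    (hF : ∀ s ∈ Icc a b, ContinuousOn (F s) (Icc 0 1))
    (he : ContinuousOn (Function.uncurry e) (Icc a b ×ˢ Ioo 0 1))
    (hFd : ∀ s ∈ Icc a b, ∀ r ∈ Ioo (0 : ℝ) 1, HasDerivAt (fun s => F s r) (e s r) s)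
    (hEd : ∀ s ∈ Icc a b, ∀ r ∈ Ioo (0 : ℝ) 1, HasDerivAt (E s) (e s r) r) :
    (∫ r in (0)..1, F b r) - (∫ r in (0)..1, F a r) = ∫ s in a..b, (E s 1 - E s 0) := by
  have hEs : ∀ s ∈ Icc a b, ContinuousOn (E s) (Icc 0 1) := fun s hs =>
    hE.comp (f := fun r => (s, r)) (by fun_prop) fun r hr => ⟨hs, hr⟩
  have hEr : ∀ r ∈ Icc (0 : ℝ) 1, ContinuousOn (fun s => E s r) (Icc a b) := fun r hr =>
    hE.comp (f := fun s => (s, r)) (by fun_prop) fun s hs => ⟨hs, hr⟩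
  have hes : ∀ s ∈ Icc a b, ContinuousOn (e s) (Ioo 0 1) := fun s hs =>
    he.comp (f := fun r => (s, r)) (by fun_prop) fun r hr => ⟨hs, hr⟩
  have her : ∀ r ∈ Ioo (0 : ℝ) 1, ContinuousOn (fun s => e s r) (Icc a b) := fun r hr =>
    he.comp (f := fun s => (s, r)) (by fun_prop) fun s hs => ⟨hs, hr⟩
  have hFi : ∀ s ∈ Icc a b, ∀ p ∈ Icc (0 : ℝ) 1, ∀ q ∈ Icc (0 : ℝ) 1,
      IntervalIntegrable (F s) volume p q := fun s hs p hp q hq =>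
    ((hF s hs).mono (uIcc_subset_Icc hp hq)).intervalIntegrable
  have hev : ∀ᶠ η in 𝓝[>] (0 : ℝ), η ∈ Ioo (0 : ℝ) (1 / 2) := Ioo_mem_nhdsGT (by norm_num)
  have main : ∀ η ∈ Ioo (0 : ℝ) (1 / 2),
      (∫ r in η..1 - η, F b r) - (∫ r in η..1 - η, F a r)
        = ∫ s in a..b, (E s (1 - η) - E s η) := by
    intro η hη
    have hsub : Icc η (1 - η) ⊆ Ioo 0 1 := fun r hr =>
      ⟨by linarith [hη.1, hr.1], by linarith [hη.1, hr.2]⟩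
    have hle : η ≤ 1 - η := by linarith [hη.2]
    have hη1 : η ∈ Icc (0 : ℝ) 1 := ⟨hη.1.le, by linarith [hη.2]⟩
    have hη2 : 1 - η ∈ Icc (0 : ℝ) 1 := ⟨by linarith [hη.2], by linarith [hη.1]⟩
    have ha : a ∈ Icc a b := ⟨le_rfl, hab⟩
    have hb : b ∈ Icc a b := ⟨hab, le_rfl⟩
    have h1 := intervalIntegral_swap_of_continuousOn hab hle (he.mono (prod_mono_right hsub))
    rw [← intervalIntegral.integral_sub (hFi b hb _ hη1 _ hη2) (hFi a ha _ hη1 _ hη2)]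
    have e1 : ∫ r in η..1 - η, (F b r - F a r) = ∫ r in η..1 - η, ∫ s in a..b, e s r := by
      refine intervalIntegral.integral_congr fun r hr => ?_
      rw [uIcc_of_le hle] at hr
      have hr' := hsub hr
      refine (intervalIntegral.integral_eq_sub_of_hasDerivAt (f := fun s => F s r)
        (f' := fun s => e s r) (fun s hs => ?_) ?_).symm
      · rw [uIcc_of_le hab] at hs
        exact hFd s hs r hr'
      · exact ContinuousOn.intervalIntegrable (by rw [uIcc_of_le hab]; exact her r hr')
    have e2 : ∫ s in a..b, (E s (1 - η) - E s η) = ∫ s in a..b, ∫ r in η..1 - η, e s r := by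
      refine intervalIntegral.integral_congr fun s hs => ?_
      rw [uIcc_of_le hab] at hs
      refine (intervalIntegral.integral_eq_sub_of_hasDerivAt (f := E s) (f' := e s)
        (fun r hr => ?_) ?_).symm
      · rw [uIcc_of_le hle] at hr
        exact hEd s hs r (hsub hr)
      · exact ContinuousOn.intervalIntegrable (by
          rw [uIcc_of_le hle]; exact (hes s hs).mono hsub)
    rw [e1, e2, h1]
  have t0 : Tendsto (fun η : ℝ => η) (𝓝[>] 0) (𝓝[Icc 0 1] 0) :=
    tendsto_nhdsWithin_iff.2 ⟨nhdsWithin_le_nhds,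
      hev.mono fun η hη => ⟨hη.1.le, by linarith [hη.2]⟩⟩
  have t1 : Tendsto (fun η : ℝ => 1 - η) (𝓝[>] 0) (𝓝[Icc 0 1] 1) := by
    refine tendsto_nhdsWithin_iff.2 ⟨?_, hev.mono fun η hη => ⟨by linarith [hη.2],
      by linarith [hη.1]⟩⟩
    have : Continuous fun η : ℝ => 1 - η := by fun_prop
    simpa using (this.tendsto 0).mono_left (nhdsWithin_le_nhds (s := Ioi 0))
  have z0 : (0 : ℝ) ∈ Icc (0 : ℝ) 1 := ⟨le_rfl, zero_le_one⟩
  have z1 : (1 : ℝ) ∈ Icc (0 : ℝ) 1 := ⟨zero_le_one, le_rfl⟩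
  have limF : ∀ s ∈ Icc a b,
      Tendsto (fun η => ∫ r in η..1 - η, F s r) (𝓝[>] 0) (𝓝 (∫ r in (0)..1, F s r)) := by
    intro s hs
    have hc := intervalIntegral.continuousOn_primitive_interval'
      (hFi s hs 0 z0 1 z1) left_mem_uIcc
    rw [uIcc_of_le zero_le_one] at hc
    have l1 := (hc 1 z1).tendsto.comp t1
    have l0 := (hc 0 z0).tendsto.comp t0
    have := l1.sub l0
    simp only [intervalIntegral.integral_same, sub_zero] at this
    refine this.congr' (hev.mono fun η hη => ?_)
    have hη1 : η ∈ Icc (0 : ℝ) 1 := ⟨hη.1.le, by linarith [hη.2]⟩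
    have hη2 : 1 - η ∈ Icc (0 : ℝ) 1 := ⟨by linarith [hη.2], by linarith [hη.1]⟩
    exact intervalIntegral.integral_interval_sub_left (hFi s hs 0 z0 _ hη2) (hFi s hs 0 z0 _ hη1)
  obtain ⟨M, hM⟩ := (isCompact_Icc.prod isCompact_Icc).exists_bound_of_continuousOn hE
  have limE : Tendsto (fun η => ∫ s in a..b, (E s (1 - η) - E s η)) (𝓝[>] 0)
      (𝓝 (∫ s in a..b, (E s 1 - E s 0))) := by
    refine intervalIntegral.tendsto_integral_filter_of_dominated_convergence (fun _ => M + M)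
      ?_ ?_ intervalIntegrable_const ?_
    · filter_upwards [hev] with η hη
      have hη1 : η ∈ Icc (0 : ℝ) 1 := ⟨hη.1.le, by linarith [hη.2]⟩
      have hη2 : 1 - η ∈ Icc (0 : ℝ) 1 := ⟨by linarith [hη.2], by linarith [hη.1]⟩
      rw [uIoc_of_le hab]
      exact (((hEr _ hη2).sub (hEr _ hη1)).mono Ioc_subset_Icc_self).aestronglyMeasurable
        measurableSet_Ioc
    · filter_upwards [hev] with η hη
      have hη1 : η ∈ Icc (0 : ℝ) 1 := ⟨hη.1.le, by linarith [hη.2]⟩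
      have hη2 : 1 - η ∈ Icc (0 : ℝ) 1 := ⟨by linarith [hη.2], by linarith [hη.1]⟩
      refine Eventually.of_forall fun s hs => ?_
      rw [uIoc_of_le hab] at hs
      have hs' := Ioc_subset_Icc_self hs
      exact (norm_sub_le _ _).trans (add_le_add (hM (s, 1 - η) ⟨hs', hη2⟩) (hM (s, η) ⟨hs', hη1⟩))
    · refine Eventually.of_forall fun s hs => ?_
      rw [uIoc_of_le hab] at hs
      have hs' := Ioc_subset_Icc_self hs
      exact (((hEs s hs') 1 z1).tendsto.comp t1).sub (((hEs s hs') 0 z0).tendsto.comp t0)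
  refine tendsto_nhds_unique ((limF b ⟨hab, le_rfl⟩).sub (limF a ⟨le_rfl, hab⟩)) ?_
  exact limE.congr' (hev.mono fun η hη => (main η hη).symm)

lemma hasDerivAt_comp_of_partial {f f₁ f₂ : ℝ → ℝ → ℝ} {g h : ℝ → ℝ} {g' h' s : ℝ}
    (df₁ : ∀ᶠ p : ℝ × ℝ in 𝓝 (g s, h s), HasDerivAt (fun t => f t p.2) (f₁ p.1 p.2) p.1)
    (df₂ : ∀ᶠ p : ℝ × ℝ in 𝓝 (g s, h s), HasDerivAt (fun x => f p.1 x) (f₂ p.1 p.2) p.2)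
    (cf₁ : ContinuousAt (fun p : ℝ × ℝ => f₁ p.1 p.2) (g s, h s))
    (cf₂ : ContinuousAt (fun p : ℝ × ℝ => f₂ p.1 p.2) (g s, h s))
    (hg : HasDerivAt g g' s) (hh : HasDerivAt h h' s) :
    HasDerivAt (fun s => f (g s) (h s)) (f₁ (g s) (h s) * g' + f₂ (g s) (h s) * h') s := by
  have key := hasStrictFDerivAt_uncurry_coprod (𝕜 := ℝ) (u := (g s, h s)) (f := f)
    (f₁ := fun t x => ContinuousLinearMap.toSpanSingleton ℝ (f₁ t x))
    (f₂ := fun t x => ContinuousLinearMap.toSpanSingleton ℝ (f₂ t x))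
    (df₁.mono fun p hp => hp.hasFDerivAt) (df₂.mono fun p hp => hp.hasFDerivAt)
    (((ContinuousLinearMap.toSpanSingletonCLE (𝕜 := ℝ) (E := ℝ)).continuous.continuousAt).comp cf₁)
    (((ContinuousLinearMap.toSpanSingletonCLE (𝕜 := ℝ) (E := ℝ)).continuous.continuousAt).comp cf₂)
  have := key.hasFDerivAt.comp_hasDerivAt s (hg.prodMk hh)
  refine this.congr_deriv ?_
  simp [Function.HasUncurry.uncurry, mul_comm]

end

noncomputable section

namespace BarrierData

variable {D : BarrierData} {T τ : ℝ}

/-! ### Green's identity for a solution and a Gaussian source -/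

/-- `Ux`, `Uxx` are the derivatives of the solution `U`. -/
structure HasHeatDerivs (D : BarrierData) (T : ℝ) (U Ux Uxx : ℝ → ℝ → ℝ) : Prop where
  space : ∀ t ∈ Ioo 0 T, ∀ x ∈ Icc (D.y t) (D.z t),
    HasDerivWithinAt (fun x' => U t x') (Ux t x) (Icc (D.y t) (D.z t)) x
  heat : ∀ t ∈ Ioo 0 T, ∀ x ∈ Ioo (D.y t) (D.z t),
    HasDerivAt (fun x' => Ux t x') (Uxx t x) x ∧ HasDerivAt (fun t' => U t' x) (Uxx t x) t
  contx : ContinuousOn (fun p : ℝ × ℝ => Ux p.1 p.2)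
    {p | p.1 ∈ Ioo 0 T ∧ p.2 ∈ Icc (D.y p.1) (D.z p.1)}
  contxx : ContinuousOn (fun p : ℝ × ℝ => Uxx p.1 p.2)
    {p | p.1 ∈ Ioo 0 T ∧ p.2 ∈ Ioo (D.y p.1) (D.z p.1)}
  bdry : ∀ t ∈ Ioo 0 T, Ux t (D.y t) = -D.Ψ t ∧ Ux t (D.z t) = D.Φ t

lemma IsSolution.exists_heatDerivs {U : ℝ → ℝ → ℝ} (hU : D.IsSolution T U) :
    ∃ Ux Uxx, D.HasHeatDerivs T U Ux Uxx := by
  obtain ⟨Ux, Uxx, h1, h2, h3, h4, h5⟩ := hU.heat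
  exact ⟨Ux, Uxx, h1, h2, h3, h4, h5⟩

lemma Admissible.isOpen_region (hD : D.Admissible T) :
    IsOpen {p : ℝ × ℝ | p.1 ∈ Ioo 0 T ∧ p.2 ∈ Ioo (D.y p.1) (D.z p.1)} := by
  have hS : IsOpen {p : ℝ × ℝ | p.1 ∈ Ioo 0 T} := isOpen_Ioo.preimage continuous_fst
  have hm : MapsTo (fun p : ℝ × ℝ => p.1) {p : ℝ × ℝ | p.1 ∈ Ioo 0 T} (Icc 0 T) :=
    fun p hp => Ioo_subset_Icc_self hp
  have h1 : ContinuousOn (fun p : ℝ × ℝ => p.2 - D.y p.1) {p : ℝ × ℝ | p.1 ∈ Ioo 0 T} :=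
    continuousOn_snd.sub (hD.y_cont.comp continuousOn_fst hm)
  have h2 : ContinuousOn (fun p : ℝ × ℝ => D.z p.1 - p.2) {p : ℝ × ℝ | p.1 ∈ Ioo 0 T} :=
    (hD.z_cont.comp continuousOn_fst hm).sub continuousOn_snd
  have := (h1.isOpen_inter_preimage hS isOpen_Ioi (t := Ioi 0)).inter
    (h2.isOpen_inter_preimage hS isOpen_Ioi (t := Ioi 0))
  convert this using 1
  ext p
  simp only [mem_ofPred_eq, mem_inter_iff, mem_preimage, mem_Ioi, mem_Ioo, sub_pos]
  tauto

lemma Admissible.hasDerivAt_y (hD : D.Admissible T) {s : ℝ} (hs : s ∈ Ioo 0 T) :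
    HasDerivAt D.y (D.dy s) s :=
  (hD.y_deriv s (Ioo_subset_Ioc_self hs)).hasDerivAt (Icc_mem_nhds hs.1 hs.2)

lemma Admissible.hasDerivAt_z (hD : D.Admissible T) {s : ℝ} (hs : s ∈ Ioo 0 T) :
    HasDerivAt D.z (D.dz s) s :=
  (hD.z_deriv s (Ioo_subset_Ioc_self hs)).hasDerivAt (Icc_mem_nhds hs.1 hs.2)

/-- The point dividing the interval `[y s, z s]` in the ratio `r`. -/
def pos (D : BarrierData) (s r : ℝ) : ℝ := D.y s + r * D.l s

lemma pos_mem_Icc {s r : ℝ} (h : D.y s < D.z s) (hr : r ∈ Icc (0 : ℝ) 1) :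
    D.pos s r ∈ Icc (D.y s) (D.z s) := by
  have hl : 0 < D.l s := sub_pos.2 h
  have hz : D.z s = D.y s + D.l s := by rw [l]; ring
  rw [hz, pos]
  constructor <;> nlinarith [hr.1, hr.2]

lemma pos_mem_Ioo {s r : ℝ} (h : D.y s < D.z s) (hr : r ∈ Ioo (0 : ℝ) 1) :
    D.pos s r ∈ Ioo (D.y s) (D.z s) := by
  have hl : 0 < D.l s := sub_pos.2 h
  have hz : D.z s = D.y s + D.l s := by rw [l]; ring
  rw [hz, pos]
  constructor <;> nlinarith [hr.1, hr.2]

lemma pos_zero (s : ℝ) : D.pos s 0 = D.y s := by simp [pos]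

lemma pos_one (s : ℝ) : D.pos s 1 = D.z s := by simp [pos, l]

lemma Admissible.hasDerivAt_l (hD : D.Admissible T) {s : ℝ} (hs : s ∈ Ioo 0 T) :
    HasDerivAt D.l (D.dz s - D.dy s) s := (hD.hasDerivAt_z hs).sub (hD.hasDerivAt_y hs)

lemma Admissible.hasDerivAt_pos (hD : D.Admissible T) {s : ℝ} (hs : s ∈ Ioo 0 T) (r : ℝ) :
    HasDerivAt (fun s => D.pos s r) (D.dy s + r * (D.dz s - D.dy s)) s :=
  (hD.hasDerivAt_y hs).add ((hD.hasDerivAt_l hs).const_mul r)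

lemma hasDerivAt_pos_right (s r : ℝ) : HasDerivAt (D.pos s) (D.l s) r := by
  exact (((hasDerivAt_id r).mul_const (D.l s)).const_add (D.y s)).congr_deriv (one_mul _)

lemma hasDerivAt_gaussK_curve {τ c s p' : ℝ} {p : ℝ → ℝ} (hs : s < τ) (hp : HasDerivAt p p' s) :
    HasDerivAt (fun s => gaussK (τ - s) (c - p s))
      (gaussR (τ - s) (c - p s) + gaussQ (τ - s) (c - p s) * p') s := by
  have hopen : IsOpen {q : ℝ × ℝ | 0 < q.1} := isOpen_Ioi.preimage continuous_fst
  have hmem : (τ - s, c - p s) ∈ {q : ℝ × ℝ | 0 < q.1} := sub_pos.2 hs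
  have hev := hopen.mem_nhds hmem
  have := hasDerivAt_comp_of_partial (f := gaussK) (f₁ := fun σ u => -gaussR σ u)
    (f₂ := fun σ u => -gaussQ σ u) (g := fun s => τ - s) (h := fun s => c - p s) (s := s)
    (Filter.mem_of_superset hev fun q hq => hasDerivAt_gaussK_time hq q.2)
    (Filter.mem_of_superset hev fun q hq => hasDerivAt_gaussK hq q.2)
    ((continuousOn_gaussR.continuousAt hev).neg) ((continuousOn_gaussQ.continuousAt hev).neg)
    ((hasDerivAt_id s).const_sub τ) (hp.const_sub c)
  refine this.congr_deriv ?_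
  ring

lemma HasHeatDerivs.hasDerivAt_curve {U Ux Uxx : ℝ → ℝ → ℝ} (h : D.HasHeatDerivs T U Ux Uxx)
    (hD : D.Admissible T) {s p' : ℝ} {p : ℝ → ℝ} (hs : s ∈ Ioo 0 T)
    (hps : p s ∈ Ioo (D.y s) (D.z s)) (hp : HasDerivAt p p' s) :
    HasDerivAt (fun s => U s (p s)) (Uxx s (p s) + Ux s (p s) * p') s := by
  have hev := hD.isOpen_region.mem_nhds (show (s, p s) ∈ _ from ⟨hs, hps⟩)
  have := hasDerivAt_comp_of_partial (f := U) (f₁ := Uxx) (f₂ := Ux) (g := fun s => s) (h := p)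
    (s := s) (Filter.mem_of_superset hev fun q hq => (h.heat q.1 hq.1 q.2 hq.2).2)
    (Filter.mem_of_superset hev fun q hq =>
      (h.space q.1 hq.1 q.2 (Ioo_subset_Icc_self hq.2)).hasDerivAt (Icc_mem_nhds hq.2.1 hq.2.2))
    (h.contxx.continuousAt hev)
    ((h.contx.mono fun q hq => ⟨hq.1, Ioo_subset_Icc_self hq.2⟩).continuousAt hev)
    (hasDerivAt_id s) hp
  refine this.congr_deriv ?_
  ring

lemma Admissible.continuousOn_pos (hD : D.Admissible T) {a b : ℝ} (ha : 0 < a) (hb : b < T) :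
    ContinuousOn (fun q : ℝ × ℝ => D.pos q.1 q.2) (Icc a b ×ˢ Icc 0 1) := by
  have hm : MapsTo (fun p : ℝ × ℝ => p.1) (Icc a b ×ˢ Icc (0 : ℝ) 1) (Icc 0 T) :=
    fun p hp => ⟨ha.le.trans hp.1.1, hp.1.2.trans hb.le⟩
  have hy := hD.y_cont.comp continuousOn_fst hm
  have hz := hD.z_cont.comp continuousOn_fst hm
  exact hy.add (continuousOn_snd.mul (hz.sub hy))

/-- The integral of the solution against a Gaussian source. -/
def mass (D : BarrierData) (τ c : ℝ) (U : ℝ → ℝ → ℝ) (s : ℝ) : ℝ :=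
  ∫ ξ in (D.y s)..(D.z s), U s ξ * ctrK τ c ξ s

lemma mass_eq (c : ℝ) (U : ℝ → ℝ → ℝ) (s : ℝ) : D.mass τ c U s
    = ∫ r in (0)..1, U s (D.pos s r) * gaussK (τ - s) (c - D.pos s r) * D.l s := by
  have := intervalIntegral.mul_integral_comp_mul_add (a := 0) (b := 1)
    (f := fun ξ => U s ξ * ctrK τ c ξ s) (D.l s) (D.y s)
  rw [mass, intervalIntegral.integral_mul_const, mul_comm _ (D.l s)]
  have e : D.l s * 1 + D.y s = D.z s := by rw [l]; ring
  rw [mul_zero, zero_add, e] at this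
  rw [← this]
  congr 2
  ext r
  rw [pos, ctrK, mul_comm r, add_comm (D.y s)]

/-- As the source solves the backward heat equation, `∂ₛ(U K) = ∂_ξ(U_x K - U ∂_ξ K)`. On the moving
interval the flux gains `U K` times the velocity of the boundary, and this together with the
boundary gradients produces the densities `Φ + f⁺ z'` and `Ψ - f⁻ y'`. -/
lemma IsSolution.green {U : ℝ → ℝ → ℝ} (hU : D.IsSolution T U) (hD : D.Admissible T)
    (hτ : τ ∈ Ioc 0 T) (c : ℝ) {a b : ℝ} (ha : 0 < a) (hab : a ≤ b) (hb : b < τ) :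
    D.mass τ c U b - D.mass τ c U a
      = ∫ s in a..b, (D.wgt 1 s * ctrK τ c (D.z s) s + D.wgt 2 s * ctrK τ c (D.y s) s
          + D.wgt 3 s * ctrL τ c (D.y s) s + D.wgt 4 s * ctrL τ c (D.z s) s) := by
  obtain ⟨Ux, Uxx, h⟩ := hU.exists_heatDerivs
  have hbT : b < T := hb.trans_le hτ.2
  have hsT : ∀ {s}, s ∈ Icc a b → s ∈ Ioo 0 T := fun hs =>
    ⟨ha.trans_le hs.1, hs.2.trans_lt hbT⟩
  have hlt : ∀ {s}, s ∈ Icc a b → D.y s < D.z s := fun hs =>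
    hD.y_lt_z _ (Ioo_subset_Icc_self (hsT hs))
  have hpos := hD.continuousOn_pos ha hbT
  have hsub : Icc a b ×ˢ Ioo (0 : ℝ) 1 ⊆ Icc a b ×ˢ Icc 0 1 := prod_mono_right Ioo_subset_Icc_self
  have hpt : ContinuousOn (fun q : ℝ × ℝ => (q.1, D.pos q.1 q.2)) (Icc a b ×ˢ Icc 0 1) :=
    continuousOn_fst.prodMk hpos
  have hptG : ContinuousOn (fun q : ℝ × ℝ => (τ - q.1, c - D.pos q.1 q.2))
      (Icc a b ×ˢ Icc 0 1) := (continuousOn_const.sub continuousOn_fst).prodMk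
    (continuousOn_const.sub hpos)
  have hmG : MapsTo (fun q : ℝ × ℝ => (τ - q.1, c - D.pos q.1 q.2)) (Icc a b ×ˢ Icc 0 1)
      {p | 0 < p.1} := fun q hq => sub_pos.2 (hq.1.2.trans_lt hb)
  have cU : ContinuousOn (fun q : ℝ × ℝ => U q.1 (D.pos q.1 q.2)) (Icc a b ×ˢ Icc 0 1) :=
    hU.cont.comp hpt fun q hq =>
      ⟨Ioo_subset_Ioc_self (hsT hq.1), pos_mem_Icc (hlt hq.1) hq.2⟩
  have cUx : ContinuousOn (fun q : ℝ × ℝ => Ux q.1 (D.pos q.1 q.2)) (Icc a b ×ˢ Icc 0 1) :=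
    h.contx.comp hpt fun q hq => ⟨hsT hq.1, pos_mem_Icc (hlt hq.1) hq.2⟩
  have cUxx : ContinuousOn (fun q : ℝ × ℝ => Uxx q.1 (D.pos q.1 q.2)) (Icc a b ×ˢ Ioo 0 1) :=
    h.contxx.comp (hpt.mono hsub) fun q hq => ⟨hsT hq.1, pos_mem_Ioo (hlt hq.1) hq.2⟩
  have cK := continuousOn_gaussK.comp hptG hmG
  have cQ := continuousOn_gaussQ.comp hptG hmG
  have cR := continuousOn_gaussR.comp hptG hmG
  have hmT : MapsTo (fun p : ℝ × ℝ => p.1) (Icc a b ×ˢ Icc (0 : ℝ) 1) (Ioc 0 T) :=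
    fun p hp => Ioo_subset_Ioc_self (hsT hp.1)
  have cdy := hD.dy_cont.comp continuousOn_fst hmT
  have cdz := hD.dz_cont.comp continuousOn_fst hmT
  have cy := hD.y_cont.comp continuousOn_fst fun p hp => Ioc_subset_Icc_self (hmT hp)
  have cz := hD.z_cont.comp continuousOn_fst fun p hp => Ioc_subset_Icc_self (hmT hp)
  have cl : ContinuousOn (fun p : ℝ × ℝ => D.l p.1) (Icc a b ×ˢ Icc (0 : ℝ) 1) := cz.sub cy
  have cl' := cdz.sub cdy
  have cg := cdy.add (continuousOn_snd.mul cl')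
  -- In the coordinate `r ∈ [0, 1]` the strip is a rectangle: `F` is the density with its Jacobian,
  -- `E` the flux, and `e` both `∂F/∂s` and `∂E/∂r`.
  set F : ℝ → ℝ → ℝ := fun s r =>
    U s (D.pos s r) * gaussK (τ - s) (c - D.pos s r) * D.l s with hF
  set E : ℝ → ℝ → ℝ := fun s r =>
    Ux s (D.pos s r) * gaussK (τ - s) (c - D.pos s r)
      - U s (D.pos s r) * gaussQ (τ - s) (c - D.pos s r)
      + U s (D.pos s r) * gaussK (τ - s) (c - D.pos s r)
        * (D.dy s + r * (D.dz s - D.dy s)) with hE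
  set e : ℝ → ℝ → ℝ := fun s r =>
    (Uxx s (D.pos s r) * gaussK (τ - s) (c - D.pos s r)
        + U s (D.pos s r) * gaussR (τ - s) (c - D.pos s r)) * D.l s
      + (Ux s (D.pos s r) * gaussK (τ - s) (c - D.pos s r)
        + U s (D.pos s r) * gaussQ (τ - s) (c - D.pos s r))
        * (D.l s * (D.dy s + r * (D.dz s - D.dy s)))
      + U s (D.pos s r) * gaussK (τ - s) (c - D.pos s r) * (D.dz s - D.dy s) with he
  have key := integral_sub_integral_eq_of_hasDerivAt (F := F) (E := E) (e := e) hab ?_ ?_ ?_ ?_ ?_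
  · rw [mass_eq, mass_eq, key]
    refine intervalIntegral.integral_congr fun s hs => ?_
    rw [uIcc_of_le hab] at hs
    have hs' := Ioo_subset_Ioc_self (hsT hs)
    simp only [hE, pos_zero, pos_one, wgt, Matrix.cons_val, ctrK, ctrL,
      (h.bdry s (hsT hs)).1, (h.bdry s (hsT hs)).2, hU.lower s hs', hU.upper s hs']
    ring
  · exact ((cUx.mul cK).sub (cU.mul cQ)).add ((cU.mul cK).mul cg)
  · intro s hs
    exact ((cU.mul cK).mul cl).comp (f := fun r => (s, r)) (by fun_prop) fun r hr => ⟨hs, hr⟩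
  · have m {f : ℝ × ℝ → ℝ} (hf : ContinuousOn f (Icc a b ×ˢ Icc 0 1)) := hf.mono hsub
    exact ((((cUxx.mul (m cK)).add (m (cU.mul cR))).mul (m cl)).add
      (m (((cUx.mul cK).add (cU.mul cQ)).mul (cl.mul cg)))).add (m ((cU.mul cK).mul cl'))
  · intro s hs r hr
    have hp := hD.hasDerivAt_pos (hsT hs) r
    have d1 := h.hasDerivAt_curve (p := fun s => D.pos s r) hD (hsT hs) (pos_mem_Ioo (hlt hs) hr) hp
    have d2 := hasDerivAt_gaussK_curve (p := fun s => D.pos s r) (c := c) (hs.2.trans_lt hb) hp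
    refine ((d1.mul d2).mul (hD.hasDerivAt_l (hsT hs))).congr_deriv ?_
    simp only [he, Pi.mul_apply]
    ring
  · intro s hs r hr
    have hpm := pos_mem_Ioo (hlt hs) hr
    have hσ : 0 < τ - s := sub_pos.2 (hs.2.trans_lt hb)
    have hp := hasDerivAt_pos_right (D := D) s r
    have dU := ((h.space s (hsT hs) _ (Ioo_subset_Icc_self hpm)).hasDerivAt
      (Icc_mem_nhds hpm.1 hpm.2)).comp r hp
    have dUx := (h.heat s (hsT hs) _ hpm).1.comp r hp
    have dK := (hasDerivAt_gaussK hσ (c - D.pos s r)).comp r (hp.const_sub c)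
    have dQ := (hasDerivAt_gaussQ hσ (c - D.pos s r)).comp r (hp.const_sub c)
    have dg : HasDerivAt (fun r => D.dy s + r * (D.dz s - D.dy s)) (D.dz s - D.dy s) r := by
      simpa using ((hasDerivAt_id r).mul_const (D.dz s - D.dy s)).const_add (D.dy s)
    refine (((dUx.mul dK).sub (dU.mul dQ)).add ((dU.mul dK).mul dg)).congr_deriv ?_
    simp only [he, Pi.mul_apply, Function.comp_apply]
    ring

end BarrierData

end

noncomputable section

namespace BarrierData

variable {D : BarrierData} {T τ : ℝ}

/-! ### Initial and final limits of the mass -/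

/-- The solution at time `s`, extended by zero. -/
def slice (D : BarrierData) (U : ℝ → ℝ → ℝ) (s : ℝ) : ℝ → ℝ :=
  (Ioo (D.y s) (D.z s)).indicator (U s)

lemma mass_eq_integral_slice {c : ℝ} {U : ℝ → ℝ → ℝ} {s : ℝ} (h : D.y s < D.z s) :
    D.mass τ c U s = ∫ ξ, D.slice U s ξ * gaussK (τ - s) (c - ξ) := by
  rw [mass, intervalIntegral.integral_of_le h.le, integral_Ioc_eq_integral_Ioo,
    ← integral_indicator measurableSet_Ioo]
  refine integral_congr_ae (Eventually.of_forall fun ξ => ?_)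
  simp only [slice, ctrK, indicator]
  split_ifs <;> simp

lemma IsSolution.measurable_slice {U : ℝ → ℝ → ℝ} (hU : D.IsSolution T U) {s : ℝ}
    (hs : s ∈ Ioc 0 T) : Measurable (D.slice U s) := by
  classical
  have hc : ContinuousOn (U s) (Ioo (D.y s) (D.z s)) :=
    hU.cont.comp (f := fun x => (s, x)) (by fun_prop) fun x hx => ⟨hs, Ioo_subset_Icc_self hx⟩
  have := hc.measurable_piecewise (g := fun _ => (0 : ℝ)) continuousOn_const measurableSet_Ioo
  convert this using 1
  exact (piecewise_eq_indicator).symm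

lemma abs_slice_le {U : ℝ → ℝ → ℝ} {C : ℝ}
    (hC : ∀ t ∈ Ioc 0 T, ∀ x ∈ Icc (D.y t) (D.z t), |U t x| ≤ C) {s : ℝ} (hs : s ∈ Ioc 0 T)
    (hyz : D.y s < D.z s) (ξ : ℝ) : |D.slice U s ξ| ≤ C := by
  rw [slice, indicator]
  split_ifs with h
  · exact hC s hs ξ (Ioo_subset_Icc_self h)
  · rw [abs_zero]
    exact (abs_nonneg _).trans (hC s hs _ (left_mem_Icc.2 hyz.le))

lemma slice_of_mem {U : ℝ → ℝ → ℝ} {s ξ : ℝ} (h : ξ ∈ Ioo (D.y s) (D.z s)) :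
    D.slice U s ξ = U s ξ := indicator_of_mem h _

lemma slice_of_notMem {U : ℝ → ℝ → ℝ} {s ξ : ℝ} (h : ξ ∉ Ioo (D.y s) (D.z s)) :
    D.slice U s ξ = 0 := indicator_of_notMem h _

/-- For `s < τ / 2` the Gaussian is bounded, and so is `U`, on a fixed compact interval. Every `ξ`
other than the two corners is eventually inside or eventually outside the strip, so the unspecified
behaviour at the corners is irrelevant. -/
lemma IsSolution.tendsto_mass_zero {U : ℝ → ℝ → ℝ} (hU : D.IsSolution T U) (hD : D.Admissible T)
    (hτ : τ ∈ Ioc 0 T) (c : ℝ) :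
    Tendsto (D.mass τ c U) (𝓝[>] 0)
      (𝓝 (∫ ξ in Ioo (D.y 0) (D.z 0), D.U0 ξ * ctrK τ c ξ 0)) := by
  have hT : 0 < T := hτ.1.trans_le hτ.2
  have h0T : (0 : ℝ) ∈ Icc 0 T := ⟨le_rfl, hT.le⟩
  obtain ⟨C, hC⟩ := hU.bounded
  obtain ⟨M1, hM1⟩ := isCompact_Icc.exists_bound_of_continuousOn hD.y_cont
  obtain ⟨M2, hM2⟩ := isCompact_Icc.exists_bound_of_continuousOn hD.z_cont
  have hfilter : 𝓝[>] (0 : ℝ) ≤ 𝓝[Icc 0 T] 0 := nhdsWithin_le_of_mem (Icc_mem_nhdsGT hT)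
  have ty : Tendsto D.y (𝓝[>] 0) (𝓝 (D.y 0)) := (hD.y_cont 0 h0T).tendsto.mono_left hfilter
  have tz : Tendsto D.z (𝓝[>] 0) (𝓝 (D.z 0)) := (hD.z_cont 0 h0T).tendsto.mono_left hfilter
  have hev : ∀ᶠ s in 𝓝[>] (0 : ℝ), s ∈ Ioo 0 (τ / 2) := Ioo_mem_nhdsGT (half_pos hτ.1)
  have hsT : ∀ {s}, s ∈ Ioo 0 (τ / 2) → s ∈ Ioc 0 T := fun hs =>
    ⟨hs.1, by linarith [hs.2, hτ.1, hτ.2]⟩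
  have hlt : ∀ {s}, s ∈ Ioo 0 (τ / 2) → D.y s < D.z s := fun hs =>
    hD.y_lt_z _ (Ioc_subset_Icc_self (hsT hs))
  have e0 : ∫ ξ in Ioo (D.y 0) (D.z 0), D.U0 ξ * ctrK τ c ξ 0
      = ∫ ξ, (Ioo (D.y 0) (D.z 0)).indicator D.U0 ξ * gaussK τ (c - ξ) := by
    rw [← integral_indicator measurableSet_Ioo]
    refine integral_congr_ae (Eventually.of_forall fun ξ => ?_)
    simp only [ctrK, indicator, sub_zero]
    split_ifs <;> simp
  rw [e0]
  refine Tendsto.congr' (hev.mono fun s hs => (mass_eq_integral_slice (hlt hs)).symm) ?_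
  refine tendsto_integral_filter_of_dominated_convergence
    ((Icc (-(M1 + M2)) (M1 + M2)).indicator fun _ => C * (1 / √(τ / 2))) ?_ ?_ ?_ ?_
  · filter_upwards [hev] with s hs
    refine ((hU.measurable_slice (hsT hs)).mul ?_).aestronglyMeasurable
    exact measurable_gaussK.comp (f := fun ξ => (τ - s, c - ξ)) (by fun_prop)
  · filter_upwards [hev] with s hs
    refine Eventually.of_forall fun ξ => ?_
    have hC0 : 0 ≤ C := (abs_nonneg _).trans
      (hC s (hsT hs) _ (left_mem_Icc.2 (hlt hs).le))
    by_cases hξ : ξ ∈ Ioo (D.y s) (D.z s)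
    · have hmem : ξ ∈ Icc (-(M1 + M2)) (M1 + M2) := by
        have a1 := hM1 s (Ioc_subset_Icc_self (hsT hs))
        have a2 := hM2 s (Ioc_subset_Icc_self (hsT hs))
        rw [Real.norm_eq_abs] at a1 a2
        have := (abs_nonneg _).trans a1
        have := (abs_nonneg _).trans a2
        rw [abs_le] at a1 a2
        constructor <;> linarith [hξ.1, hξ.2]
      have hσ : 0 < τ - s := by linarith [hs.2, hτ.1]
      rw [indicator_of_mem hmem, norm_mul, Real.norm_of_nonneg (gaussK_nonneg _ _)]
      have b1 := abs_slice_le hC (hsT hs) (hlt hs) ξ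
      have b2 : gaussK (τ - s) (c - ξ) ≤ 1 / √(τ / 2) := by
        refine (gaussK_le_inv_sqrt hσ _).trans ?_
        have : 0 < √(τ / 2) := Real.sqrt_pos.2 (half_pos hτ.1)
        have : √(τ / 2) ≤ √(τ - s) := Real.sqrt_le_sqrt (by linarith [hs.2])
        gcongr
      exact mul_le_mul b1 b2 (gaussK_nonneg _ _) hC0
    · rw [slice_of_notMem hξ, zero_mul, norm_zero]
      exact indicator_nonneg (fun _ _ => by positivity) _
  · exact (integrable_indicator_iff measurableSet_Icc).2
      (integrableOn_const (by simp [Real.volume_Icc]))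
  · have hini := (ae_restrict_iff' measurableSet_Ioo).1 hU.initial
    have ny : ∀ᵐ ξ : ℝ, ξ ≠ D.y 0 := compl_mem_ae_iff.2 (measure_singleton _)
    have nz : ∀ᵐ ξ : ℝ, ξ ≠ D.z 0 := compl_mem_ae_iff.2 (measure_singleton _)
    filter_upwards [hini, ny, nz] with ξ hξ hy hz
    have tK : Tendsto (fun s => gaussK (τ - s) (c - ξ)) (𝓝[>] 0) (𝓝 (gaussK τ (c - ξ))) := by
      have h1 : ContinuousAt (fun s => gaussK (τ - s) (c - ξ)) 0 :=
        (hasDerivAt_gaussK_curve (τ := τ) (s := 0) hτ.1 (hasDerivAt_const 0 ξ)).continuousAt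
      simpa using h1.tendsto.mono_left (nhdsWithin_le_nhds (s := Ioi 0))
    refine Tendsto.mul ?_ tK
    by_cases hin : ξ ∈ Ioo (D.y 0) (D.z 0)
    · rw [indicator_of_mem hin]
      refine (hξ hin).congr' ?_
      filter_upwards [ty.eventually (gt_mem_nhds hin.1), tz.eventually (lt_mem_nhds hin.2)]
        with s h1 h2
      exact (slice_of_mem ⟨h1, h2⟩).symm
    · rw [indicator_of_notMem hin]
      refine tendsto_const_nhds.congr' ?_
      have hout : ξ < D.y 0 ∨ D.z 0 < ξ := by
        by_contra! hcon
        exact hin ⟨lt_of_le_of_ne hcon.1 hy.symm, lt_of_le_of_ne hcon.2 hz⟩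
      rcases hout with ho | ho
      · filter_upwards [ty.eventually (lt_mem_nhds ho)] with s hs
        exact (slice_of_notMem fun h => (h.1.trans hs).false).symm
      · filter_upwards [tz.eventually (gt_mem_nhds ho)] with s hs
        exact (slice_of_notMem fun h => (hs.trans h.2).false).symm

lemma integral_mul_gaussK {σ : ℝ} (hσ : 0 < σ) (c : ℝ) (g : ℝ → ℝ) :
    ∫ ξ, g ξ * gaussK σ (c - ξ) = ∫ w, g (c + 2 * √σ * w) * (1 / √π * exp (-w ^ 2)) := by
  have hs : 0 < √σ := Real.sqrt_pos.2 hσ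
  have h1 := Measure.integral_comp_mul_left
    (fun ξ => g (c + ξ) * gaussK σ (c - (c + ξ))) (2 * √σ)
  rw [integral_add_left_eq_self (fun ξ => g ξ * gaussK σ (c - ξ)) c, smul_eq_mul,
    abs_of_pos (by positivity)] at h1
  have h2 : ∀ w, g (c + 2 * √σ * w) * (1 / √π * exp (-w ^ 2))
      = 2 * √σ * (g (c + 2 * √σ * w) * gaussK σ (c - (c + 2 * √σ * w))) := by
    intro w
    rw [sub_add_cancel_left, gaussK_neg, gaussK_eq_scaled hσ]
    have : 0 < √π := Real.sqrt_pos.2 pi_pos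
    field_simp
  simp only [h2]
  rw [integral_const_mul, h1]
  field_simp

/-- Under the scaling `ξ = c + 2 √(τ - s) w` the Gaussian becomes a fixed probability density, and
boundedness of `U` supplies the domination. -/
lemma IsSolution.tendsto_mass_of_slice {U : ℝ → ℝ → ℝ} (hU : D.IsSolution T U)
    (hD : D.Admissible T) (hτ : τ ∈ Ioc 0 T) {c m : ℝ}
    (hlim : ∀ w, Tendsto (fun s => D.slice U s (c + 2 * √(τ - s) * w)) (𝓝[<] τ) (𝓝 m)) :
    Tendsto (D.mass τ c U) (𝓝[<] τ) (𝓝 m) := by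
  obtain ⟨C, hC⟩ := hU.bounded
  have hev : ∀ᶠ s in 𝓝[<] τ, s ∈ Ioo 0 τ := Ioo_mem_nhdsLT hτ.1
  have hsT : ∀ {s}, s ∈ Ioo 0 τ → s ∈ Ioc 0 T := fun hs => ⟨hs.1, hs.2.le.trans hτ.2⟩
  have hlt : ∀ {s}, s ∈ Ioo 0 τ → D.y s < D.z s := fun hs =>
    hD.y_lt_z _ (Ioc_subset_Icc_self (hsT hs))
  have hI : ∫ w : ℝ, m * (1 / √π * exp (-w ^ 2)) = m := by
    have := integral_gaussian 1
    simp only [neg_mul, one_mul, div_one] at this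
    rw [integral_const_mul, integral_const_mul, this]
    have : 0 < √π := Real.sqrt_pos.2 pi_pos
    field_simp
  have hint : Integrable (fun w : ℝ => 1 / √π * exp (-w ^ 2)) := by
    have := (integrable_exp_neg_mul_sq (b := 1) one_pos).const_mul (1 / √π)
    simpa using this
  rw [← hI]
  refine Tendsto.congr' (hev.mono fun s hs => ((mass_eq_integral_slice (hlt hs)).trans
    (integral_mul_gaussK (sub_pos.2 hs.2) c _)).symm) ?_
  refine tendsto_integral_filter_of_dominated_convergence
    (fun w => C * (1 / √π * exp (-w ^ 2))) ?_ ?_ (hint.const_mul C) ?_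
  · filter_upwards [hev] with s hs
    exact (((hU.measurable_slice (hsT hs)).comp (by fun_prop)).mul
      (by fun_prop)).aestronglyMeasurable
  · filter_upwards [hev] with s hs
    refine Eventually.of_forall fun w => ?_
    have h0 : 0 ≤ 1 / √π * exp (-w ^ 2) := by positivity
    rw [norm_mul, Real.norm_of_nonneg h0]
    exact mul_le_mul_of_nonneg_right (abs_slice_le hC (hsT hs) (hlt hs) _) h0
  · exact Eventually.of_forall fun w => (hlim w).mul_const _

lemma Admissible.tendsto_boundaries (hD : D.Admissible T) (hτ : τ ∈ Ioc 0 T) :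
    Tendsto D.y (𝓝[<] τ) (𝓝 (D.y τ)) ∧ Tendsto D.z (𝓝[<] τ) (𝓝 (D.z τ)) := by
  have hfilter : 𝓝[<] τ ≤ 𝓝[Icc 0 T] τ := nhdsWithin_le_of_mem
    (mem_of_superset (Icc_mem_nhdsLT hτ.1) (Icc_subset_Icc_right hτ.2))
  exact ⟨(hD.y_cont τ (Ioc_subset_Icc_self hτ)).tendsto.mono_left hfilter,
    (hD.z_cont τ (Ioc_subset_Icc_self hτ)).tendsto.mono_left hfilter⟩

lemma tendsto_parabolic (τ c w : ℝ) :
    Tendsto (fun s => c + 2 * √(τ - s) * w) (𝓝[<] τ) (𝓝 c) := by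
  have : Continuous fun s => c + 2 * √(τ - s) * w := by fun_prop
  simpa using (this.tendsto τ).mono_left (nhdsWithin_le_nhds (s := Iio τ))

lemma IsSolution.tendsto_mass_interior {U : ℝ → ℝ → ℝ} (hU : D.IsSolution T U)
    (hD : D.Admissible T) (hτ : τ ∈ Ioc 0 T) {c : ℝ} (hc : c ∈ Ioo (D.y τ) (D.z τ)) :
    Tendsto (D.mass τ c U) (𝓝[<] τ) (𝓝 (U τ c)) := by
  obtain ⟨ty, tz⟩ := hD.tendsto_boundaries hτ
  refine hU.tendsto_mass_of_slice hD hτ fun w => ?_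
  have tw := tendsto_parabolic τ c w
  have hin : ∀ᶠ s in 𝓝[<] τ, s ∈ Ioc 0 T ∧ c + 2 * √(τ - s) * w ∈ Ioo (D.y s) (D.z s) := by
    filter_upwards [Ioo_mem_nhdsLT hτ.1, ty.eventually_lt tw hc.1, tw.eventually_lt tz hc.2]
      with s h0 h1 h2
    exact ⟨⟨h0.1, h0.2.le.trans hτ.2⟩, h1, h2⟩
  have hcont := hU.cont (τ, c) ⟨hτ, Ioo_subset_Icc_self hc⟩
  have htend : Tendsto (fun s => (s, c + 2 * √(τ - s) * w)) (𝓝[<] τ)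
      (𝓝[{p : ℝ × ℝ | p.1 ∈ Ioc 0 T ∧ p.2 ∈ Icc (D.y p.1) (D.z p.1)}] (τ, c)) :=
    tendsto_nhdsWithin_iff.2 ⟨(tendsto_id'.2 nhdsWithin_le_nhds).prodMk_nhds tw,
      hin.mono fun s hs => ⟨hs.1, Ioo_subset_Icc_self hs.2⟩⟩
  exact (hcont.tendsto.comp htend).congr' (hin.mono fun s hs => (slice_of_mem hs.2).symm)

lemma IsSolution.tendsto_mass_exterior {U : ℝ → ℝ → ℝ} (hU : D.IsSolution T U)
    (hD : D.Admissible T) (hτ : τ ∈ Ioc 0 T) {c : ℝ} (hc : c < D.y τ ∨ D.z τ < c) :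
    Tendsto (D.mass τ c U) (𝓝[<] τ) (𝓝 0) := by
  obtain ⟨ty, tz⟩ := hD.tendsto_boundaries hτ
  refine hU.tendsto_mass_of_slice hD hτ fun w => tendsto_const_nhds.congr' ?_
  have tw := tendsto_parabolic τ c w
  rcases hc with hc | hc
  · filter_upwards [tw.eventually_lt ty hc] with s hs
    exact (slice_of_notMem fun h => (h.1.trans hs).false).symm
  · filter_upwards [tz.eventually_lt tw hc] with s hs
    exact (slice_of_notMem fun h => (hs.trans h.2).false).symm

/-! ### The representation of a solution -/

/-- Green's identity between `a` and `b`, with `a → 0` and then `b → τ`. Domination makes the time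
integrand integrable up to both ends, so its primitive is continuous there. -/
lemma IsSolution.Rep_ctr {U : ℝ → ℝ → ℝ} (hU : D.IsSolution T U) (hD : D.Admissible T)
    (hτ : τ ∈ Ioc 0 T) {c m C : ℝ} (hdom : D.Dominated τ C (D.curve (ctrK τ c) (ctrL τ c)))
    (hm : Tendsto (D.mass τ c U) (𝓝[<] τ) (𝓝 m)) :
    D.Rep τ (D.curve (ctrK τ c) (ctrL τ c)) = m := by
  have hint := hdom.intervalIntegrable hD hτ
  have i1 : IntervalIntegrable (fun s => D.wgt 1 s * ctrK τ c (D.z s) s) volume 0 τ := hint 1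
  have i2 : IntervalIntegrable (fun s => D.wgt 2 s * ctrK τ c (D.y s) s) volume 0 τ := hint 2
  have i3 : IntervalIntegrable (fun s => D.wgt 3 s * ctrL τ c (D.y s) s) volume 0 τ := hint 3
  have i4 : IntervalIntegrable (fun s => D.wgt 4 s * ctrL τ c (D.z s) s) volume 0 τ := hint 4
  set G : ℝ → ℝ := fun s => D.wgt 1 s * ctrK τ c (D.z s) s + D.wgt 2 s * ctrK τ c (D.y s) s
          + D.wgt 3 s * ctrL τ c (D.y s) s + D.wgt 4 s * ctrL τ c (D.z s) s with hG
  have iG : IntervalIntegrable G volume 0 τ := ((i1.add i2).add i3).add i4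
  have hP := intervalIntegral.continuousOn_primitive_interval' iG left_mem_uIcc
  rw [uIcc_of_le hτ.1.le] at hP
  have sub : ∀ {p q}, p ∈ Icc 0 τ → q ∈ Icc 0 τ → IntervalIntegrable G volume p q :=
    fun hp hq => iG.mono_set (by rw [uIcc_of_le hτ.1.le]; exact uIcc_subset_Icc hp hq)
  set m0 := ∫ ξ in Ioo (D.y 0) (D.z 0), D.U0 ξ * ctrK τ c ξ 0 with hm0
  have z0 : (0 : ℝ) ∈ Icc 0 τ := ⟨le_rfl, hτ.1.le⟩
  have step : ∀ b ∈ Ioo 0 τ, D.mass τ c U b = m0 + ∫ s in (0)..b, G s := by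
    intro b hb
    have t1 : Tendsto (fun a => D.mass τ c U a + ((∫ s in (0)..b, G s) - ∫ s in (0)..a, G s))
        (𝓝[>] 0) (𝓝 (m0 + ((∫ s in (0)..b, G s) - ∫ s in (0)..0, G s))) := by
      refine (hU.tendsto_mass_zero hD hτ c).add (tendsto_const_nhds.sub ?_)
      exact (hP 0 z0).tendsto.mono_left (nhdsWithin_le_of_mem (Icc_mem_nhdsGT hτ.1))
    rw [intervalIntegral.integral_same, sub_zero] at t1
    refine tendsto_nhds_unique (tendsto_const_nhds.congr' ?_) t1
    filter_upwards [Ioo_mem_nhdsGT hb.1] with a ha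
    have ha' : a ∈ Icc 0 τ := ⟨ha.1.le, (ha.2.trans hb.2).le⟩
    have := hU.green hD hτ c ha.1 ha.2.le hb.2
    rw [intervalIntegral.integral_interval_sub_left (sub z0 ⟨hb.1.le, hb.2.le⟩) (sub z0 ha'),
      ← this]
    ring
  have t2 : Tendsto (D.mass τ c U) (𝓝[<] τ) (𝓝 (m0 + ∫ s in (0)..τ, G s)) := by
    have h1 := (hP τ ⟨hτ.1.le, le_rfl⟩).tendsto.mono_left
      (nhdsWithin_le_of_mem (Icc_mem_nhdsLT hτ.1))
    refine (h1.const_add m0).congr' ?_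
    filter_upwards [Ioo_mem_nhdsLT hτ.1] with b hb using (step b hb).symm
  rw [tendsto_nhds_unique hm t2, hG, intervalIntegral.integral_add ((i1.add i2).add i3) i4,
    intervalIntegral.integral_add (i1.add i2) i3, intervalIntegral.integral_add i1 i2]
  have e {f : ℝ → ℝ} : ∫ s in (0)..τ, f s = ∫ s in Ioo 0 τ, f s := by
    rw [intervalIntegral.integral_of_le hτ.1.le, integral_Ioc_eq_integral_Ioo]
  rw [Rep, Fin.sum_univ_five, e, e, e, e, ← add_assoc, ← add_assoc, ← add_assoc]
  rfl

/-- The reflected centre always lies outside `[y τ, z τ]`, and the direct centre `x + 2nl` does so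
unless `n = 0`. -/
lemma IsSolution.imageTerm_eq {U : ℝ → ℝ → ℝ} (hU : D.IsSolution T U) (hD : D.Admissible T)
    (hτ : τ ∈ Ioc 0 T) {x : ℝ} (hx : x ∈ Ioo (D.y τ) (D.z τ)) (n : ℤ) :
    D.imageTerm τ x n = if n = 0 then U τ x else 0 := by
  have hl : 0 < D.l τ := sub_pos.2 (hx.1.trans hx.2)
  have hz : D.z τ = D.y τ + D.l τ := by rw [l]; ring
  have hctr : ∀ c, c ≠ D.y τ → c ≠ D.z τ → ∃ C,
      D.Dominated τ C (D.curve (ctrK τ c) (ctrL τ c)) := by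
    intro c h1 h2
    obtain ⟨B, -, hB⟩ := hD.exists_dominated_ctr hτ
      (lt_min (abs_pos.2 (sub_ne_zero.2 h1)) (abs_pos.2 (sub_ne_zero.2 h2)))
    exact ⟨_, hB c (min_le_left _ _) (min_le_right _ _)⟩
  have hn : n ≤ -1 ∨ n = 0 ∨ 1 ≤ n := by lia
  have hx2 := hx.2
  rw [hz] at hx2
  set c1 := 2 * n * D.l τ + x with hc1
  set c2 := 2 * D.y τ - x - 2 * n * D.l τ with hc2
  have out2 : c2 < D.y τ ∨ D.z τ < c2 := by
    rw [hz]
    rcases le_or_gt 0 n with h | h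
    · have : (0 : ℝ) ≤ n := by exact_mod_cast h
      left; nlinarith [hx.1]
    · have : (n : ℝ) ≤ -1 := by exact_mod_cast Int.le_sub_one_of_lt h
      right; nlinarith
  have ne2 : c2 ≠ D.y τ ∧ c2 ≠ D.z τ := by
    have := hx.1.trans hx.2
    rcases out2 with h | h
    · exact ⟨h.ne, (h.trans this).ne⟩
    · exact ⟨(this.trans h).ne', h.ne'⟩
  obtain ⟨C2, hC2⟩ := hctr c2 ne2.1 ne2.2
  have r2 := hU.Rep_ctr hD hτ hC2 (hU.tendsto_mass_exterior hD hτ out2)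
  obtain ⟨C1, hC1, r1⟩ : ∃ C, D.Dominated τ C (D.curve (ctrK τ c1) (ctrL τ c1)) ∧
      D.Rep τ (D.curve (ctrK τ c1) (ctrL τ c1)) = if n = 0 then U τ x else 0 := by
    by_cases hn0 : n = 0
    · have e1 : c1 = x := by simp [hc1, hn0]
      rw [e1, if_pos hn0]
      obtain ⟨C, hC⟩ := hctr x hx.1.ne' hx.2.ne
      exact ⟨C, hC, hU.Rep_ctr hD hτ hC (hU.tendsto_mass_interior hD hτ hx)⟩
    · have out1 : c1 < D.y τ ∨ D.z τ < c1 := by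
        rw [hz]
        rcases hn with h | h | h
        · have : (n : ℝ) ≤ -1 := by exact_mod_cast h
          left; nlinarith
        · exact absurd h hn0
        · have : (1 : ℝ) ≤ n := by exact_mod_cast h
          right; nlinarith [hx.1]
      have ne1 : c1 ≠ D.y τ ∧ c1 ≠ D.z τ := by
        have := hx.1.trans hx.2
        rcases out1 with h | h
        · exact ⟨h.ne, (h.trans this).ne⟩
        · exact ⟨(this.trans h).ne', h.ne'⟩
      obtain ⟨C, hC⟩ := hctr c1 ne1.1 ne1.2
      rw [if_neg hn0]
      exact ⟨C, hC, hU.Rep_ctr hD hτ hC (hU.tendsto_mass_exterior hD hτ out1)⟩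
  obtain ⟨B, -, hB⟩ := hD.exists_dominated_image_interior hτ hx
  rw [imageTerm_eq_Rep hD hτ (hB n), imageKer_eq, Rep_sub hD hτ hC1 hC2, r1, r2, sub_zero]

end BarrierData

end

/-! ### Assembly of the three claims -/

theorem mainTheorem2 (T : ℝ) (hT : 0 < T) (D : BarrierData) (hD : D.Admissible T) :
    -- the image series converges and equals the Fourier form inside the strip
    (∀ τ ∈ Ioc 0 T, ∀ x ∈ Ioo (D.y τ) (D.z τ),
      (∀ n : ℤ, D.ImageIntegrable τ x n) ∧
      (∀ n : ℕ, 1 ≤ n → D.FourierIntegrable τ n) ∧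
      Summable (fun n : ℤ => D.imageTerm τ x n) ∧
      Tendsto (fun N : ℕ => ∑ n ∈ Finset.Icc 1 N, D.fourierTerm τ x n) atTop
        (𝓝 (∑' n : ℤ, D.imageTerm τ x n))) ∧
    -- its one-sided limits at the two boundaries
    (∀ τ ∈ Ioc 0 T,
      Tendsto (fun x => ∑' n : ℤ, D.imageTerm τ x n) (𝓝[>] (D.y τ)) (𝓝 (D.fm τ)) ∧
      Tendsto (fun x => ∑' n : ℤ, D.imageTerm τ x n) (𝓝[<] (D.z τ)) (𝓝 (D.fp τ))) ∧
    -- the solution of the problem is represented by the image series and by the Fourier form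
    (∀ U : ℝ → ℝ → ℝ, D.IsSolution T U →
      ∀ τ ∈ Ioc 0 T, ∀ x ∈ Ioo (D.y τ) (D.z τ),
        HasSum (fun n : ℤ => D.imageTerm τ x n) (U τ x) ∧
        Tendsto (fun N : ℕ => ∑ n ∈ Finset.Icc 1 N, D.fourierTerm τ x n) atTop (𝓝 (U τ x))) := by
  refine ⟨fun τ hτ x hx => ?_, fun τ hτ => ?_, fun U hU τ hτ x hx => ?_⟩
  · obtain ⟨B, -, hB⟩ := hD.exists_dominated_image_interior hτ hx
    have hsum := hD.hasSum_imageTerm hτ hx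
    refine ⟨fun n => D.imageIntegrable_of_dominated hD hτ (hB n),
      fun n _ => hD.fourierIntegrable hτ n, hsum.summable, ?_⟩
    rw [hsum.tsum_eq]
    exact hD.tendsto_fourierTerm hτ hx
  · have hlt := hD.y_lt_z τ (Ioc_subset_Icc_self hτ)
    constructor
    · refine (hD.tendsto_Rep_lower hτ).congr' ?_
      filter_upwards [Ioo_mem_nhdsGT hlt] with x hx using (hD.hasSum_imageTerm hτ hx).tsum_eq.symm
    · refine (hD.tendsto_Rep_upper hτ).congr' ?_
      filter_upwards [Ioo_mem_nhdsLT hlt] with x hx using (hD.hasSum_imageTerm hτ hx).tsum_eq.symm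
  -- For a solution the image series has at most one nonzero term; the Fourier limit then follows by
  -- uniqueness of the image sum.
  · have h : HasSum (fun n : ℤ => D.imageTerm τ x n) (U τ x) := by
      simp only [hU.imageTerm_eq hD hτ hx]
      exact hasSum_ite_eq 0 (U τ x)
    have hlim := hD.tendsto_fourierTerm hτ hx
    rw [(hD.hasSum_imageTerm hτ hx).unique h] at hlim
    exact ⟨h, hlim⟩
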